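/- Let $Y=\prod_{i=1}^N(0,T_i)$ with all $T_i>0$. Let $A=A(y,\xi)\in\mathbb R^N$ be a flux that is $Y$-periodic in $y$, belongs to $W^{2,\infty}_{\rm loc}(\mathbb R^N\times\mathbb R)$ and satisfies $\mathrm{div}_yA(\cdot,\xi)=0$ for every $\xi$; set $a(y,\xi)=\partial_\xi A(y,\xi)$. Let $u_0\in L^1\cap L^\infty(\mathbb R^N\times Y)$, $M=\|u_0\|_{L^\infty(\mathbb R^N\times Y)}$, $\chi(\xi,u)=\mathbf 1_{0<\xi<u}-\mathbf 1_{u<\xi<0}$ and $f_0(x,y,\xi)=\chi(\xi,u_0(x,y))$. Let $\mathcal K$ be the set of all $\varphi\in L^2(Y\times\mathbb R)$ supported in $Y\times[-M,M]$ such that, in the sense of distributions that are $Y$-periodic in $y$, $\mathrm{div}_y(a\varphi)=0$ and $\partial_\xi\varphi=\delta(\xi)-\nu$ for some non-negative $Y$-periodic Radon measure $\nu$. For $T>0$ let $X_T=C([0,T],L^2(\mathbb R^N_x\times Y\times\mathbb R_\xi))$ with the supremum norm. The set $\mathcal K$ is non-empty, closed and convex in $L^2(Y\times\mathbb R)$;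 let $\mathcal P$ be the projection of $L^2(Y\times\mathbb R)$ onto $\mathcal K$, and put $\mathcal P(f)(t,x,\cdot)=\mathcal P(f(t,x,\cdot))$. For all $\lambda,T>0$ there is a unique $f_\lambda\in X_T$ such that $$\partial_tf_\lambda+a(y,\xi)\cdot\nabla_xf_\lambda+\lambda f_\lambda=\lambda\mathcal P(f_\lambda)\ \text{ in the sense of distributions on }(0,T)\times\mathbb R^N\times Y\times\mathbb R,\qquad f_\lambda(0)=f_0 .$$ It has the following properties. 1. For all $t\in[0,T]$ and almost all $(x,y,\xi)$: $f_\lambda(t,x,y,\xi)=0$ if $|\xi|\ge M$, and $\mathrm{sgn}(\xi)f_\lambda(t,x,y,\xi)=|f_\lambda(t,x,y,\xi)|\le1$. 2. $\|f_\lambda\|_{X_T}\le\|u_0\|_{L^1(\mathbb R^N\times Y)}^{1/2}$. 3. If moreover $u_0$ is well-prepared, that is, $\mathrm{div}_y\big(a(y,\xi)\chi(\xi,u_0(x,y))\big)=0$ in the sense of ($Y$-periodic) distributions on $Y\times\mathbb R$ for almost every $x$, then there is a function $\omega:[0,\infty)\to[0,\infty)$, independent of $\lambda$ and $T$, with $\lim_{t\to0^+}\omega(t)=0$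 and $\|f_\lambda(t)-f_0\|_{L^1(\mathbb R^N\times Y\times\mathbb R)}\le\omega(t)$ for all $\lambda,T>0$ and $t\in[0,T]$. 4. Let $\mathcal M_\lambda=\lambda(\mathcal P(f_\lambda)-f_\lambda)$. For every $g\in\mathcal K$, every $t\in[0,T]$ and almost every $x$, $\int_{Y\times\mathbb R}\mathcal M_\lambda(t,x,\cdot)\,\big(\mathcal P(f_\lambda)(t,x,\cdot)-g\big)\,dy\,d\xi\le0$. -/

import Mathlib

open MeasureTheory Set Filter Topology
open scoped NNReal ENNReal ContDiff

noncomputable section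

/-- The space `ℝ^N` with its Euclidean structure. -/
abbrev E (N : ℕ) : Type := EuclideanSpace ℝ (Fin N)

/-- The periodicity cell `Y = ∏ (0, L i)`, taken half-open so that it is a fundamental domain of
the lattice `∏ (L i) ℤ`; it differs from the open box by a null set. -/
def cell {N : ℕ} (L : Fin N → ℝ) : Set (E N) := {y | ∀ i, 0 ≤ y i ∧ y i < L i}

/-- Lebesgue measure on `Y`. -/
def cellMeasure {N : ℕ} (L : Fin N → ℝ) : Measure (E N) := volume.restrict (cell L)

/-- Lebesgue measure `dy dξ` on `Y × ℝ`. -/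
def measYXi {N : ℕ} (L : Fin N → ℝ) : Measure (E N × ℝ) := (cellMeasure L).prod volume

/-- Lebesgue measure `dx dy` on `ℝ^N × Y`. -/
def measXY {N : ℕ} (L : Fin N → ℝ) : Measure (E N × E N) :=
  (volume : Measure (E N)).prod (cellMeasure L)

/-- Lebesgue measure `dx dy dξ` on `ℝ^N × Y × ℝ`; a point is written `(x, y, ξ)`. -/
def measXYXi {N : ℕ} (L : Fin N → ℝ) : Measure (E N × E N × ℝ) :=
  (volume : Measure (E N)).prod (measYXi L)

/-- `L²(Y × ℝ)`. -/
abbrev L2YXi {N : ℕ} (L : Fin N → ℝ) : Type := Lp ℝ 2 (measYXi L)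

/-- `L²(ℝ^N × Y × ℝ)`. -/
abbrev L2XYXi {N : ℕ} (L : Fin N → ℝ) : Type := Lp ℝ 2 (measXYXi L)

/-- `X_T = C([0,T], L²(ℝ^N × Y × ℝ))`, with its supremum norm. -/
abbrev XT {N : ℕ} (L : Fin N → ℝ) (T : ℝ) : Type := C(Set.Icc (0 : ℝ) T, L2XYXi L)

/-- A divergence-free flux `A(y, ξ)`: it is `Y`-periodic in `y`, it belongs to `W^{2,∞}_loc`
(that is, it is `C¹` with locally Lipschitz derivative), and `div_y A(·, ξ) = 0` for all `ξ`. -/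
structure IsDivFreeFlux {N : ℕ} (L : Fin N → ℝ) (A : E N × ℝ → E N) : Prop where
  periodic : ∀ (y : E N) (ξ : ℝ) (i : Fin N), A (y + EuclideanSpace.single i (L i), ξ) = A (y, ξ)
  contDiff : ContDiff ℝ 1 A
  lipschitz : LocallyLipschitz (fderiv ℝ A)
  div_eq_zero : ∀ (y : E N) (ξ : ℝ),
    ∑ i, (fderiv ℝ (fun y' => A (y', ξ)) y (EuclideanSpace.single i 1)) i = 0

/-- The kinetic velocity `a(y, ξ) = ∂_ξ A(y, ξ) ∈ ℝ^N`. -/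
def velocity {N : ℕ} (A : E N × ℝ → E N) (y : E N) (ξ : ℝ) : E N :=
  deriv (fun s => A (y, s)) ξ

/-- `χ(ξ, u) = 1_{0 < ξ < u} - 1_{u < ξ < 0}`. -/
def chi (ξ u : ℝ) : ℝ :=
  (if 0 < ξ ∧ ξ < u then 1 else 0) - (if u < ξ ∧ ξ < 0 then 1 else 0)

/-- Test functions on `Y × ℝ`: smooth on `ℝ^N × ℝ`, `Y`-periodic in `y`, compactly supported
in `ξ`. -/
structure IsTestYXi {N : ℕ} (L : Fin N → ℝ) (ψ : E N × ℝ → ℝ) : Prop where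
  smooth : ContDiff ℝ ∞ ψ
  periodic : ∀ (y : E N) (ξ : ℝ) (i : Fin N), ψ (y + EuclideanSpace.single i (L i), ξ) = ψ (y, ξ)
  support : ∃ R : ℝ, ∀ (y : E N) (ξ : ℝ), ψ (y, ξ) ≠ 0 → |ξ| ≤ R

/-- `div_y (a φ) = 0` in the sense of (periodic) distributions on `Y × ℝ`. -/
def IsDivFree {N : ℕ} (L : Fin N → ℝ) (A : E N × ℝ → E N) (φ : E N × ℝ → ℝ) : Prop :=
  ∀ ψ : E N × ℝ → ℝ, IsTestYXi L ψ →
    ∫ w, φ w * fderiv ℝ (fun y' => ψ (y', w.2)) w.1 (velocity A w.1 w.2) ∂(measYXi L) = 0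

/-- `∂_ξ φ = δ(ξ) - ν` in the sense of (periodic) distributions on `Y × ℝ`, for some non-negative
`Y`-periodic Radon measure `ν`. A periodic measure is given by its restriction to the fundamental
domain `cell L ×ˢ univ`. -/
def HasKineticDerivative {N : ℕ} (L : Fin N → ℝ) (φ : E N × ℝ → ℝ) : Prop :=
  ∃ ν : Measure (E N × ℝ), IsLocallyFiniteMeasure ν ∧ ν (cell L ×ˢ (univ : Set ℝ))ᶜ = 0 ∧
    ∀ ψ : E N × ℝ → ℝ, IsTestYXi L ψ →
      -∫ w, φ w * deriv (fun s => ψ (w.1, s)) w.2 ∂(measYXi L) =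
        (∫ y, ψ (y, 0) ∂(cellMeasure L)) - ∫ w, ψ w ∂ν

/-- The constraint set `𝒦`: the `φ ∈ L²(Y × ℝ)` supported in `Y × [-M, M]` such that
`div_y (a φ) = 0` and `∂_ξ φ = δ(ξ) - ν` for some `ν ≥ 0`. -/
def constraintSet {N : ℕ} (L : Fin N → ℝ) (A : E N × ℝ → E N) (M : ℝ) : Set (L2YXi L) :=
  {φ | (∀ᵐ w ∂(measYXi L), M < |w.2| → φ w = 0) ∧ IsDivFree L A φ ∧ HasKineticDerivative L φ}

open Classical in
/-- The point of `K` nearest to `f` (with value `0` if there is none); for a non-empty closed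
convex subset of a Hilbert space this is the projection onto `K`. -/
def metricProj {H : Type*} [NormedAddCommGroup H] (K : Set H) (f : H) : H :=
  if h : ∃ p ∈ K, ∀ q ∈ K, ‖f - p‖ ≤ ‖f - q‖ then h.choose else 0

open Classical in
/-- The slice `F(x, ·) ∈ L²(Y × ℝ)` of `F ∈ L²(ℝ^N × Y × ℝ)`, defined for almost every `x`. -/
def slice {N : ℕ} {L : Fin N → ℝ} (F : L2XYXi L) (x : E N) : L2YXi L :=
  if h : MemLp (fun w => F (x, w)) 2 (measYXi L) then h.toLp _ else 0

/-- `G = 𝒫(F)`, where the projection `𝒫` onto `K` acts on the variables `(y, ξ)` only: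
`G(x, ·) = 𝒫(F(x, ·))` for almost every `x`. -/
def IsSliceProj {N : ℕ} {L : Fin N → ℝ} (K : Set (L2YXi L)) (F G : L2XYXi L) : Prop :=
  ∀ᵐ x : E N, slice G x = metricProj K (slice F x)

/-- Test functions on `(0,T) × ℝ^N × Y × ℝ`: smooth functions of `(t, x, y, ξ)`, `Y`-periodic in
`y`, compactly supported in `(t, x, ξ) ∈ (0,T) × ℝ^N × ℝ`. -/
structure IsEvolTest {N : ℕ} (L : Fin N → ℝ) (T : ℝ) (φ : ℝ × E N × E N × ℝ → ℝ) : Prop where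
  smooth : ContDiff ℝ ∞ φ
  periodic : ∀ (t : ℝ) (x y : E N) (ξ : ℝ) (i : Fin N),
    φ (t, x, y + EuclideanSpace.single i (L i), ξ) = φ (t, x, y, ξ)
  support : ∃ δ > 0, ∃ R : ℝ, ∀ (t : ℝ) (x y : E N) (ξ : ℝ), φ (t, x, y, ξ) ≠ 0 →
    δ ≤ t ∧ t ≤ T - δ ∧ ‖x‖ ≤ R ∧ |ξ| ≤ R

/-- The initial datum `f₀(x, y, ξ) = χ(ξ, u₀(x, y))`. -/
def initialDatum {N : ℕ} (u₀ : E N × E N → ℝ) (z : E N × E N × ℝ) : ℝ :=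
  chi z.2.2 (u₀ (z.1, z.2.1))

/-- `M = ‖u₀‖_{L^∞(ℝ^N × Y)}`. -/
def supNorm {N : ℕ} (L : Fin N → ℝ) (u₀ : E N × E N → ℝ) : ℝ :=
  (eLpNorm u₀ ⊤ (measXY L)).toReal

/-- `f ∈ X_T` solves `∂_t f + a(y,ξ)·∇_x f + lam f = lam 𝒫(f)` in the sense of distributions on
`(0,T) × ℝ^N × Y × ℝ`, with `f(0) = χ(ξ, u₀)`. -/
def IsBGKSolution {N : ℕ} (L : Fin N → ℝ) (A : E N × ℝ → E N) (u₀ : E N × E N → ℝ)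
    (lam T : ℝ) (f : XT L T) : Prop :=
  (∀ t : Set.Icc (0 : ℝ) T, (t : ℝ) = 0 → f t =ᵐ[measXYXi L] initialDatum u₀) ∧
  ∃ g : Set.Icc (0 : ℝ) T → L2XYXi L,
    (∀ t, IsSliceProj (constraintSet L A (supNorm L u₀)) (f t) (g t)) ∧
    ∀ φ : ℝ × E N × E N × ℝ → ℝ, IsEvolTest L T φ →
      ∫ t : Set.Icc (0 : ℝ) T, (∫ z,
        (f t z * (deriv (fun s => φ (s, z)) (t : ℝ)
            + fderiv ℝ (fun x' => φ ((t : ℝ), x', z.2)) z.1 (velocity A z.2.1 z.2.2)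
            - lam * φ ((t : ℝ), z))
          + lam * g t z * φ ((t : ℝ), z)) ∂(measXYXi L))
        ∂((volume : Measure ℝ).comap Subtype.val) = 0

/-- `𝓜_lam(t, x, ·) = lam (𝒫(f(t, x, ·)) - f(t, x, ·)) ∈ L²(Y × ℝ)`, where `F = f(t)`. -/
def relaxTerm {N : ℕ} {L : Fin N → ℝ} (K : Set (L2YXi L)) (lam : ℝ) (F : L2XYXi L) (x : E N) :
    L2YXi L :=
  lam • (metricProj K (slice F x) - slice F x)

end

/-! Free transport S_t F(x, y, ξ) = F(x - t a(y, ξ), y, ξ) is a group of isometries of L²(ℝ^N × Y ×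
ℝ), and the projection P, acting on the slices F(x, ·), is 1-Lipschitz there. Distributional
solutions are exactly the solutions of Duhamel's formula f(t) = e^{-lam t} S_t f₀ + lam ∫₀ᵗ e^{-lam
(t-s)} S_{t-s} P f(s) ds (`isBGKSolution_iff_isMild`). Its right-hand side contracts C([0,T], L²)
with constant 1 - e^{-lam T}, whence existence and uniqueness.

The Duhamel weights are positive and have total mass one. Hence a closed convex set invariant under
every S_t and under P contains the whole solution (`IsMild.mem`), and a fixed point h of P with ‖S_r
h - h‖ ≤ C r satisfies ‖f(t) - h‖ ≤ ‖f₀ - h‖ + C t with no dependence on lam (`IsMild.norm_sub_le`).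
The choice h = 0 is the L² bound. The sign and size bounds, together with the L¹ bound needed for
continuity at t = 0, come from the invariant set `kinSet`.

Three facts about the constraint set carry the rest. The condition ∂_ξ φ = δ - ν with ν ≥ 0 is
equivalent to the family of linear inequalities ∂_ξ φ ≤ δ, and also to monotonicity of 1_{ξ>0} - φ
in ξ; the measure is recovered as a weak limit of difference quotients
(`KinMono.hasKineticDerivative`). So the set is closed and convex, and its members have the sign of
ξ and modulus at most one. Secondly, P is itself the metric projection of L²(ℝ^N × Y × ℝ) onto the
functions with slices in the constraint set (`isSliceProj_sliceProj`), which settles measurability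
in x. Thirdly, P does not increase the L¹ norm (`lintegral_metricProj_le`). For p = P f, a small
multiple of β_n(p), with β_n odd polynomials tending to the sign on [-1, 1], may be subtracted from
p without leaving the set; the variational inequality gives ∫ p β_n(p) ≤ ∫ f β_n(p) ≤ ∫ |f|, and n →
∞ concludes. That β_n(p) still satisfies div_y(a β_n(p)) = 0 is a renormalization property: bounded
solutions form an algebra (`IsDivFree.mul`), by the DiPerna–Lions commutator estimate, since a is
locally Lipschitz and divergence free.

Continuity at t = 0 for well-prepared data: f₀ has its slices in the constraint set, and so do its
mollifications h in x, which are therefore fixed by P and are Lipschitz along S. Comparison with h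
controls ‖f(t) - f₀‖ in L² uniformly in lam and T. The passage to L¹ uses |s - k| = (s - k)² + |s| -
s² for k in {-1, 0, 1} and s of the same sign with |s| ≤ 1, together with the L¹ bound on f(t).

The delicate half of weak ⇔ mild is weak ⇒ mild: the natural test functions κ(t) h(x - t a, y, ξ)
are not smooth, because a is only Lipschitz. Replacing a by a smooth periodic b with |a - b| ≤ ε
gives admissible test functions with an error O(ε) (`exists_evolTest_approx`). -/

open MeasureTheory Set Filter Topology
open scoped NNReal ENNReal ContDiff

noncomputable section

/-! ### Duhamel's formula for an isometry group and a nonexpansive map -/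

section Mild

variable {H : Type*} [NormedAddCommGroup H] [NormedSpace ℝ H]

/-- A strongly continuous one-parameter group of linear isometries. -/
structure IsIsometryGroup (S : ℝ → H →L[ℝ] H) : Prop where
  norm_map : ∀ t v, ‖S t v‖ = ‖v‖
  map_add : ∀ s t v, S (s + t) v = S s (S t v)
  map_zero : ∀ v, S 0 v = v
  continuous_apply : ∀ v, Continuous fun t => S t v

/-- Isometry makes the family equicontinuous, so strong continuity in t upgrades to joint
continuity. -/
theorem IsIsometryGroup.continuous_uncurry {S : ℝ → H →L[ℝ] H} (hS : IsIsometryGroup S) :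
    Continuous fun p : ℝ × H => S p.1 p.2 := by
  rw [continuous_iff_continuousAt]
  rintro ⟨t, v⟩
  rw [ContinuousAt, tendsto_iff_norm_sub_tendsto_zero]
  have h1 : Tendsto (fun p : ℝ × H => ‖p.2 - v‖ + ‖S p.1 v - S t v‖) (𝓝 (t, v)) (𝓝 (0 + 0)) := by
    refine Tendsto.add ?_ ?_
    · have : Continuous fun p : ℝ × H => ‖p.2 - v‖ := by fun_prop
      simpa using this.tendsto (t, v)
    · have : Continuous fun p : ℝ × H => ‖S p.1 v - S t v‖ :=
        (((hS.continuous_apply v).comp continuous_fst).sub continuous_const).norm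
      simpa using this.tendsto (t, v)
  rw [add_zero] at h1
  refine squeeze_zero (fun _ => norm_nonneg _) (fun p => ?_) h1
  calc ‖S p.1 p.2 - S t v‖ = ‖S p.1 (p.2 - v) + (S p.1 v - S t v)‖ := by
        rw [_root_.map_sub]; congr 1; abel
    _ ≤ ‖S p.1 (p.2 - v)‖ + ‖S p.1 v - S t v‖ := norm_add_le _ _
    _ = _ := by rw [hS.norm_map]

/-- The right-hand side of Duhamel's formula for `∂_t f + B f + lam f = lam P f`, where `-B`
generates `S`. -/
def duhamel (S : ℝ → H →L[ℝ] H) (P : H → H) (lam : ℝ) (f₀ : H) (f : ℝ → H) (t : ℝ) : H :=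
  Real.exp (-(lam * t)) • S t (f₀ + lam • ∫ s in (0 : ℝ)..t,
    Real.exp (lam * s) • S (-s) (P (f s)))

/-- Multiplied by e^{-lam t}, this says that the weights of Duhamel's formula, e^{-lam t} on the
datum and lam e^{-lam (t-s)} ds on the source, have total mass one. -/
theorem integral_lam_exp (lam t : ℝ) :
    lam * ∫ s in (0 : ℝ)..t, Real.exp (lam * s) = Real.exp (lam * t) - 1 := by
  rw [← intervalIntegral.integral_const_mul]
  have := intervalIntegral.integral_eq_sub_of_hasDerivAt (a := 0) (b := t)
    (f := fun s => Real.exp (lam * s)) (f' := fun s => lam * Real.exp (lam * s))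
    (fun s _ => by
      have := ((hasDerivAt_id s).const_mul lam).exp
      simpa [mul_comm] using this)
    (Continuous.intervalIntegrable (by fun_prop) _ _)
  simp [this]

theorem continuous_duhamel_integrand {S : ℝ → H →L[ℝ] H} (hS : IsIsometryGroup S) {P : H → H}
    (hP : Continuous P) (lam : ℝ) {f : ℝ → H} (hf : Continuous f) :
    Continuous fun s => Real.exp (lam * s) • S (-s) (P (f s)) := by
  have h1 : Continuous fun s : ℝ => S (-s) (P (f s)) :=
    hS.continuous_uncurry.comp (continuous_neg.prodMk (hP.comp hf))
  exact (by fun_prop : Continuous fun s : ℝ => Real.exp (lam * s)).smul h1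

theorem continuous_duhamel {S : ℝ → H →L[ℝ] H} (hS : IsIsometryGroup S) {P : H → H}
    (hP : Continuous P) (lam : ℝ) (f₀ : H) {f : ℝ → H} (hf : Continuous f) :
    Continuous (duhamel S P lam f₀ f) := by
  have h1 := continuous_duhamel_integrand hS hP lam hf
  have h2 : Continuous fun t => ∫ s in (0 : ℝ)..t, Real.exp (lam * s) • S (-s) (P (f s)) :=
    intervalIntegral.continuous_primitive (fun a b => h1.intervalIntegrable a b) 0
  have h3 : Continuous fun t => S t (f₀ + lam • ∫ s in (0 : ℝ)..t,
      Real.exp (lam * s) • S (-s) (P (f s))) :=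
    hS.continuous_uncurry.comp (continuous_id.prodMk (continuous_const.add (h2.const_smul lam)))
  exact (by fun_prop : Continuous fun t : ℝ => Real.exp (-(lam * t))).smul h3

variable [CompleteSpace H]

/-- Duhamel's formula with the group moved inside the integral. -/
theorem duhamel_eq {S : ℝ → H →L[ℝ] H} (hS : IsIsometryGroup S) {P : H → H}
    (hP : Continuous P) (lam : ℝ) (f₀ : H) {f : ℝ → H} (hf : Continuous f) (t : ℝ) :
    duhamel S P lam f₀ f t = Real.exp (-(lam * t)) • (S t f₀ + lam • ∫ s in (0 : ℝ)..t,
      Real.exp (lam * s) • S (t - s) (P (f s))) := by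
  have h1 := continuous_duhamel_integrand hS hP lam hf
  unfold duhamel
  congr 1
  rw [_root_.map_add, _root_.map_smul,
    ← ContinuousLinearMap.intervalIntegral_comp_comm _ (h1.intervalIntegrable _ _)]
  congr 3
  ext s
  rw [_root_.map_smul, ← hS.map_add, sub_eq_add_neg]

theorem continuous_shifted_integrand {S : ℝ → H →L[ℝ] H} (hS : IsIsometryGroup S) {P : H → H}
    (hP : Continuous P) (lam : ℝ) {f : ℝ → H} (hf : Continuous f) (t : ℝ) :
    Continuous fun s => Real.exp (lam * s) • S (t - s) (P (f s)) := by
  have h1 : Continuous fun s : ℝ => S (t - s) (P (f s)) :=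
    hS.continuous_uncurry.comp ((continuous_const.sub continuous_id).prodMk (hP.comp hf))
  exact (by fun_prop : Continuous fun s : ℝ => Real.exp (lam * s)).smul h1

/-- Duhamel's formula stays in a closed convex set. -/
theorem duhamel_mem {S : ℝ → H →L[ℝ] H} (hS : IsIsometryGroup S) {P : H → H}
    (hP : Continuous P) {lam : ℝ} (hlam : 0 < lam) {f₀ : H} {f : ℝ → H} (hf : Continuous f)
    {t : ℝ} (ht : 0 ≤ t) {B : Set H} (hBc : IsClosed B) (hBx : Convex ℝ B)
    (hSB : ∀ r, ∀ v ∈ B, S r v ∈ B) (h₀ : f₀ ∈ B) (hfB : ∀ s ∈ Icc 0 t, P (f s) ∈ B) :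
    duhamel S P lam f₀ f t ∈ B := by
  by_contra hz
  -- A functional bounded by u on B is also bounded by u on an average of points of B with weights
  -- of mass one, which contradicts strict separation.
  obtain ⟨l, u, hlB, hlz⟩ := geometric_hahn_banach_closed_point hBx hBc hz
  have hc := continuous_shifted_integrand hS hP lam hf t
  rw [duhamel_eq hS hP lam f₀ hf t, _root_.map_smul, _root_.map_add, _root_.map_smul,
    ← ContinuousLinearMap.intervalIntegral_comp_comm _ (hc.intervalIntegrable _ _)] at hlz
  have h1 : (∫ s in (0 : ℝ)..t, l (Real.exp (lam * s) • S (t - s) (P (f s)))) ≤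
      ∫ s in (0 : ℝ)..t, Real.exp (lam * s) * u := by
    refine intervalIntegral.integral_mono_on ht ((l.continuous.comp hc).intervalIntegrable _ _)
      (Continuous.intervalIntegrable (by fun_prop) _ _) fun s hs => ?_
    rw [_root_.map_smul, smul_eq_mul]
    exact mul_le_mul_of_nonneg_left (hlB _ (hSB _ _ (hfB s hs))).le (Real.exp_pos _).le
  rw [intervalIntegral.integral_mul_const] at h1
  have h2 := hlB _ (hSB t _ h₀)
  have h3 := integral_lam_exp lam t
  have h4 : l (S t f₀) + lam * ∫ s in (0 : ℝ)..t, l (Real.exp (lam * s) • S (t - s) (P (f s))) ≤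
      Real.exp (lam * t) * u := by
    have := mul_le_mul_of_nonneg_left h1 hlam.le
    rw [← mul_assoc, h3] at this
    linarith
  have h5 := mul_le_mul_of_nonneg_left h4 (Real.exp_pos (-(lam * t))).le
  rw [← mul_assoc, ← Real.exp_add, neg_add_cancel, Real.exp_zero, one_mul] at h5
  simp only [smul_eq_mul] at hlz
  linarith

/-- `f` solves Duhamel's formula on `[0, T]`. -/
def IsMild (S : ℝ → H →L[ℝ] H) (P : H → H) (lam : ℝ) (f₀ : H) {T : ℝ} (hT : 0 ≤ T)
    (f : C(Set.Icc (0 : ℝ) T, H)) : Prop :=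
  ∀ t : Set.Icc (0 : ℝ) T, f t = duhamel S P lam f₀ (IccExtend hT f) t

/-- The map whose fixed points are the mild solutions. -/
def duhamelMap {S : ℝ → H →L[ℝ] H} (hS : IsIsometryGroup S) {P : H → H}
    (hP : Continuous P) (lam : ℝ) (f₀ : H) {T : ℝ} (hT : 0 ≤ T) (f : C(Set.Icc (0 : ℝ) T, H)) :
    C(Set.Icc (0 : ℝ) T, H) :=
  ⟨fun t => duhamel S P lam f₀ (IccExtend hT f) t,
    (continuous_duhamel hS hP lam f₀ (f.continuous.Icc_extend')).comp continuous_subtype_val⟩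

theorem isMild_iff {S : ℝ → H →L[ℝ] H} (hS : IsIsometryGroup S) {P : H → H}
    (hP : Continuous P) (lam : ℝ) (f₀ : H) {T : ℝ} (hT : 0 ≤ T) (f : C(Set.Icc (0 : ℝ) T, H)) :
    IsMild S P lam f₀ hT f ↔ Function.IsFixedPt (duhamelMap hS hP lam f₀ hT) f := by
  constructor
  · intro h
    ext t
    exact (h t).symm
  · intro h t
    exact (DFunLike.congr_fun h t).symm

/-- S is isometric and P is 1-Lipschitz, so the Lipschitz constant is the mass 1 - e^{-lam T}
carried by the integral term. It is below one on the whole of [0, T], and neither a weighted norm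
nor a restriction to short times is needed. -/
theorem contractingWith_duhamelMap {S : ℝ → H →L[ℝ] H} (hS : IsIsometryGroup S) {P : H → H}
    (hP : LipschitzWith 1 P) {lam : ℝ} (hlam : 0 < lam) (f₀ : H) {T : ℝ} (hT : 0 ≤ T) :
    ContractingWith (1 - Real.exp (-(lam * T))).toNNReal
      (duhamelMap hS hP.continuous lam f₀ hT) := by
  have hlT : Real.exp (-(lam * T)) ≤ 1 := Real.exp_le_one_iff.2 (by nlinarith)
  refine ⟨?_, ?_⟩
  · rw [← NNReal.coe_lt_coe, Real.coe_toNNReal _ (by linarith)]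
    have := Real.exp_pos (-(lam * T))
    simp only [NNReal.coe_one]; linarith
  · refine LipschitzWith.of_dist_le_mul fun f g => ?_
    rw [Real.coe_toNNReal _ (by linarith), dist_eq_norm, dist_eq_norm,
      ContinuousMap.norm_le _ (mul_nonneg (by linarith) (norm_nonneg _))]
    intro t
    have ht := t.2
    set F := IccExtend hT f
    set G := IccExtend hT g
    have hF : Continuous F := f.continuous.Icc_extend'
    have hG : Continuous G := g.continuous.Icc_extend'
    have cF := continuous_duhamel_integrand hS hP.continuous lam hF
    have cG := continuous_duhamel_integrand hS hP.continuous lam hG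
    have e1 : (duhamelMap hS hP.continuous lam f₀ hT f - duhamelMap hS hP.continuous lam f₀ hT g) t
        = Real.exp (-(lam * t)) • S t (lam • ∫ s in (0 : ℝ)..t,
          (Real.exp (lam * s) • S (-s) (P (F s)) - Real.exp (lam * s) • S (-s) (P (G s)))) := by
      rw [intervalIntegral.integral_sub (cF.intervalIntegrable _ _) (cG.intervalIntegrable _ _),
        ContinuousMap.sub_apply]
      change duhamel S P lam f₀ F t - duhamel S P lam f₀ G t = _
      unfold duhamel
      rw [← smul_sub, ← _root_.map_sub, add_sub_add_left_eq_sub, ← smul_sub]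
    have e2 : ‖∫ s in (0 : ℝ)..t,
          (Real.exp (lam * s) • S (-s) (P (F s)) - Real.exp (lam * s) • S (-s) (P (G s)))‖ ≤
        ∫ s in (0 : ℝ)..t, Real.exp (lam * s) * ‖f - g‖ := by
      refine intervalIntegral.norm_integral_le_of_norm_le ht.1 ?_
        (Continuous.intervalIntegrable (by fun_prop) _ _)
      refine Eventually.of_forall fun s _ => ?_
      rw [← smul_sub, ← _root_.map_sub, norm_smul, hS.norm_map, Real.norm_eq_abs, Real.abs_exp]
      refine mul_le_mul_of_nonneg_left ?_ (Real.exp_pos _).le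
      rw [← dist_eq_norm]
      refine (hP.dist_le_mul _ _).trans ?_
      rw [NNReal.coe_one, one_mul, dist_eq_norm]
      exact (f - g).norm_coe_le_norm _
    rw [intervalIntegral.integral_mul_const] at e2
    rw [e1, norm_smul, hS.norm_map, norm_smul, Real.norm_eq_abs, Real.abs_exp, Real.norm_eq_abs,
      abs_of_pos hlam]
    have e3 := mul_le_mul_of_nonneg_left e2 hlam.le
    rw [← mul_assoc, integral_lam_exp] at e3
    have e4 := mul_le_mul_of_nonneg_left e3 (Real.exp_pos (-(lam * t))).le
    refine e4.trans ?_
    rw [← mul_assoc, mul_sub, ← Real.exp_add, neg_add_cancel, Real.exp_zero, mul_one]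
    refine mul_le_mul_of_nonneg_right ?_ (norm_nonneg _)
    have : Real.exp (-(lam * T)) ≤ Real.exp (-(lam * t)) :=
      Real.exp_le_exp.2 (by nlinarith [ht.2])
    linarith

theorem existsUnique_isMild {S : ℝ → H →L[ℝ] H} (hS : IsIsometryGroup S) {P : H → H}
    (hP : LipschitzWith 1 P) {lam : ℝ} (hlam : 0 < lam) (f₀ : H) {T : ℝ} (hT : 0 ≤ T) :
    ∃! f : C(Set.Icc (0 : ℝ) T, H), IsMild S P lam f₀ hT f := by
  have hc := contractingWith_duhamelMap hS hP hlam f₀ hT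
  refine ⟨hc.fixedPoint, (isMild_iff hS hP.continuous lam f₀ hT _).2 hc.fixedPoint_isFixedPt, ?_⟩
  intro g hg
  exact hc.fixedPoint_unique ((isMild_iff hS hP.continuous lam f₀ hT _).1 hg)

/-- Mild solutions stay in closed convex sets that are invariant under `S` and `P`. -/
theorem IsMild.mem {S : ℝ → H →L[ℝ] H} (hS : IsIsometryGroup S) {P : H → H}
    (hP : LipschitzWith 1 P) {lam : ℝ} (hlam : 0 < lam) {f₀ : H} {T : ℝ} {hT : 0 ≤ T}
    {f : C(Set.Icc (0 : ℝ) T, H)} (hf : IsMild S P lam f₀ hT f)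
    {B : Set H} (hBc : IsClosed B) (hBx : Convex ℝ B) (hSB : ∀ r, ∀ v ∈ B, S r v ∈ B)
    (hPB : ∀ v ∈ B, P v ∈ B) (h₀ : f₀ ∈ B) (t : Set.Icc (0 : ℝ) T) : f t ∈ B := by
  have hc := contractingWith_duhamelMap hS hP hlam f₀ hT
  have hfix := (isMild_iff hS hP.continuous lam f₀ hT f).1 hf
  have hlim := hc.tendsto_iterate_fixedPoint (ContinuousMap.const _ f₀)
  rw [← hc.fixedPoint_unique hfix] at hlim
  have hit : ∀ n : ℕ, ∀ t, ((duhamelMap hS hP.continuous lam f₀ hT)^[n]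
      (ContinuousMap.const _ f₀)) t ∈ B := by
    intro n
    induction n with
    | zero => intro t; simpa using h₀
    | succ n ih =>
      intro t
      rw [Function.iterate_succ_apply']
      refine duhamel_mem hS hP.continuous hlam (ContinuousMap.continuous _).Icc_extend' t.2.1 hBc hBx hSB h₀ ?_
      intro s _
      exact hPB _ (ih _)
  exact hBc.mem_of_tendsto (((continuous_eval_const t).tendsto f).comp hlim)
    (Eventually.of_forall fun n => hit n t)

/-- Comparison of a mild solution with a fixed point of `P` that `S` moves with bounded speed. -/
theorem IsMild.norm_sub_le {S : ℝ → H →L[ℝ] H} (hS : IsIsometryGroup S) {P : H → H}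
    (hP : LipschitzWith 1 P) {lam : ℝ} (hlam : 0 < lam) {f₀ : H} {T : ℝ} {hT : 0 ≤ T}
    {f : C(Set.Icc (0 : ℝ) T, H)} (hf : IsMild S P lam f₀ hT f)
    {h : H} (hh : P h = h) {C : ℝ} (hC : ∀ r, 0 ≤ r → ‖S r h - h‖ ≤ C * r)
    (t : Set.Icc (0 : ℝ) T) : ‖f t - h‖ ≤ ‖f₀ - h‖ + C * t := by
  -- v is the excess over the claimed bound; the argument is a maximum principle at a point τ where
  -- v is largest.
  set v : Set.Icc (0 : ℝ) T → ℝ := fun t => ‖f t - h‖ - (‖f₀ - h‖ + C * t) with hv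
  have hvc : Continuous v := by
    have := f.continuous
    fun_prop
  obtain ⟨τ, -, hτ⟩ := isCompact_univ.exists_isMaxOn (⟨⟨0, le_rfl, hT⟩, mem_univ _⟩) hvc.continuousOn
  have hmax : ∀ s, v s ≤ v τ := fun s => hτ (mem_univ s)
  suffices hVτ : v τ ≤ 0 by
    have := (hmax t).trans hVτ
    simp only [hv] at this
    linarith
  set D := ‖f₀ - h‖
  set F := IccExtend hT f
  have hF : Continuous F := f.continuous.Icc_extend'
  have hc := continuous_shifted_integrand hS hP.continuous lam hF τ
  -- Since the Duhamel weights have mass one, h is the weighted average of itself and can be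
  -- subtracted termwise.
  have eh : h = Real.exp (-(lam * τ)) • (h + lam • ∫ s in (0 : ℝ)..τ, Real.exp (lam * s) • h) := by
    rw [intervalIntegral.integral_smul_const, smul_smul, integral_lam_exp, sub_smul, one_smul,
      add_sub_cancel, smul_smul, ← Real.exp_add, neg_add_cancel, Real.exp_zero, one_smul]
  have e1 : f τ - h = Real.exp (-(lam * τ)) • ((S τ f₀ - h) + lam • ∫ s in (0 : ℝ)..τ,
      (Real.exp (lam * s) • S (τ - s) (P (F s)) - Real.exp (lam * s) • h)) := by
    rw [intervalIntegral.integral_sub (hc.intervalIntegrable _ _)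
      (Continuous.intervalIntegrable (by fun_prop) _ _)]
    conv_lhs => rw [hf τ, duhamel_eq hS hP.continuous lam f₀ hF, eh]
    rw [← smul_sub]
    congr 1
    rw [smul_sub]; abel
  have e2 : ‖∫ s in (0 : ℝ)..τ,
      (Real.exp (lam * s) • S (τ - s) (P (F s)) - Real.exp (lam * s) • h)‖ ≤
      ∫ s in (0 : ℝ)..τ, Real.exp (lam * s) * (v τ + (D + C * τ)) := by
    refine intervalIntegral.norm_integral_le_of_norm_le τ.2.1 ?_
      (Continuous.intervalIntegrable (by fun_prop) _ _)
    refine Eventually.of_forall fun s hs => ?_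
    rw [← smul_sub, norm_smul, Real.norm_eq_abs, Real.abs_exp]
    refine mul_le_mul_of_nonneg_left ?_ (Real.exp_pos _).le
    have hsT : s ∈ Icc (0 : ℝ) T := ⟨hs.1.le, hs.2.trans τ.2.2⟩
    have hFs : F s = f ⟨s, hsT⟩ := IccExtend_of_mem hT f hsT
    have h1 : ‖S (τ - s) (P (F s)) - h‖ ≤ ‖F s - h‖ + C * (τ - s) := by
      calc ‖S (τ - s) (P (F s)) - h‖ = ‖S (τ - s) (P (F s) - P h) + (S (τ - s) h - h)‖ := by
            rw [_root_.map_sub, hh]; congr 1; abel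
        _ ≤ ‖S (τ - s) (P (F s) - P h)‖ + ‖S (τ - s) h - h‖ := norm_add_le _ _
        _ ≤ ‖F s - h‖ + C * (τ - s) := by
            refine add_le_add ?_ (hC _ (by linarith [hs.2]))
            rw [hS.norm_map, ← dist_eq_norm, ← dist_eq_norm]
            simpa using hP.dist_le_mul (F s) h
    have h2 := hmax ⟨s, hsT⟩
    simp only [hv, ← hFs] at h2 ⊢
    linarith
  rw [intervalIntegral.integral_mul_const] at e2
  have e3 : ‖S τ f₀ - h‖ ≤ D + C * τ := by
    calc ‖S τ f₀ - h‖ = ‖S τ (f₀ - h) + (S τ h - h)‖ := by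
          rw [_root_.map_sub]; congr 1; abel
      _ ≤ ‖S τ (f₀ - h)‖ + ‖S τ h - h‖ := norm_add_le _ _
      _ ≤ D + C * τ := by
          refine add_le_add ?_ (hC _ τ.2.1)
          rw [hS.norm_map]
  have e4 : ‖f τ - h‖ ≤ Real.exp (-(lam * τ)) * ((D + C * τ) +
      (Real.exp (lam * τ) - 1) * (v τ + (D + C * τ))) := by
    rw [e1, norm_smul, Real.norm_eq_abs, Real.abs_exp]
    refine mul_le_mul_of_nonneg_left ((norm_add_le _ _).trans (add_le_add e3 ?_))
      (Real.exp_pos _).le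
    rw [norm_smul, Real.norm_eq_abs, abs_of_pos hlam, ← integral_lam_exp, mul_assoc]
    exact mul_le_mul_of_nonneg_left e2 hlam.le
  have e5 : Real.exp (-(lam * τ)) * Real.exp (lam * τ) = 1 := by
    rw [← Real.exp_add, neg_add_cancel, Real.exp_zero]
  have e6 : ‖f τ - h‖ = v τ + (D + C * τ) := by simp only [hv]; ring
  -- Estimate `e4` amounts to v(τ) ≤ (1 - e^{-lam τ}) v(τ), which forces v(τ) ≤ 0.
  have e7 : Real.exp (-(lam * τ)) * v τ ≤ 0 := by
    have : Real.exp (-(lam * τ)) * ((D + C * τ) +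
      (Real.exp (lam * τ) - 1) * (v τ + (D + C * τ))) =
      v τ + (D + C * τ) - Real.exp (-(lam * τ)) * v τ := by
      linear_combination (v τ + (D + C * τ)) * e5
    linarith
  nlinarith [Real.exp_pos (-(lam * τ))]

end Mild

/-! ### Weak derivatives in time -/

/-- Lemma of du Bois-Reymond: if `U' = V` weakly on `(0, T)` then `U t = U 0 + ∫_0^t V`. -/
theorem eq_add_integral_of_weak_deriv {T : ℝ} (hT : 0 < T) {U V : ℝ → ℝ} (hU : Continuous U)
    (hV : Continuous V)
    (h : ∀ θ : ℝ → ℝ, ContDiff ℝ ∞ θ → HasCompactSupport θ → tsupport θ ⊆ Ioo 0 T →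
      ∫ t in (0 : ℝ)..T, (deriv θ t * U t + θ t * V t) = 0) :
    ∀ t ∈ Icc 0 T, U t = U 0 + ∫ s in (0 : ℝ)..t, V s := by
  set I : ℝ → ℝ := fun t => ∫ s in (0 : ℝ)..t, V s with hI
  have hId : ∀ t, HasDerivAt I (V t) t := fun t =>
    intervalIntegral.integral_hasDerivAt_right (hV.intervalIntegrable _ _)
      hV.stronglyMeasurable.stronglyMeasurableAtFilter hV.continuousAt
  have hIc : Continuous I := continuous_iff_continuousAt.2 fun t => (hId t).continuousAt
  -- Subtracting the primitive of V reduces the claim to a function with vanishing weak derivative,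
  -- which has to be constant.
  set W : ℝ → ℝ := fun t => U t - I t with hW
  have hWc : Continuous W := hU.sub hIc
  have endpts : ∀ θ : ℝ → ℝ, tsupport θ ⊆ Ioo 0 T → θ 0 = 0 ∧ θ T = 0 := by
    intro θ hθ
    constructor
    · by_contra h0
      exact lt_irrefl _ (hθ (subset_tsupport _ h0)).1
    · by_contra h0
      exact lt_irrefl _ (hθ (subset_tsupport _ h0)).2
  have hWθ : ∀ θ : ℝ → ℝ, ContDiff ℝ ∞ θ → HasCompactSupport θ → tsupport θ ⊆ Ioo 0 T →
      ∫ t in (0 : ℝ)..T, deriv θ t * W t = 0 := by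
    intro θ h1 h2 h3
    have hd : ∀ t, HasDerivAt θ (deriv θ t) t := fun t =>
      (h1.differentiable (by simp) t).hasDerivAt
    have hdc : Continuous (deriv θ) := h1.continuous_deriv (by simp)
    have hθc := h1.continuous
    have e0 := h θ h1 h2 h3
    have e1 := intervalIntegral.integral_deriv_mul_eq_sub (a := 0) (b := T) (u := θ) (v := I)
      (u' := deriv θ) (v' := V) (fun t _ => hd t) (fun t _ => hId t)
      (hdc.intervalIntegrable _ _) (hV.intervalIntegrable _ _)
    rw [(endpts θ h3).1, (endpts θ h3).2, zero_mul, zero_mul, sub_zero] at e1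
    have e2 : ∫ t in (0 : ℝ)..T, deriv θ t * W t =
        (∫ t in (0 : ℝ)..T, (deriv θ t * U t + θ t * V t)) -
        ∫ t in (0 : ℝ)..T, (deriv θ t * I t + θ t * V t) := by
      rw [← intervalIntegral.integral_sub (Continuous.intervalIntegrable (by fun_prop) _ _)
        (Continuous.intervalIntegrable (by fun_prop) _ _)]
      congr 1
      ext t
      simp only [hW]; ring
    rw [e2, e0, e1, sub_zero]
  -- a fixed bump of integral one
  obtain ⟨g₀, hg₀s, hg₀c, hg₀t, hg₀i⟩ : ∃ g₀ : ℝ → ℝ, ContDiff ℝ ∞ g₀ ∧ HasCompactSupport g₀ ∧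
      tsupport g₀ ⊆ Ioo 0 T ∧ ∫ t, g₀ t = 1 := by
    let b : ContDiffBump (T / 2) := ⟨T / 8, T / 4, by linarith, by linarith⟩
    refine ⟨b.normed volume, b.contDiff_normed, b.hasCompactSupport_normed, ?_, b.integral_normed⟩
    rw [b.tsupport_normed_eq, Real.closedBall_eq_Icc]
    intro t ht
    have : b.rOut = T / 4 := rfl
    rw [this] at ht
    exact ⟨by linarith [ht.1], by linarith [ht.2]⟩
  set c : ℝ := ∫ t in (0 : ℝ)..T, g₀ t * W t with hc
  have restr : ∀ g : ℝ → ℝ, tsupport g ⊆ Ioo 0 T → ∀ k : ℝ → ℝ,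
      ∫ t, g t * k t = ∫ t in (0 : ℝ)..T, g t * k t := by
    intro g hg k
    rw [intervalIntegral.integral_of_le hT.le, setIntegral_eq_integral_of_forall_compl_eq_zero]
    intro t ht
    have : g t = 0 := by
      by_contra h0
      exact ht (Ioo_subset_Ioc_self (hg (subset_tsupport _ h0)))
    rw [this, zero_mul]
  have key : ∀ g : ℝ → ℝ, ContDiff ℝ ∞ g → HasCompactSupport g → tsupport g ⊆ Ioo 0 T →
      ∫ t, g t • (W t - c) = 0 := by
    intro g h1 h2 h3
    set m : ℝ := ∫ t, g t with hm
    -- Removing a multiple of the fixed bump makes the mean zero, so the primitive of k is compactly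
    -- supported in (0, T) and is an admissible test function.
    set k : ℝ → ℝ := fun t => g t - m * g₀ t with hk
    have hks : ContDiff ℝ ∞ k := h1.sub (contDiff_const.mul hg₀s)
    have hkc : Continuous k := hks.continuous
    have hkt : tsupport k ⊆ tsupport g ∪ tsupport g₀ := by
      refine closure_minimal ?_ ((isClosed_tsupport _).union (isClosed_tsupport _))
      intro t ht
      by_contra hn
      simp only [mem_union, not_or] at hn
      refine ht ?_
      simp [hk, image_eq_zero_of_notMem_tsupport hn.1, image_eq_zero_of_notMem_tsupport hn.2]
    set Θ : ℝ → ℝ := fun t => ∫ s in (0 : ℝ)..t, k s with hΘ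
    have hΘd : ∀ t, HasDerivAt Θ (k t) t := fun t =>
      intervalIntegral.integral_hasDerivAt_right (hkc.intervalIntegrable _ _)
        hkc.stronglyMeasurable.stronglyMeasurableAtFilter hkc.continuousAt
    have hΘderiv : deriv Θ = k := funext fun t => (hΘd t).deriv
    have hΘs : ContDiff ℝ ∞ Θ := by
      rw [contDiff_infty_iff_deriv, hΘderiv]
      exact ⟨fun t => (hΘd t).differentiableAt, hks⟩
    have hki : ∫ t, k t = 0 := by
      have i1 : Integrable g := h1.continuous.integrable_of_hasCompactSupport h2
      have i2 : Integrable g₀ := hg₀s.continuous.integrable_of_hasCompactSupport hg₀c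
      simp only [hk]
      rw [integral_sub i1 (i2.const_mul m), integral_const_mul, hg₀i, mul_one, hm, sub_self]
    -- the support of `Θ`
    have hcomp : IsCompact (tsupport g ∪ tsupport g₀) := h2.union hg₀c
    obtain ⟨a, b, ha, hab, hb, hsub⟩ : ∃ a b, 0 < a ∧ a ≤ b ∧ b < T ∧
        tsupport g ∪ tsupport g₀ ⊆ Icc a b := by
      have hne : (tsupport g ∪ tsupport g₀).Nonempty := by
        by_contra hn
        rw [not_nonempty_iff_eq_empty] at hn
        have : g₀ = 0 := by
          rw [← tsupport_eq_empty_iff]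
          exact (union_empty_iff.1 hn).2
        rw [this] at hg₀i
        simp at hg₀i
      obtain ⟨a, ha⟩ := hcomp.exists_isLeast hne
      obtain ⟨b, hb⟩ := hcomp.exists_isGreatest hne
      have hI : tsupport g ∪ tsupport g₀ ⊆ Ioo 0 T := union_subset h3 hg₀t
      exact ⟨a, b, (hI ha.1).1, ha.2 hb.1, (hI hb.1).2, fun x hx => ⟨ha.2 hx, hb.2 hx⟩⟩
    have kz : ∀ t, t ∉ Icc a b → k t = 0 := by
      intro t ht
      by_contra h0
      exact ht (hsub (hkt (subset_tsupport _ h0)))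
    have hΘz : ∀ t, t ∉ Icc a b → Θ t = 0 := by
      intro t ht
      rcases lt_or_ge t a with hta | hta
      · simp only [hΘ]
        refine intervalIntegral.integral_zero_ae (Eventually.of_forall fun s hs => kz s ?_)
        intro hs'
        rw [mem_uIoc] at hs
        rcases hs with hs | hs
        · linarith [hs'.1, hs.2]
        · linarith [hs'.1, hs.2, hs.1]
      · have htb : b < t := by
          by_contra hn
          exact ht ⟨hta, not_lt.1 hn⟩
        simp only [hΘ]
        rw [intervalIntegral.integral_of_le (by linarith),
          setIntegral_eq_integral_of_forall_compl_eq_zero, hki]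
        intro s hs
        refine kz s fun hs' => hs ⟨by linarith [hs'.1], by linarith [hs'.2]⟩
    have hΘt : tsupport Θ ⊆ Icc a b := by
      refine closure_minimal ?_ isClosed_Icc
      intro t ht
      by_contra hn
      exact ht (hΘz t hn)
    have hΘcs : HasCompactSupport Θ := isCompact_Icc.of_isClosed_subset (isClosed_tsupport _) hΘt
    have e := hWθ Θ hΘs hΘcs (hΘt.trans fun t ht => ⟨ha.trans_le ht.1, ht.2.trans_lt hb⟩)
    rw [hΘderiv] at e
    have i1 : Integrable g := h1.continuous.integrable_of_hasCompactSupport h2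
    have i2 : Integrable fun t => g t * W t :=
      (h1.continuous.mul hWc).integrable_of_hasCompactSupport h2.mul_right
    have e2 : ∫ t in (0 : ℝ)..T, k t * W t = (∫ t, g t * W t) - m * c := by
      rw [restr g h3, hc, ← intervalIntegral.integral_const_mul,
        ← intervalIntegral.integral_sub]
      · congr 1; ext t; simp only [hk]; ring
      · exact (h1.continuous.mul hWc).intervalIntegrable _ _
      · exact (continuous_const.mul (hg₀s.continuous.mul hWc)).intervalIntegrable _ _
    have e3 : ∫ t, g t • (W t - c) = (∫ t, g t * W t) - m * c := by
      simp only [smul_eq_mul, mul_sub]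
      rw [integral_sub i2 (i1.mul_const c), integral_mul_const]
    rw [e3, ← e2, e]
  have hae : ∀ᵐ t : ℝ, t ∈ Ioo 0 T → W t - c = 0 :=
    isOpen_Ioo.ae_eq_zero_of_integral_contDiff_smul_eq_zero
      ((hWc.sub continuous_const).locallyIntegrable.locallyIntegrableOn _) key
  have hWeq : EqOn (fun t => W t - c) 0 (Ioo 0 T) := by
    refine Measure.eqOn_open_of_ae_eq (μ := (volume : Measure ℝ)) ?_ isOpen_Ioo
      (hWc.sub continuous_const).continuousOn continuousOn_const
    rw [EventuallyEq, ae_restrict_iff' measurableSet_Ioo]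
    exact hae
  have hcl : EqOn (fun t => W t - c) 0 (Icc 0 T) := by
    rw [← closure_Ioo hT.ne]
    exact hWeq.closure (hWc.sub continuous_const) continuous_const
  intro t ht
  have h1 := hcl ht
  have h2 := hcl ⟨le_rfl, hT.le⟩
  have hI0 : I 0 = 0 := by simp [hI]
  simp only [hW, Pi.zero_apply, hI0] at h1 h2
  change U t = U 0 + I t
  linarith

theorem inner_real_eq_mul (a b : ℝ) : inner ℝ a b = a * b := by simp [mul_comm]

/-! ### The projection onto a closed convex set -/

section MetricProj

variable {H : Type*} [NormedAddCommGroup H] [InnerProductSpace ℝ H] [CompleteSpace H]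

theorem metricProj_spec {K : Set H} (hne : K.Nonempty) (hc : IsClosed K) (hx : Convex ℝ K)
    (f : H) : metricProj K f ∈ K ∧ ∀ q ∈ K, inner ℝ (f - metricProj K f) (q - metricProj K f) ≤ 0 := by
  have hex : ∃ p ∈ K, ∀ q ∈ K, ‖f - p‖ ≤ ‖f - q‖ := by
    obtain ⟨p, hp, h⟩ := exists_norm_eq_iInf_of_complete_convex hne hc.isComplete hx f
    refine ⟨p, hp, fun q hq => ?_⟩
    rw [h]
    exact ciInf_le ⟨0, by rintro _ ⟨w, rfl⟩; exact norm_nonneg _⟩ (⟨q, hq⟩ : K)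
  have hdef : metricProj K f = hex.choose := dif_pos hex
  obtain ⟨h1, h2⟩ := hex.choose_spec
  rw [hdef]
  refine ⟨h1, (norm_eq_iInf_iff_real_inner_le_zero hx h1).1 ?_⟩
  have : Nonempty K := ⟨⟨_, h1⟩⟩
  refine le_antisymm (le_ciInf fun q => h2 q q.2) ?_
  exact ciInf_le ⟨0, by rintro _ ⟨w, rfl⟩; exact norm_nonneg _⟩ (⟨_, h1⟩ : K)

theorem metricProj_mem {K : Set H} (hne : K.Nonempty) (hc : IsClosed K) (hx : Convex ℝ K)
    (f : H) : metricProj K f ∈ K := (metricProj_spec hne hc hx f).1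

theorem inner_metricProj_le {K : Set H} (hne : K.Nonempty) (hc : IsClosed K) (hx : Convex ℝ K)
    (f : H) {q : H} (hq : q ∈ K) : inner ℝ (f - metricProj K f) (q - metricProj K f) ≤ 0 :=
  (metricProj_spec hne hc hx f).2 q hq

/-- Adding the variational inequalities of the two candidates, each tested with the other, leaves ‖r
- p‖² ≤ 0. -/
theorem eq_metricProj {K : Set H} (hne : K.Nonempty) (hc : IsClosed K) (hx : Convex ℝ K)
    {f p : H} (hp : p ∈ K) (h : ∀ q ∈ K, inner ℝ (f - p) (q - p) ≤ 0) : p = metricProj K f := by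
  set r := metricProj K f
  have h1 := h r (metricProj_mem hne hc hx f)
  have h2 := inner_metricProj_le hne hc hx f hp
  have h3 : inner ℝ (r - p) (r - p) ≤ (0 : ℝ) := by
    have e : inner ℝ (r - p) (r - p) = inner ℝ (f - p) (r - p) + inner ℝ (f - r) (p - r) := by
      rw [← neg_sub r p, inner_neg_right, ← sub_eq_add_neg, ← inner_sub_left]
      congr 1; abel
    rw [e]
    exact add_nonpos h1 h2
  rw [real_inner_self_eq_norm_sq] at h3
  have h4 : ‖r - p‖ = 0 := by nlinarith [norm_nonneg (r - p)]
  exact (sub_eq_zero.1 (norm_eq_zero.1 h4)).symm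

theorem metricProj_of_mem {K : Set H} (hne : K.Nonempty) (hc : IsClosed K) (hx : Convex ℝ K)
    {f : H} (hf : f ∈ K) : metricProj K f = f :=
  (eq_metricProj hne hc hx hf fun q _ => by simp).symm

/-- Testing each variational inequality with the other projection gives ‖p - q‖² ≤ ⟨f - g, p - q⟩.
-/
theorem lipschitzWith_metricProj {K : Set H} (hne : K.Nonempty) (hc : IsClosed K)
    (hx : Convex ℝ K) : LipschitzWith 1 (metricProj K) := by
  refine LipschitzWith.of_dist_le_mul fun f g => ?_
  rw [NNReal.coe_one, one_mul, dist_eq_norm, dist_eq_norm]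
  set p := metricProj K f
  set q := metricProj K g
  have h1 : inner ℝ (f - p) (q - p) ≤ 0 :=
    inner_metricProj_le hne hc hx f (metricProj_mem hne hc hx g)
  have h2 : inner ℝ (g - q) (p - q) ≤ 0 :=
    inner_metricProj_le hne hc hx g (metricProj_mem hne hc hx f)
  have h3 : inner ℝ (p - q) (p - q) ≤ inner ℝ (f - g) (p - q) := by
    have e : inner ℝ (f - g) (p - q) - inner ℝ (p - q) (p - q) =
        -(inner ℝ (f - p) (q - p) + inner ℝ (g - q) (p - q)) := by
      rw [← neg_sub p q, inner_neg_right]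
      simp only [inner_sub_left, inner_sub_right]
      ring
    linarith
  rw [real_inner_self_eq_norm_sq] at h3
  have h4 := real_inner_le_norm (f - g) (p - q)
  rcases eq_or_lt_of_le (norm_nonneg (p - q)) with h | h
  · rw [← h]; exact norm_nonneg _
  · exact le_of_mul_le_mul_right (by nlinarith) h

end MetricProj

/-! ### Projection of slices as a projection in the full space -/

section Slices

variable {N : ℕ} {L : Fin N → ℝ}

theorem measurableSet_cell (L : Fin N → ℝ) : MeasurableSet (cell L) := by
  have : cell L = ⋂ i, {y : E N | 0 ≤ y i ∧ y i < L i} := by ext; simp [cell]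
  rw [this]
  refine MeasurableSet.iInter fun i => ?_
  have h : Measurable fun y : E N => y i := by fun_prop
  exact (measurableSet_le measurable_const h).inter (measurableSet_lt h measurable_const)

/-- The closed box containing the periodicity cell. -/
def closedCell (L : Fin N → ℝ) : Set (E N) := {y | ∀ i, 0 ≤ y i ∧ y i ≤ L i}

theorem cell_subset_closedCell : cell L ⊆ closedCell L := fun _ hy i => ⟨(hy i).1, (hy i).2.le⟩

theorem isCompact_closedCell (L : Fin N → ℝ) : IsCompact (closedCell L) := by
  have h : closedCell L = (EuclideanSpace.equiv (Fin N) ℝ).toHomeomorph ⁻¹'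
      (Set.pi univ fun i => Icc 0 (L i)) := by
    ext y; simp [closedCell, Set.mem_pi, -Set.pi_univ_Icc]
  rw [h, Homeomorph.isCompact_preimage]
  exact isCompact_univ_pi fun i => isCompact_Icc

instance : IsFiniteMeasure (cellMeasure L) := by
  refine ⟨?_⟩
  rw [cellMeasure, Measure.restrict_apply_univ]
  exact (measure_mono cell_subset_closedCell).trans_lt (isCompact_closedCell L).measure_lt_top

instance : SigmaFinite (measYXi L) := inferInstanceAs (SigmaFinite ((cellMeasure L).prod volume))

instance : SigmaFinite (measXYXi L) :=
  inferInstanceAs (SigmaFinite ((volume : Measure (E N)).prod (measYXi L)))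

instance : IsLocallyFiniteMeasure (measYXi L) :=
  inferInstanceAs (IsLocallyFiniteMeasure ((cellMeasure L).prod volume))

instance : IsLocallyFiniteMeasure (measXYXi L) :=
  inferInstanceAs (IsLocallyFiniteMeasure ((volume : Measure (E N)).prod (measYXi L)))

theorem memLp_slice (F : L2XYXi L) :
    ∀ᵐ x : E N, MemLp (fun w => F (x, w)) 2 (measYXi L) := by
  have h1 : MemLp F 2 ((volume : Measure (E N)).prod (measYXi L)) := Lp.memLp F
  have h2 := (memLp_two_iff_integrable_sq h1.1).1 h1
  filter_upwards [h1.1.prodMk_left, h2.prod_right_ae] with x hx1 hx2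
  exact (memLp_two_iff_integrable_sq hx1).2 hx2

theorem coeFn_slice (F : L2XYXi L) :
    ∀ᵐ x : E N, slice F x =ᵐ[measYXi L] fun w => F (x, w) := by
  filter_upwards [memLp_slice F] with x hx
  rw [slice, dif_pos hx]
  exact hx.coeFn_toLp

theorem ae_ae_of_ae_XYXi {p : E N × E N × ℝ → Prop} (h : ∀ᵐ z ∂(measXYXi L), p z) :
    ∀ᵐ x : E N, ∀ᵐ w ∂(measYXi L), p (x, w) := Measure.ae_ae_of_ae_prod h

theorem slice_sub (F G : L2XYXi L) : ∀ᵐ x : E N, slice (F - G) x = slice F x - slice G x := by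
  filter_upwards [coeFn_slice F, coeFn_slice G, coeFn_slice (F - G),
    ae_ae_of_ae_XYXi (Lp.coeFn_sub F G)] with x h1 h2 h3 h4
  apply Lp.ext
  filter_upwards [h1, h2, h3, h4, Lp.coeFn_sub (slice F x) (slice G x)] with w e1 e2 e3 e4 e5
  rw [e5, Pi.sub_apply, e1, e2, e3, e4, Pi.sub_apply]

theorem slice_add (F G : L2XYXi L) : ∀ᵐ x : E N, slice (F + G) x = slice F x + slice G x := by
  filter_upwards [coeFn_slice F, coeFn_slice G, coeFn_slice (F + G),
    ae_ae_of_ae_XYXi (Lp.coeFn_add F G)] with x h1 h2 h3 h4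
  apply Lp.ext
  filter_upwards [h1, h2, h3, h4, Lp.coeFn_add (slice F x) (slice G x)] with w e1 e2 e3 e4 e5
  rw [e5, Pi.add_apply, e1, e2, e3, e4, Pi.add_apply]

theorem slice_smul (c : ℝ) (F : L2XYXi L) : ∀ᵐ x : E N, slice (c • F) x = c • slice F x := by
  filter_upwards [coeFn_slice F, coeFn_slice (c • F),
    ae_ae_of_ae_XYXi (Lp.coeFn_smul c F)] with x h1 h3 h4
  apply Lp.ext
  filter_upwards [h1, h3, h4, Lp.coeFn_smul c (slice F x)] with w e1 e3 e4 e5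
  rw [e5, Pi.smul_apply, e1, e3, e4, Pi.smul_apply]

theorem slice_eq_of_ae {F : L2XYXi L} {x : E N} {k : L2YXi L}
    (h : (fun w => F (x, w)) =ᵐ[measYXi L] k) : slice F x = k := by
  have hm : MemLp (fun w => F (x, w)) 2 (measYXi L) := (memLp_congr_ae h).2 (Lp.memLp k)
  rw [slice, dif_pos hm]
  apply Lp.ext
  exact hm.coeFn_toLp.trans h

theorem inner_slice_eq (F G : L2XYXi L) :
    ∀ᵐ x : E N, inner ℝ (slice F x) (slice G x) = ∫ w, F (x, w) * G (x, w) ∂(measYXi L) := by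
  filter_upwards [coeFn_slice F, coeFn_slice G] with x h1 h2
  rw [L2.inner_def]
  refine integral_congr_ae ?_
  filter_upwards [h1, h2] with w e1 e2
  rw [e1, e2, inner_real_eq_mul]

theorem integrable_mul_XYXi (F G : L2XYXi L) :
    Integrable (fun z => F z * G z) ((volume : Measure (E N)).prod (measYXi L)) := by
  have : Integrable (fun z => inner ℝ (F z) (G z)) (measXYXi L) := L2.integrable_inner F G
  simp only [inner_real_eq_mul] at this
  exact this

theorem integrable_inner_slice (F G : L2XYXi L) :
    Integrable fun x : E N => inner ℝ (slice F x) (slice G x) :=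
  ((integrable_mul_XYXi F G).integral_prod_left).congr
    ((inner_slice_eq F G).mono fun _ hx => hx.symm)

theorem inner_eq_integral_slice (F G : L2XYXi L) :
    inner ℝ F G = ∫ x : E N, inner ℝ (slice F x) (slice G x) := by
  rw [integral_congr_ae (inner_slice_eq F G), L2.inner_def]
  have := integral_prod _ (integrable_mul_XYXi F G)
  simp only [inner_real_eq_mul]
  exact this

/-- The inner product of the full space is the x-integral of the inner products of slices, so equal
slices give a difference of norm zero. -/
theorem ext_slice {F G : L2XYXi L} (h : ∀ᵐ x : E N, slice F x = slice G x) : F = G := by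
  have h1 : inner ℝ (F - G) (F - G) = (0 : ℝ) := by
    rw [inner_eq_integral_slice]
    refine integral_eq_zero_of_ae ?_
    filter_upwards [h, slice_sub F G] with x e1 e2
    rw [e2, e1, sub_self, inner_self_eq_zero.2 rfl, Pi.zero_apply]
  exact sub_eq_zero.1 (inner_self_eq_zero.1 h1)

/-- The functions of `L²(ℝ^N × Y × ℝ)` whose slices lie in `K`. -/
def sliceSet (K : Set (L2YXi L)) : Set (L2XYXi L) := {G | ∀ᵐ x : E N, slice G x ∈ K}

theorem convex_sliceSet {K : Set (L2YXi L)} (hx : Convex ℝ K) : Convex ℝ (sliceSet K) := by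
  intro F hF G hG a b ha hb hab
  filter_upwards [hF, hG, slice_add (a • F) (b • G), slice_smul a F, slice_smul b G]
    with x h1 h2 h3 h4 h5
  rw [h3, h4, h5]
  exact hx h1 h2 ha hb hab

/-- Convergence in the full space says that the squared norms of the slices of G_n - F tend to zero
in L¹(dx); along a subsequence almost every slice converges, and K is closed. -/
theorem isClosed_sliceSet {K : Set (L2YXi L)} (hc : IsClosed K) : IsClosed (sliceSet K) := by
  refine IsSeqClosed.isClosed fun G F hG hGF => ?_
  have hn : Tendsto (fun n => ∫ x : E N, inner ℝ (slice (G n - F) x) (slice (G n - F) x))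
      atTop (𝓝 (0 : ℝ)) := by
    have e : ∀ n, ∫ x : E N, inner ℝ (slice (G n - F) x) (slice (G n - F) x) = ‖G n - F‖ ^ 2 :=
      fun n => by rw [← inner_eq_integral_slice, real_inner_self_eq_norm_sq]
    simp only [e]
    have := ((tendsto_iff_norm_sub_tendsto_zero.1 hGF).pow 2)
    simpa using this
  have hL : Tendsto (fun n => eLpNorm ((fun x : E N => inner ℝ (slice (G n - F) x)
      (slice (G n - F) x)) - fun _ => (0 : ℝ)) 1 volume) atTop (𝓝 0) := by
    have e : ∀ n, eLpNorm ((fun x : E N => inner ℝ (slice (G n - F) x)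
        (slice (G n - F) x)) - fun _ => (0 : ℝ)) 1 volume =
        ENNReal.ofReal (∫ x : E N, inner ℝ (slice (G n - F) x) (slice (G n - F) x)) := by
      intro n
      rw [eLpNorm_one_eq_lintegral_enorm, ofReal_integral_eq_lintegral_ofReal
        (integrable_inner_slice _ _) (Eventually.of_forall fun _ => real_inner_self_nonneg)]
      refine lintegral_congr fun x => ?_
      rw [Pi.sub_apply, sub_zero, Real.enorm_eq_ofReal real_inner_self_nonneg]
    simp only [e]
    simpa using ENNReal.tendsto_ofReal hn
  have hM := tendstoInMeasure_of_tendsto_eLpNorm (by norm_num : (1 : ℝ≥0∞) ≠ 0)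
    (fun n => (integrable_inner_slice (G n - F) (G n - F)).1)
    (aestronglyMeasurable_const (b := (0 : ℝ))) hL
  obtain ⟨ns, -, hns⟩ := hM.exists_seq_tendsto_ae
  have hGs : ∀ᵐ x : E N, ∀ n, slice (G n) x ∈ K ∧ slice (G n - F) x = slice (G n) x - slice F x := by
    rw [ae_all_iff]
    intro n
    filter_upwards [hG n, slice_sub (G n) F] with x h1 h2
    exact ⟨h1, h2⟩
  filter_upwards [hns, hGs] with x h1 h2
  refine hc.mem_of_tendsto (f := fun k => slice (G (ns k)) x) (b := atTop) ?_
    (Eventually.of_forall fun k => (h2 _).1)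
  rw [tendsto_iff_norm_sub_tendsto_zero]
  have h3 := h1.sqrt
  simp only [real_inner_self_eq_norm_sq, Real.sqrt_sq (norm_nonneg _), Real.sqrt_zero] at h3
  refine h3.congr fun k => ?_
  rw [(h2 _).2]

/-- The projection acting on the slices. -/
def sliceProj (K : Set (L2YXi L)) (F : L2XYXi L) : L2XYXi L := metricProj (sliceSet K) F

theorem zero_mem_sliceSet {K : Set (L2YXi L)} (h0 : (0 : L2YXi L) ∈ K) :
    (0 : L2XYXi L) ∈ sliceSet K := by
  have := slice_sub (0 : L2XYXi L) 0
  filter_upwards [this] with x hx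
  rw [sub_self, sub_self] at hx
  rwa [hx]

/-- This is the competitor of the localization argument: k over B and G elsewhere. B must have
finite volume because k does not depend on x. -/
theorem memLp_glue {B : Set (E N)} (hB : MeasurableSet B) (hBf : volume B < ⊤) (k : L2YXi L)
    (G : L2XYXi L) :
    MemLp (fun z : E N × E N × ℝ => B.indicator (fun _ => (1 : ℝ)) z.1 * k z.2 +
      Bᶜ.indicator (fun _ => (1 : ℝ)) z.1 * G z) 2 (measXYXi L) := by
  refine MemLp.add ?_ ?_
  · have hm : AEStronglyMeasurable (fun z : E N × E N × ℝ =>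
        B.indicator (fun _ => (1 : ℝ)) z.1 * k z.2) (measXYXi L) := by
      refine AEStronglyMeasurable.mul ?_ ?_
      · exact ((measurable_const.indicator hB).comp measurable_fst).aestronglyMeasurable
      · exact (Lp.aestronglyMeasurable k).comp_snd
    refine (memLp_two_iff_integrable_sq hm).2 ?_
    have h1 : Integrable (B.indicator fun _ => (1 : ℝ)) (volume : Measure (E N)) :=
      (integrable_indicator_iff hB).2 (by rw [integrableOn_const_iff]; exact Or.inr hBf)
    have h2 : Integrable (fun w => k w ^ 2) (measYXi L) :=
      (memLp_two_iff_integrable_sq (Lp.aestronglyMeasurable k)).1 (Lp.memLp k)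
    refine (h1.mul_prod h2).congr (Eventually.of_forall fun z => ?_)
    by_cases hz : z.1 ∈ B <;> simp [hz]
  · have h := (Lp.memLp G).indicator (measurable_fst hB.compl)
    refine (memLp_congr_ae (Eventually.of_forall fun z => ?_)).1 h
    by_cases hz : z.1 ∈ B <;> simp [hz]

/-- The variational inequality in the full space is localized in x by glued competitors, which turns
it into the variational inequality of almost every slice. Defining the projection globally avoids
having to prove that x ↦ `metricProj K (slice F x)` is measurable. -/
theorem isSliceProj_sliceProj {K : Set (L2YXi L)} (h0 : (0 : L2YXi L) ∈ K) (hc : IsClosed K)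
    (hx : Convex ℝ K) (F : L2XYXi L) : IsSliceProj K F (sliceProj K F) := by
  classical
  have hne : (sliceSet (L := L) K).Nonempty := ⟨0, zero_mem_sliceSet h0⟩
  obtain ⟨hG, hGle⟩ := metricProj_spec hne (isClosed_sliceSet hc) (convex_sliceSet hx) F
  change sliceProj K F ∈ _ at hG
  change ∀ q ∈ sliceSet K, inner ℝ (F - sliceProj K F) (q - sliceProj K F) ≤ 0 at hGle
  set G := sliceProj K F
  have key : ∀ k ∈ K, ∀ᵐ x : E N, inner ℝ (slice F x - slice G x) (k - slice G x) ≤ (0 : ℝ) := by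
    intro k hk
    have main : ∀ B : Set (E N), MeasurableSet B → volume B < ⊤ →
        IntegrableOn (fun x => inner ℝ (slice F x - slice G x) (k - slice G x)) B ∧
        ∫ x in B, inner ℝ (slice F x - slice G x) (k - slice G x) ≤ (0 : ℝ) := by
      intro B hB hBf
      set Q : L2XYXi L := (memLp_glue hB hBf k G).toLp _ with hQ
      have hQs : ∀ᵐ x : E N, slice Q x = if x ∈ B then k else slice G x := by
        filter_upwards [ae_ae_of_ae_XYXi (memLp_glue hB hBf k G).coeFn_toLp, coeFn_slice G]
          with x h1 h2
        refine slice_eq_of_ae ?_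
        split_ifs with hxB
        · filter_upwards [h1] with w e1
          rw [hQ, e1]; simp [hxB]
        · filter_upwards [h1, h2] with w e1 e2
          rw [hQ, e1, e2]; simp [hxB]
      have hQm : Q ∈ sliceSet K := by
        change ∀ᵐ x : E N, slice Q x ∈ K
        filter_upwards [hQs, hG] with x h1 h2
        rw [h1]
        split_ifs
        · exact hk
        · exact h2
      have hae : (fun x : E N => inner ℝ (slice (F - G) x) (slice (Q - G) x)) =ᵐ[volume]
          B.indicator (fun x => inner ℝ (slice F x - slice G x) (k - slice G x)) := by
        filter_upwards [hQs, slice_sub F G, slice_sub Q G] with x h1 h2 h3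
        rw [h2, h3, h1]
        by_cases hxB : x ∈ B <;> simp [hxB]
      have hint := (integrable_inner_slice (F - G) (Q - G)).congr hae
      refine ⟨(integrable_indicator_iff hB).1 hint, ?_⟩
      rw [← integral_indicator hB, ← integral_congr_ae hae, ← inner_eq_integral_slice]
      exact hGle Q hQm
    have h := ae_nonneg_of_forall_setIntegral_nonneg_of_sigmaFinite
      (f := fun x : E N => -inner ℝ (slice F x - slice G x) (k - slice G x)) (μ := volume)
      (fun B hB hBf => (main B hB hBf).1.neg)
      (fun B hB hBf => by
        rw [integral_neg]
        exact neg_nonneg.2 (main B hB hBf).2)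
    filter_upwards [h] with x hx
    exact neg_nonneg.1 hx
  have : Fact ((2 : ℝ≥0∞) ≠ ⊤) := ⟨by norm_num⟩
  -- The exceptional null set depends on k; a countable dense subset of K gives one null set for all
  -- k, and continuity in k does the rest.
  obtain ⟨D, hDK, hDc, hDd⟩ :=
    (TopologicalSpace.IsSeparable.of_separableSpace K).exists_countable_dense_subset
  have hall : ∀ᵐ x : E N, ∀ k ∈ D, inner ℝ (slice F x - slice G x) (k - slice G x) ≤ (0 : ℝ) := by
    rw [ae_ball_iff hDc]
    exact fun k hk => key k (hDK hk)
  filter_upwards [hall, hG] with x h1 h2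
  refine eq_metricProj ⟨0, h0⟩ hc hx h2 fun q hq => ?_
  have hcl : IsClosed {q : L2YXi L | inner ℝ (slice F x - slice G x) (q - slice G x) ≤ (0 : ℝ)} :=
    isClosed_le (by fun_prop) continuous_const
  exact closure_minimal (fun k hk => h1 k hk) hcl (hDd hq)

theorem lipschitzWith_sliceProj {K : Set (L2YXi L)} (h0 : (0 : L2YXi L) ∈ K) (hc : IsClosed K)
    (hx : Convex ℝ K) : LipschitzWith 1 (sliceProj (N := N) K) :=
  lipschitzWith_metricProj ⟨0, zero_mem_sliceSet h0⟩ (isClosed_sliceSet hc) (convex_sliceSet hx)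

theorem isSliceProj_iff {K : Set (L2YXi L)} (h0 : (0 : L2YXi L) ∈ K) (hc : IsClosed K)
    (hx : Convex ℝ K) {F G : L2XYXi L} : IsSliceProj K F G ↔ G = sliceProj K F := by
  constructor
  · intro h
    refine ext_slice ?_
    filter_upwards [h, isSliceProj_sliceProj h0 hc hx F] with x h1 h2
    rw [h1, h2]
  · rintro rfl
    exact isSliceProj_sliceProj h0 hc hx F

end Slices

/-! ### The period lattice and its fundamental domain -/

section Lattice

variable {N : ℕ} {L : Fin N → ℝ}

/-- The point of the period lattice with coordinates `k`. -/
def latt (L : Fin N → ℝ) (k : Fin N → ℤ) : E N := ∑ i, k i • EuclideanSpace.single i (L i)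

theorem latt_apply (L : Fin N → ℝ) (k : Fin N → ℤ) (i : Fin N) : latt L k i = k i * L i := by
  simp [latt, Pi.single_apply]

theorem latt_add (L : Fin N → ℝ) (k l : Fin N → ℤ) : latt L (k + l) = latt L k + latt L l := by
  ext i; simp [latt_apply, add_mul]

theorem latt_neg (L : Fin N → ℝ) (k : Fin N → ℤ) : latt L (-k) = -latt L k := by
  ext i; simp [latt_apply]

theorem periodic_latt {α : Type*} {X : Type*} [AddCommGroup X] (ι : E N →+ X) {f : X → α}
    (h : ∀ (x : X) (i : Fin N), f (x + ι (EuclideanSpace.single i (L i))) = f x)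
    (k : Fin N → ℤ) (x : X) : f (x + ι (latt L k)) = f x := by
  have hs : ∀ s : Finset (Fin N),
      Function.Periodic f (∑ i ∈ s, k i • ι (EuclideanSpace.single i (L i))) := by
    intro s
    induction s using Finset.induction_on with
    | empty => intro x; simp
    | insert a s ha ih =>
      rw [Finset.sum_insert ha]
      exact Function.Periodic.add_period (Function.Periodic.zsmul (fun x => h x a) (k a)) ih
  have := hs Finset.univ x
  simpa [latt, map_sum, map_zsmul] using this

/-- The integer part of a point with respect to the period lattice. -/
def cellFloor (L : Fin N → ℝ) (y : E N) : Fin N → ℤ := fun i => ⌊y i / L i⌋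

/-- The representative in the cell of a point modulo the period lattice. -/
def fold (L : Fin N → ℝ) (y : E N) : E N := y - latt L (cellFloor L y)

theorem fold_mem_cell (hL : ∀ i, 0 < L i) (y : E N) : fold L y ∈ cell L := by
  intro i
  have h1 := Int.floor_le (y i / L i)
  have h2 := Int.lt_floor_add_one (y i / L i)
  rw [le_div_iff₀ (hL i)] at h1
  rw [div_lt_iff₀ (hL i)] at h2
  simp only [fold, PiLp.sub_apply, latt_apply, cellFloor]
  constructor <;> linarith

theorem cellFloor_eq_of_mem (hL : ∀ i, 0 < L i) {y : E N} {k : Fin N → ℤ}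
    (h : y - latt L k ∈ cell L) : cellFloor L y = k := by
  funext i
  have := h i
  simp only [PiLp.sub_apply, latt_apply] at this
  rw [cellFloor, Int.floor_eq_iff, le_div_iff₀ (hL i), div_lt_iff₀ (hL i)]
  constructor <;> linarith

theorem fold_of_mem (hL : ∀ i, 0 < L i) {y : E N} (hy : y ∈ cell L) : fold L y = y := by
  have h0 : latt L 0 = 0 := by ext i; simp [latt_apply]
  have : cellFloor L y = 0 := cellFloor_eq_of_mem hL (by rwa [h0, sub_zero])
  rw [fold, this, h0, sub_zero]

theorem fold_add_latt (hL : ∀ i, 0 < L i) (y : E N) (k : Fin N → ℤ) :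
    fold L (y + latt L k) = fold L y := by
  have : cellFloor L (y + latt L k) = cellFloor L y + k := by
    apply cellFloor_eq_of_mem hL
    rw [latt_add]
    have := fold_mem_cell hL y
    rw [fold] at this
    convert this using 1
    abel
  rw [fold, this, latt_add, fold]
  abel

theorem measurable_fold (L : Fin N → ℝ) : Measurable (fold L) := by
  have : fold L = fun y => (WithLp.toLp 2 fun i => y i - (⌊y i / L i⌋ : ℝ) * L i : E N) := by
    funext y
    ext i
    simp [fold, latt_apply, cellFloor]
  rw [this]
  refine (by fun_prop : Measurable (WithLp.toLp 2 : (Fin N → ℝ) → E N)).comp ?_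
  refine measurable_pi_lambda _ fun i => ?_
  have h : Measurable fun y : E N => y i := by fun_prop
  exact h.sub ((measurable_from_top.comp (Int.measurable_floor.comp (h.div_const _))).mul_const _)

theorem finite_latt_norm_le (hL : ∀ i, 0 < L i) (C : ℝ) : {k : Fin N → ℤ | ‖latt L k‖ ≤ C}.Finite := by
  refine (Set.Finite.pi' fun i : Fin N => Set.finite_Icc (-⌈C / L i⌉) ⌈C / L i⌉).subset ?_
  intro k hk i
  have h1 : |(k i : ℝ) * L i| ≤ C := by
    rw [← latt_apply, ← Real.norm_eq_abs]
    exact (PiLp.norm_apply_le _ i).trans hk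
  rw [abs_mul, abs_of_pos (hL i), ← le_div_iff₀ (hL i)] at h1
  have h2 := h1.trans (Int.le_ceil (C / L i))
  rw [abs_le] at h2
  refine ⟨?_, ?_⟩
  · exact_mod_cast h2.1
  · exact_mod_cast h2.2

theorem norm_le_of_mem_cell {y : E N} (hy : y ∈ cell L) :
    ‖y‖ ≤ Real.sqrt (∑ i, L i ^ 2) := by
  rw [EuclideanSpace.norm_eq]
  refine Real.sqrt_le_sqrt (Finset.sum_le_sum fun i _ => ?_)
  have := hy i
  rw [Real.norm_eq_abs, sq_abs]
  nlinarith

end Lattice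

/-! ### Periodization of test functions and unfolding of integrals -/

section Periodize

variable {N : ℕ} {L : Fin N → ℝ} {X : Type*} [NormedAddCommGroup X] [NormedSpace ℝ X]

/-- The sum of the lattice translates of `g`. -/
def periodize (L : Fin N → ℝ) (ι : E N →L[ℝ] X) (g : X → ℝ) (z : X) : ℝ :=
  ∑ᶠ k : Fin N → ℤ, g (z + ι (latt L k))

theorem periodize_periodic (ι : E N →L[ℝ] X) (g : X → ℝ) (z : X) (i : Fin N) :
    periodize L ι g (z + ι (EuclideanSpace.single i (L i))) = periodize L ι g z := by
  have e : EuclideanSpace.single i (L i) = latt L (Pi.single i 1) := by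
    ext j
    by_cases h : j = i
    · subst h; simp [latt_apply]
    · simp [latt_apply, h]
  unfold periodize
  rw [e, ← finsum_comp_equiv (Equiv.addLeft (Pi.single i (1 : ℤ))) (f := fun k => g (z + ι (latt L k)))]
  refine finsum_congr fun k => ?_
  rw [Equiv.coe_addLeft, latt_add, _root_.map_add, add_assoc]

/-- On bounded parts of `X` only finitely many lattice translates matter. -/
theorem exists_finset_latt (hL : ∀ i, 0 < L i) (π : X →L[ℝ] E N) (ι : E N →L[ℝ] X)
    (hπι : ∀ y, π (ι y) = y) {g : X → ℝ} (hg : HasCompactSupport g) (r : ℝ) :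
    ∃ S : Finset (Fin N → ℤ), ∀ z, ‖π z‖ ≤ r → ∀ k ∉ S, z + ι (latt L k) ∉ tsupport g := by
  obtain ⟨R, hR⟩ := (hg.isCompact.image π.continuous).isBounded.exists_norm_le
  refine ⟨(finite_latt_norm_le hL (R + r)).toFinset, fun z hz k hk hmem => hk ?_⟩
  rw [Finite.mem_toFinset, Set.mem_ofPred_eq]
  have h1 := hR _ (mem_image_of_mem π hmem)
  rw [_root_.map_add, hπι] at h1
  calc ‖latt L k‖ = ‖(π z + latt L k) - π z‖ := by congr 1; abel
    _ ≤ ‖π z + latt L k‖ + ‖π z‖ := norm_sub_le _ _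
    _ ≤ R + r := add_le_add h1 hz

theorem periodize_eq_sum {ι : E N →L[ℝ] X} {g : X → ℝ} {S : Finset (Fin N → ℤ)} {z : X}
    (h : ∀ k ∉ S, z + ι (latt L k) ∉ tsupport g) :
    periodize L ι g z = ∑ k ∈ S, g (z + ι (latt L k)) := by
  refine finsum_eq_sum_of_support_subset _ fun k hk => ?_
  by_contra hn
  exact hk (image_eq_zero_of_notMem_tsupport (h k hn))

theorem periodize_eventuallyEq (hL : ∀ i, 0 < L i) (π : X →L[ℝ] E N) (ι : E N →L[ℝ] X)
    (hπι : ∀ y, π (ι y) = y) {g : X → ℝ} (hg : HasCompactSupport g) (r : ℝ) :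
    ∃ S : Finset (Fin N → ℤ), (∀ z, ‖π z‖ < r → ∀ k ∉ S, z + ι (latt L k) ∉ tsupport g) ∧
      ∀ z, ‖π z‖ < r → periodize L ι g =ᶠ[𝓝 z] fun z => ∑ k ∈ S, g (z + ι (latt L k)) := by
  obtain ⟨S, hS⟩ := exists_finset_latt hL π ι hπι hg r
  refine ⟨S, fun z hz => hS z hz.le, fun z hz => ?_⟩
  have ho : IsOpen {z : X | ‖π z‖ < r} := isOpen_lt (by fun_prop) continuous_const
  filter_upwards [ho.mem_nhds hz] with z' hz'
  exact periodize_eq_sum (hS z' (le_of_lt hz'))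

/-- Near each point the sum over the lattice is a fixed finite sum. -/
theorem contDiff_periodize (hL : ∀ i, 0 < L i) (π : X →L[ℝ] E N) (ι : E N →L[ℝ] X)
    (hπι : ∀ y, π (ι y) = y) {g : X → ℝ} (hg : HasCompactSupport g) (hs : ContDiff ℝ ∞ g) :
    ContDiff ℝ ∞ (periodize L ι g) := by
  rw [contDiff_iff_contDiffAt]
  intro z
  obtain ⟨S, -, hS⟩ := periodize_eventuallyEq hL π ι hπι hg (‖π z‖ + 1)
  refine ContDiffAt.congr_of_eventuallyEq ?_ (hS z (by linarith))
  exact ContDiffAt.sum fun k _ => (hs.comp (contDiff_id.add contDiff_const)).contDiffAt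

theorem periodize_nonneg {ι : E N →L[ℝ] X} {g : X → ℝ} (h : ∀ z, 0 ≤ g z) (z : X) :
    0 ≤ periodize L ι g z := finsum_nonneg fun _ => h _

/-- Directional derivatives of the periodization. -/
theorem fderiv_periodize {ι : E N →L[ℝ] X} {g : X → ℝ} {S : Finset (Fin N → ℤ)} {z : X}
    (hd : Differentiable ℝ g)
    (h : periodize L ι g =ᶠ[𝓝 z] fun z => ∑ k ∈ S, g (z + ι (latt L k))) :
    fderiv ℝ (periodize L ι g) z = ∑ k ∈ S, fderiv ℝ g (z + ι (latt L k)) := by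
  have h1 : ∀ k, DifferentiableAt ℝ (fun z => g (z + ι (latt L k))) z := fun k =>
    (hd.comp (by fun_prop : Differentiable ℝ fun z => z + ι (latt L k))).differentiableAt
  rw [h.fderiv_eq, fderiv_fun_sum fun k _ => h1 k]
  exact Finset.sum_congr rfl fun k _ => fderiv_comp_add_right _

theorem periodize_eq_zero {ι : E N →L[ℝ] X} {g : X → ℝ} {z : X}
    (h : ∀ k, g (z + ι (latt L k)) = 0) : periodize L ι g z = 0 := by
  simp [periodize, h]

/-- If `g` is supported in the cell, its periodization coincides with `g` there. -/
theorem periodize_of_mem_cell (hL : ∀ i, 0 < L i) {π : X →L[ℝ] E N} {ι : E N →L[ℝ] X}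
    (hπι : ∀ y, π (ι y) = y) {g : X → ℝ} (hg : ∀ z, g z ≠ 0 → π z ∈ cell L) {z : X}
    (hz : π z ∈ cell L) : periodize L ι g z = g z := by
  have h0 : latt L 0 = 0 := by ext i; simp [latt_apply]
  unfold periodize
  rw [finsum_eq_single _ (0 : Fin N → ℤ)]
  · rw [h0, _root_.map_zero, add_zero]
  · intro k hk
    by_contra hne
    have h1 := hg _ hne
    rw [_root_.map_add, hπι] at h1
    apply hk
    have h2 : cellFloor L (π z) = 0 := cellFloor_eq_of_mem hL (by rwa [h0, sub_zero])
    have h3 : cellFloor L (π z) = -k := cellFloor_eq_of_mem hL (by rwa [latt_neg, sub_neg_eq_add])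
    rw [h2] at h3
    exact neg_eq_zero.1 h3.symm

variable [MeasurableSpace X] [BorelSpace X]

theorem measurableSet_preimage_cell (π : X →L[ℝ] E N) : MeasurableSet (π ⁻¹' cell L) :=
  π.continuous.measurable (measurableSet_cell L)

/-- Unfolding: an integral over the whole space as an integral over the cell. -/
theorem integral_eq_setIntegral_cell (hL : ∀ i, 0 < L i) {π : X →L[ℝ] E N} {ι : E N →L[ℝ] X}
    (hπι : ∀ y, π (ι y) = y) (μ : Measure X) [μ.IsAddRightInvariant] {f : X → ℝ}
    (hf : Integrable f μ) {S : Finset (Fin N → ℤ)}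
    (hS : ∀ z, π z ∈ cell L → ∀ k ∉ S, f (z + ι (latt L k)) = 0) :
    ∫ z, f z ∂μ = ∫ z in π ⁻¹' cell L, ∑ k ∈ S, f (z + ι (latt L k)) ∂μ := by
  set s : (Fin N → ℤ) → Set X := fun k => {z | π z - latt L k ∈ cell L} with hs
  have hsm : ∀ k, MeasurableSet (s k) := fun k =>
    (π.continuous.measurable.sub_const _) (measurableSet_cell L)
  have hsd : Pairwise (Function.onFun Disjoint s) := by
    intro k l hkl
    refine Set.disjoint_left.2 fun z hk hl => hkl ?_
    rw [← cellFloor_eq_of_mem hL hk, ← cellFloor_eq_of_mem hL hl]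
  have hsu : ⋃ k, s k = univ := by
    refine eq_univ_of_forall fun z => mem_iUnion.2 ⟨cellFloor L (π z), ?_⟩
    exact fold_mem_cell hL (π z)
  have h1 := hasSum_integral_iUnion hsm hsd (f := f) (μ := μ) (by rw [hsu]; exact hf.integrableOn)
  rw [hsu, setIntegral_univ] at h1
  have h2 : ∀ k, ∫ z in s k, f z ∂μ = ∫ z in π ⁻¹' cell L, f (z + ι (latt L k)) ∂μ := by
    intro k
    have hmp := measurePreserving_add_right μ (ι (latt L k))
    rw [← hmp.setIntegral_preimage_emb (MeasurableEquiv.addRight _).measurableEmbedding f (s k)]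
    congr 2
    ext z
    simp [hs, hπι]
  have h3 : ∀ k ∉ S, ∫ z in s k, f z ∂μ = 0 := by
    intro k hk
    rw [h2 k]
    refine setIntegral_eq_zero_of_forall_eq_zero fun z hz => hS z hz k hk
  rw [h1.unique (hasSum_sum_of_ne_finset_zero h3), integral_finsetSum]
  · exact Finset.sum_congr rfl fun k _ => h2 k
  · intro k _
    exact (hf.comp_add_right _).integrableOn

/-- The open periodicity box. -/
def openCell (L : Fin N → ℝ) : Set (E N) := {y | ∀ i, 0 < y i ∧ y i < L i}

theorem isOpen_openCell (L : Fin N → ℝ) : IsOpen (openCell L) := by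
  have : openCell L = ⋂ i, {y : E N | 0 < y i ∧ y i < L i} := by ext; simp [openCell]
  rw [this]
  refine isOpen_iInter_of_finite fun i => ?_
  have h : Continuous fun y : E N => y i := by fun_prop
  exact (isOpen_lt continuous_const h).inter (isOpen_lt h continuous_const)

theorem openCell_subset_cell : openCell L ⊆ cell L := fun _ hy i => ⟨(hy i).1.le, (hy i).2⟩

variable [FiniteDimensional ℝ X]

/-- The points of the half-open cell outside the open one lie in finitely many coordinate
hyperplanes, which are proper subspaces. -/
theorem ae_mem_openCell {π : X →L[ℝ] E N} {ι : E N →L[ℝ] X}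
    (hπι : ∀ y, π (ι y) = y) (μ : Measure X) [μ.IsAddHaarMeasure] :
    ∀ᵐ z ∂μ, π z ∈ cell L → π z ∈ openCell L := by
  have h : ∀ i : Fin N, ∀ᵐ z ∂μ, π z i ≠ 0 := by
    intro i
    set ℓ : X →ₗ[ℝ] ℝ := (EuclideanSpace.proj (𝕜 := ℝ) i).toLinearMap ∘ₗ π.toLinearMap with hℓ
    have hker : LinearMap.ker ℓ ≠ ⊤ := by
      intro h
      have : ι (EuclideanSpace.single i 1) ∈ LinearMap.ker ℓ := by rw [h]; trivial
      rw [LinearMap.mem_ker] at this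
      simp [hℓ, hπι] at this
    have := Measure.addHaar_submodule μ _ hker
    rw [ae_iff]
    convert! this using 2
    ext z
    simp [hℓ]
  filter_upwards [ae_all_iff.2 h] with z hz hc i
  exact ⟨lt_of_le_of_ne (hc i).1 (hz i).symm, (hc i).2⟩

/-- A function whose integrals over the cell against non-negative periodic test functions are
non-negative is itself non-negative. -/
theorem ae_nonneg_of_periodize (hL : ∀ i, 0 < L i) {π : X →L[ℝ] E N} {ι : E N →L[ℝ] X}
    (hπι : ∀ y, π (ι y) = y) (μ : Measure X) [μ.IsAddHaarMeasure] {F : X → ℝ}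
    (hF : LocallyIntegrable F (μ.restrict (π ⁻¹' cell L)))
    (h : ∀ g : X → ℝ, ContDiff ℝ ∞ g → HasCompactSupport g → (∀ z, 0 ≤ g z) →
      0 ≤ ∫ z in π ⁻¹' cell L, F z * periodize L ι g z ∂μ) :
    ∀ᵐ z ∂(μ.restrict (π ⁻¹' cell L)), 0 ≤ F z := by
  -- Extension by zero gives a locally integrable function on the whole space, whose mollifications
  -- converge almost everywhere.
  set F₁ : X → ℝ := (π ⁻¹' cell L).indicator F with hF₁
  have hm := measurableSet_preimage_cell (L := L) π
  have hloc : LocallyIntegrable F₁ μ := by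
    intro x
    obtain ⟨U, hU, hI⟩ := hF x
    refine ⟨U, hU, ?_⟩
    rw [IntegrableOn, Measure.restrict_restrict₀' hm.nullMeasurableSet] at hI
    rw [hF₁, IntegrableOn, integrable_indicator_iff hm, IntegrableOn, Measure.restrict_restrict hm,
      inter_comm]
    exact hI
  -- The ratio of the outer to the inner radius has to stay bounded for convergence at Lebesgue
  -- points; here it equals two.
  let φ : ℕ → ContDiffBump (0 : X) := fun n =>
    ⟨1 / (n + 1), 2 / (n + 1), by positivity, by gcongr; norm_num⟩
  have hφ : Tendsto (fun n => (φ n).rOut) atTop (𝓝 0) := by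
    have := (tendsto_one_div_add_atTop_nhds_zero_nat (𝕜 := ℝ)).const_mul 2
    simpa [φ, ← div_eq_mul_inv] using this
  have hK : ∀ᶠ n in atTop, (φ n).rOut ≤ 2 * (φ n).rIn := by
    refine Eventually.of_forall fun n => ?_
    change (2 : ℝ) / (n + 1) ≤ 2 * (1 / (n + 1))
    rw [mul_one_div]
  have hconv := ContDiffBump.ae_convolution_tendsto_right_of_locallyIntegrable (μ := μ) hφ hK hloc
  rw [ae_restrict_iff' hm]
  filter_upwards [hconv, ae_mem_openCell (L := L) hπι μ] with z hz hzo hzc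
  have hzc' : z ∈ π ⁻¹' cell L := hzc
  have ho : IsOpen (π ⁻¹' openCell L) := (isOpen_openCell L).preimage π.continuous
  obtain ⟨ε, hε, hball⟩ := Metric.isOpen_iff.1 ho z (hzo hzc)
  have hF₁z : F₁ z = F z := indicator_of_mem hzc' F
  rw [← hF₁z]
  refine ge_of_tendsto hz ?_
  -- Once the outer radius is below ε the kernel centred at z lives inside the cell, where it
  -- coincides with its periodization; the hypothesis then applies to it.
  filter_upwards [hφ.eventually (gt_mem_nhds hε)] with n hn
  rw [convolution_def]
  set g : X → ℝ := fun v => (φ n).normed μ (z - v) with hg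
  have hgs : ContDiff ℝ ∞ g := (φ n).contDiff_normed.comp (contDiff_const.sub contDiff_id)
  have hgsub : ∀ v, g v ≠ 0 → v ∈ Metric.closedBall z (φ n).rOut := by
    intro v hv
    have : z - v ∈ Function.support ((φ n).normed μ) := hv
    rw [(φ n).support_normed_eq, mem_ball_zero_iff] at this
    rw [mem_closedBall_iff_norm, norm_sub_rev]
    exact this.le
  have hgc : HasCompactSupport g :=
    HasCompactSupport.intro (isCompact_closedBall z (φ n).rOut) fun v hv => by
      by_contra hne
      exact hv (hgsub v hne)
  have hgcell : ∀ v, g v ≠ 0 → π v ∈ cell L := fun v hv =>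
    openCell_subset_cell (hball (Metric.closedBall_subset_ball hn (hgsub v hv)))
  have e := h g hgs hgc fun v => (φ n).nonneg_normed _
  have e2 : ∫ v in π ⁻¹' cell L, F v * periodize L ι g v ∂μ =
      ∫ v in π ⁻¹' cell L, F v * g v ∂μ := by
    refine setIntegral_congr_fun hm fun v hv => ?_
    rw [periodize_of_mem_cell hL hπι hgcell hv]
  rw [e2, ← integral_indicator hm] at e
  have e3 : ∀ v, (ContinuousLinearMap.lsmul ℝ ℝ) ((φ n).normed μ v) (F₁ (z - v)) =
      (fun u => (π ⁻¹' cell L).indicator (fun v => F v * g v) u) (z - v) := by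
    intro v
    by_cases hv : z - v ∈ π ⁻¹' cell L
    · simp [hF₁, hv, indicator_of_mem, hg, mul_comm]
    · simp [hF₁, hv, indicator_of_notMem]
  rw [integral_congr_ae (Eventually.of_forall e3), integral_sub_left_eq_self]
  exact e

end Periodize

/-! ### The measures as restrictions of Haar measures -/

section Spaces

variable {N : ℕ} {L : Fin N → ℝ}

instance : (volume : Measure (E N × ℝ)).IsAddHaarMeasure :=
  Measure.prod.instIsAddHaarMeasure (volume : Measure (E N)) (volume : Measure ℝ)

instance : (volume : Measure (E N × E N × ℝ)).IsAddHaarMeasure :=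
  Measure.prod.instIsAddHaarMeasure (volume : Measure (E N)) (volume : Measure (E N × ℝ))

theorem measYXi_eq (L : Fin N → ℝ) :
    measYXi L = (volume : Measure (E N × ℝ)).restrict
      (ContinuousLinearMap.fst ℝ (E N) ℝ ⁻¹' cell L) := by
  have : (ContinuousLinearMap.fst ℝ (E N) ℝ ⁻¹' cell L) = cell L ×ˢ (univ : Set ℝ) := by
    ext; simp
  rw [this, Measure.volume_eq_prod, ← Measure.prod_restrict, Measure.restrict_univ]
  rfl

/-- The projection `(x, y, ξ) ↦ y`. -/
def projY (N : ℕ) : E N × E N × ℝ →L[ℝ] E N :=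
  (ContinuousLinearMap.fst ℝ (E N) ℝ).comp (ContinuousLinearMap.snd ℝ (E N) (E N × ℝ))

/-- The embedding `y ↦ (0, y, 0)`. -/
def inclY (N : ℕ) : E N →L[ℝ] E N × E N × ℝ :=
  (ContinuousLinearMap.inr ℝ (E N) (E N × ℝ)).comp (ContinuousLinearMap.inl ℝ (E N) ℝ)

theorem projY_inclY (y : E N) : projY N (inclY N y) = y := rfl

theorem measXYXi_eq (L : Fin N → ℝ) :
    measXYXi L = (volume : Measure (E N × E N × ℝ)).restrict (projY N ⁻¹' cell L) := by
  have : (projY N ⁻¹' cell L) =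
      (univ : Set (E N)) ×ˢ (ContinuousLinearMap.fst ℝ (E N) ℝ ⁻¹' cell L) := by
    ext; simp [projY]
  rw [this, Measure.volume_eq_prod, ← Measure.prod_restrict, Measure.restrict_univ, ← measYXi_eq]
  rfl

end Spaces

/-! ### Pairings with square-integrable functions -/

section Generic

theorem memLp_of_eq_zero_off_compact {X : Type*} [TopologicalSpace X] [MeasurableSpace X]
    [OpensMeasurableSpace X] [T2Space X] {μ : Measure X} [IsLocallyFiniteMeasure μ]
    {u : X → ℝ} (hu : AEStronglyMeasurable u μ) {B : Set X} (hB : IsCompact B) {C : ℝ}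
    (hC : ∀ x ∈ B, |u x| ≤ C) (h0 : ∀ᵐ x ∂μ, x ∉ B → u x = 0) (p : ℝ≥0∞) : MemLp u p μ := by
  have hBm := hB.isClosed.measurableSet
  have : IsFiniteMeasure (μ.restrict B) :=
    ⟨by rw [Measure.restrict_apply_univ]; exact hB.measure_lt_top⟩
  have h1 : MemLp u p (μ.restrict B) := by
    refine MemLp.of_bound hu.restrict C ?_
    rw [ae_restrict_iff' hBm]
    exact Eventually.of_forall hC
  refine (memLp_congr_ae ?_).1 ((memLp_indicator_iff_restrict hBm).2 h1)
  filter_upwards [h0] with x hx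
  by_cases hxB : x ∈ B
  · rw [indicator_of_mem hxB]
  · rw [indicator_of_notMem hxB, hx hxB]

theorem inner_toLp_eq {X : Type*} [MeasurableSpace X] {μ : Measure X} (φ : Lp ℝ 2 μ) {u : X → ℝ}
    (hu : MemLp u 2 μ) : inner ℝ φ (hu.toLp u) = ∫ x, φ x * u x ∂μ := by
  rw [L2.inner_def]
  refine integral_congr_ae ?_
  filter_upwards [hu.coeFn_toLp] with x hx
  rw [hx, inner_real_eq_mul]

/-- Used to see that the conditions defining the constraint set, which are equalities and
inequalities between such pairings and constants, are closed in L². -/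
theorem continuous_integral_mul {X : Type*} [MeasurableSpace X] {μ : Measure X} {u : X → ℝ}
    (hu : MemLp u 2 μ) : Continuous fun φ : Lp ℝ 2 μ => ∫ x, φ x * u x ∂μ := by
  simp only [← inner_toLp_eq _ hu]
  fun_prop

theorem integrable_Lp_mul {X : Type*} [MeasurableSpace X] {μ : Measure X} (φ : Lp ℝ 2 μ)
    {u : X → ℝ} (hu : MemLp u 2 μ) : Integrable (fun x => φ x * u x) μ :=
  (Lp.memLp φ).integrable_mul hu

end Generic

/-! ### The kinetic inequality ∂_ξ φ ≤ δ and its monotone form -/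

section Constraint

variable {N : ℕ} {L : Fin N → ℝ}

/-- The compact slab containing the supports of the test functions. -/
def slab (L : Fin N → ℝ) (R : ℝ) : Set (E N × ℝ) := closedCell L ×ˢ Icc (-R) R

theorem isCompact_slab (L : Fin N → ℝ) (R : ℝ) : IsCompact (slab L R) :=
  (isCompact_closedCell L).prod isCompact_Icc

theorem ae_fst_mem_cell (L : Fin N → ℝ) : ∀ᵐ w ∂(measYXi L), w.1 ∈ cell L := by
  rw [measYXi_eq]
  exact ae_restrict_mem (measurableSet_preimage_cell (ContinuousLinearMap.fst ℝ (E N) ℝ))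

theorem ae_mem_slab (L : Fin N → ℝ) (R : ℝ) : ∀ᵐ w ∂(measYXi L), w ∉ slab L R → R < |w.2| := by
  filter_upwards [ae_fst_mem_cell L] with w hw hn
  by_contra hle
  exact hn ⟨cell_subset_closedCell hw, abs_le.1 (not_lt.1 hle)⟩

theorem memLp_of_continuous_slab {u : E N × ℝ → ℝ} (hu : Continuous u) {R : ℝ}
    (h : ∀ w, R < |w.2| → u w = 0) (p : ℝ≥0∞) : MemLp u p (measYXi L) := by
  obtain ⟨C, hC⟩ := (isCompact_slab L R).exists_bound_of_continuousOn hu.continuousOn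
  refine memLp_of_eq_zero_off_compact hu.aestronglyMeasurable (isCompact_slab L R) hC ?_ p
  filter_upwards [ae_mem_slab L R] with w hw hn
  exact h w (hw hn)

theorem memLp_of_bounded_slab {u : E N × ℝ → ℝ} (hu : AEStronglyMeasurable u (measYXi L)) {R C : ℝ}
    (hC : ∀ w, |u w| ≤ C) (h : ∀ᵐ w ∂(measYXi L), R < |w.2| → u w = 0) (p : ℝ≥0∞) :
    MemLp u p (measYXi L) := by
  refine memLp_of_eq_zero_off_compact hu (isCompact_slab L R) (fun w _ => hC w) ?_ p
  filter_upwards [ae_mem_slab L R, h] with w hw h1 hn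
  exact h1 (hw hn)

theorem measurePreserving_shift (L : Fin N → ℝ) (h : ℝ) :
    MeasurePreserving (fun w : E N × ℝ => (w.1, w.2 + h)) (measYXi L) (measYXi L) :=
  (MeasurePreserving.id (cellMeasure L)).prod (measurePreserving_add_right volume h)

theorem IsTestYXi.exists_support {ψ : E N × ℝ → ℝ} (hψ : IsTestYXi L ψ) :
    ∃ R : ℝ, 0 ≤ R ∧ ∀ w, R < |w.2| → ψ w = 0 := by
  obtain ⟨R, hR⟩ := hψ.support
  refine ⟨max R 0, le_max_right _ _, fun w hw => ?_⟩
  by_contra hne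
  exact absurd (hR w.1 w.2 hne) (not_le.2 ((le_max_left _ _).trans_lt hw))

theorem eventually_snd_gt {R : ℝ} {w : E N × ℝ} (hw : R < |w.2|) :
    ∀ᶠ v in 𝓝 w, R < |v.2| :=
  (isOpen_lt continuous_const (by fun_prop : Continuous fun v : E N × ℝ => |v.2|)).mem_nhds hw

theorem fderiv_eq_zero_of_slab {ψ : E N × ℝ → ℝ} {R : ℝ} (h : ∀ w, R < |w.2| → ψ w = 0)
    {w : E N × ℝ} (hw : R < |w.2|) : fderiv ℝ ψ w = 0 := by
  have : ψ =ᶠ[𝓝 w] fun _ => (0 : ℝ) := (eventually_snd_gt hw).mono fun v hv => h v hv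
  rw [this.fderiv_eq]
  simp

theorem deriv_snd_eq {ψ : E N × ℝ → ℝ} (hψ : Differentiable ℝ ψ) (w : E N × ℝ) :
    deriv (fun s => ψ (w.1, s)) w.2 = fderiv ℝ ψ w (0, 1) := by
  have h1 : HasDerivAt (fun s : ℝ => (w.1, s)) ((0 : E N), (1 : ℝ)) w.2 :=
    (hasDerivAt_const _ _).prodMk (hasDerivAt_id _)
  exact ((hψ w).hasFDerivAt.comp_hasDerivAt w.2 h1).deriv

theorem fderiv_fst_eq {ψ : E N × ℝ → ℝ} (hψ : Differentiable ℝ ψ) (w : E N × ℝ) (v : E N) :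
    fderiv ℝ (fun y' => ψ (y', w.2)) w.1 v = fderiv ℝ ψ w (v, 0) := by
  have h1 : HasFDerivAt (fun y' : E N => (y', w.2)) (ContinuousLinearMap.inl ℝ (E N) ℝ) w.1 :=
    hasFDerivAt_prodMk_left w.1 w.2
  have := (HasFDerivAt.comp w.1 (hψ w).hasFDerivAt h1).fderiv
  change fderiv ℝ (ψ ∘ fun y' => (y', w.2)) w.1 v = _
  rw [this]; simp

theorem IsTestYXi.differentiable {ψ : E N × ℝ → ℝ} (hψ : IsTestYXi L ψ) : Differentiable ℝ ψ :=
  hψ.smooth.differentiable (by simp)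

theorem IsTestYXi.continuous_fderiv {ψ : E N × ℝ → ℝ} (hψ : IsTestYXi L ψ) :
    Continuous (fderiv ℝ ψ) := hψ.smooth.continuous_fderiv (by simp)

theorem IsTestYXi.memLp {ψ : E N × ℝ → ℝ} (hψ : IsTestYXi L ψ) (p : ℝ≥0∞) :
    MemLp ψ p (measYXi L) := by
  obtain ⟨R, -, hR⟩ := hψ.exists_support
  exact memLp_of_continuous_slab hψ.smooth.continuous hR p

theorem IsTestYXi.memLp_deriv {ψ : E N × ℝ → ℝ} (hψ : IsTestYXi L ψ) (p : ℝ≥0∞) :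
    MemLp (fun w : E N × ℝ => deriv (fun s => ψ (w.1, s)) w.2) p (measYXi L) := by
  obtain ⟨R, -, hR⟩ := hψ.exists_support
  simp only [deriv_snd_eq hψ.differentiable]
  refine memLp_of_continuous_slab (hψ.continuous_fderiv.clm_apply continuous_const) (R := R) ?_ p
  intro w hw
  rw [fderiv_eq_zero_of_slab hR hw]; rfl

theorem velocity_eq {A : E N × ℝ → E N} (hA : IsDivFreeFlux L A) (y : E N) (ξ : ℝ) :
    velocity A y ξ = fderiv ℝ A (y, ξ) (0, 1) := by
  have h1 : HasDerivAt (fun s : ℝ => (y, s)) ((0 : E N), (1 : ℝ)) ξ :=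
    (hasDerivAt_const _ _).prodMk (hasDerivAt_id _)
  exact ((hA.contDiff.differentiable (by simp) (y, ξ)).hasFDerivAt.comp_hasDerivAt ξ h1).deriv

theorem continuous_velocity {A : E N × ℝ → E N} (hA : IsDivFreeFlux L A) :
    Continuous fun w : E N × ℝ => velocity A w.1 w.2 := by
  simp only [velocity_eq hA]
  exact (hA.contDiff.continuous_fderiv (by simp)).clm_apply continuous_const

theorem velocity_periodic {A : E N × ℝ → E N} (hA : IsDivFreeFlux L A) (y : E N) (ξ : ℝ)
    (i : Fin N) : velocity A (y + EuclideanSpace.single i (L i)) ξ = velocity A y ξ := by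
  unfold velocity
  congr 1
  funext s
  exact hA.periodic y s i

theorem IsTestYXi.memLp_transport {A : E N × ℝ → E N} (hA : IsDivFreeFlux L A)
    {ψ : E N × ℝ → ℝ} (hψ : IsTestYXi L ψ) (p : ℝ≥0∞) :
    MemLp (fun w : E N × ℝ => fderiv ℝ (fun y' => ψ (y', w.2)) w.1 (velocity A w.1 w.2)) p
      (measYXi L) := by
  obtain ⟨R, -, hR⟩ := hψ.exists_support
  simp only [fderiv_fst_eq hψ.differentiable]
  refine memLp_of_continuous_slab (hψ.continuous_fderiv.clm_apply
    ((continuous_velocity hA).prodMk continuous_const)) (R := R) ?_ p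
  intro w hw
  rw [fderiv_eq_zero_of_slab hR hw]; rfl

/-- `∂_ξ φ ≤ δ(ξ)` in the sense of distributions. -/
def KinNonneg (L : Fin N → ℝ) (φ : E N × ℝ → ℝ) : Prop :=
  ∀ ψ : E N × ℝ → ℝ, IsTestYXi L ψ → (∀ w, 0 ≤ ψ w) →
    0 ≤ (∫ y, ψ (y, 0) ∂(cellMeasure L)) +
      ∫ w, φ w * deriv (fun s => ψ (w.1, s)) w.2 ∂(measYXi L)

/-- `1_{ξ > 0} - φ` is non-decreasing in `ξ`. -/
def KinMono (L : Fin N → ℝ) (φ : E N × ℝ → ℝ) : Prop :=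
  ∀ h : ℝ, 0 < h → ∀ᵐ w ∂(measYXi L),
    φ (w.1, w.2 + h) - φ w ≤ (Ioc (-h) 0).indicator (fun _ => (1 : ℝ)) w.2

theorem HasKineticDerivative.kinNonneg {φ : E N × ℝ → ℝ} (h : HasKineticDerivative L φ) :
    KinNonneg L φ := by
  obtain ⟨ν, -, -, hν⟩ := h
  intro ψ hψ h0
  have := hν ψ hψ
  have h1 : 0 ≤ ∫ w, ψ w ∂ν := integral_nonneg h0
  linarith

theorem isTestYXi_periodize (hL : ∀ i, 0 < L i) {g : E N × ℝ → ℝ} (hs : ContDiff ℝ ∞ g)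
    (hc : HasCompactSupport g) :
    IsTestYXi L (periodize L (ContinuousLinearMap.inl ℝ (E N) ℝ) g) := by
  refine ⟨contDiff_periodize hL (ContinuousLinearMap.fst ℝ (E N) ℝ) _ (fun _ => rfl) hc hs, ?_, ?_⟩
  · intro y ξ i
    have := periodize_periodic (L := L) (ContinuousLinearMap.inl ℝ (E N) ℝ) g (y, ξ) i
    simpa using this
  · obtain ⟨R, hR⟩ := (hc.isCompact.image continuous_snd).isBounded.exists_norm_le
    refine ⟨R, fun y ξ hne => ?_⟩
    by_contra hgt
    apply hne
    refine periodize_eq_zero fun k => ?_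
    by_contra h0
    have := hR _ (mem_image_of_mem Prod.snd (subset_tsupport _ h0))
    simp at this
    exact hgt this

theorem IsTestYXi.shift {ψ : E N × ℝ → ℝ} (hψ : IsTestYXi L ψ) (s : ℝ) :
    IsTestYXi L fun w => ψ (w.1, w.2 - s) := by
  refine ⟨?_, fun y ξ i => hψ.periodic y (ξ - s) i, ?_⟩
  · exact hψ.smooth.comp (contDiff_fst.prodMk (contDiff_snd.sub contDiff_const))
  · obtain ⟨R, hR⟩ := hψ.support
    refine ⟨R + |s|, fun y ξ hne => ?_⟩
    have h1 := hR _ _ hne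
    calc |ξ| = |(ξ - s) + s| := by congr 1; ring
      _ ≤ |ξ - s| + |s| := abs_add_le _ _
      _ ≤ R + |s| := by linarith

/-- A test function is bounded on the slab, and so are its derivatives. -/
theorem IsTestYXi.exists_bound {ψ : E N × ℝ → ℝ} (hψ : IsTestYXi L ψ) :
    ∃ C, 0 ≤ C ∧ (∀ w : E N × ℝ, w.1 ∈ cell L → |ψ w| ≤ C) ∧
      ∀ w : E N × ℝ, w.1 ∈ cell L → ‖fderiv ℝ ψ w‖ ≤ C := by
  obtain ⟨R, -, hR⟩ := hψ.exists_support
  obtain ⟨C, hC⟩ := (isCompact_slab L R).exists_bound_of_continuousOn hψ.smooth.continuous.continuousOn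
  obtain ⟨C', hC'⟩ := (isCompact_slab L R).exists_bound_of_continuousOn
    hψ.continuous_fderiv.continuousOn
  refine ⟨max (max C C') 0, le_max_right _ _, fun w hw => ?_, fun w hw => ?_⟩
  · by_cases h : R < |w.2|
    · rw [hR w h, abs_zero]; exact le_max_right _ _
    · exact (hC w ⟨cell_subset_closedCell hw, abs_le.1 (not_lt.1 h)⟩).trans
        ((le_max_left _ _).trans (le_max_left _ _))
  · by_cases h : R < |w.2|
    · rw [fderiv_eq_zero_of_slab hR h, norm_zero]; exact le_max_right _ _
    · exact (hC' w ⟨cell_subset_closedCell hw, abs_le.1 (not_lt.1 h)⟩).trans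
        ((le_max_right _ _).trans (le_max_left _ _))

/-- The integrated form of `KinNonneg`. -/
theorem KinNonneg.integrated {φ : E N × ℝ → ℝ} (hφ : KinNonneg L φ) (hφ2 : MemLp φ 2 (measYXi L))
    {ψ : E N × ℝ → ℝ} (hψ : IsTestYXi L ψ) (h0 : ∀ w, 0 ≤ ψ w) {h : ℝ} (hh : 0 < h) :
    0 ≤ (∫ s in (0 : ℝ)..h, ∫ y, ψ (y, -s) ∂(cellMeasure L)) +
      ∫ w, φ w * (ψ w - ψ (w.1, w.2 - h)) ∂(measYXi L) := by
  obtain ⟨R, hR0, hR⟩ := hψ.exists_support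
  obtain ⟨C, hC0, hC, hC'⟩ := hψ.exists_bound
  set D : (E N × ℝ) × ℝ → ℝ := fun p => fderiv ℝ ψ (p.1.1, p.1.2 - p.2) (0, 1) with hD
  have hDc : Continuous D :=
    (hψ.continuous_fderiv.comp (by fun_prop)).clm_apply continuous_const
  have hint : Integrable (fun p : (E N × ℝ) × ℝ => φ p.1 * D p)
      ((measYXi L).prod (volume.restrict (Ioc 0 h))) := by
    -- φ is only square integrable; since D vanishes for |ξ| > R + h, cutting off to this slab
    -- supplies an integrable majorant.
    set b : E N × ℝ → ℝ := (slab L (R + h)).indicator fun _ => C with hb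
    have hbm : MeasurableSet (slab L (R + h)) := (isCompact_slab L _).isClosed.measurableSet
    have hb2 : MemLp b 2 (measYXi L) := by
      refine memLp_of_eq_zero_off_compact ((measurable_const.indicator hbm).aestronglyMeasurable)
        (isCompact_slab L (R + h)) (C := C) (fun w hw => ?_) (Eventually.of_forall fun w hw => ?_) 2
      · rw [indicator_of_mem hw, abs_of_nonneg hC0]
      · rw [indicator_of_notMem hw]
    have h1 : Integrable (fun w => φ w * b w) (measYXi L) := hφ2.integrable_mul hb2
    have h2 : Integrable (fun _ : ℝ => (1 : ℝ)) (volume.restrict (Ioc 0 h)) := integrable_const _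
    refine (h1.mul_prod h2).mono (hφ2.1.comp_fst.mul hDc.aestronglyMeasurable) ?_
    have a1 : ∀ᵐ p ∂((measYXi L).prod (volume.restrict (Ioc 0 h))), p.1.1 ∈ cell L :=
      Measure.quasiMeasurePreserving_fst.ae (ae_fst_mem_cell L)
    have a2 : ∀ᵐ p ∂((measYXi L).prod (volume.restrict (Ioc 0 h))), p.2 ∈ Ioc 0 h :=
      Measure.quasiMeasurePreserving_snd.ae (ae_restrict_mem measurableSet_Ioc)
    filter_upwards [a1, a2] with p hp1 hp2
    rw [norm_mul, norm_mul, norm_mul, norm_one, mul_one]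
    refine mul_le_mul_of_nonneg_left ?_ (norm_nonneg _)
    by_cases hm : p.1 ∈ slab L (R + h)
    · rw [hb, indicator_of_mem hm, Real.norm_of_nonneg hC0]
      have := (fderiv ℝ ψ (p.1.1, p.1.2 - p.2)).le_opNorm (0, 1)
      have hn : ‖((0 : E N), (1 : ℝ))‖ = 1 := by simp [Prod.norm_def]
      rw [hn, mul_one] at this
      exact this.trans (hC' _ hp1)
    · have : R < |p.1.2 - p.2| := by
        have hgt : R + h < |p.1.2| := by
          by_contra hle
          exact hm ⟨cell_subset_closedCell hp1, abs_le.1 (not_lt.1 hle)⟩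
        have h3 := abs_sub_abs_le_abs_sub p.1.2 p.2
        have h4 : |p.2| ≤ h := by rw [abs_of_pos hp2.1]; exact hp2.2
        linarith
      rw [hD]
      simp only
      rw [fderiv_eq_zero_of_slab hR (w := (p.1.1, p.1.2 - p.2)) this]
      simp
  -- The ξ-derivative of ψ(y, ξ - s) is minus its s-derivative, so the integral over s in (0, h)
  -- telescopes to ψ(y, ξ) - ψ(y, ξ - h).
  have hswap : ∫ w, φ w * (ψ w - ψ (w.1, w.2 - h)) ∂(measYXi L) =
      ∫ s in (0 : ℝ)..h, ∫ w, φ w * D (w, s) ∂(measYXi L) := by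
    rw [intervalIntegral.integral_of_le hh.le, ← integral_integral_swap (f := fun w s => φ w * D (w, s)) hint]
    refine integral_congr_ae (Eventually.of_forall fun w => ?_)
    simp only
    rw [integral_const_mul, ← intervalIntegral.integral_of_le hh.le]
    congr 1
    have hd : ∀ s, HasDerivAt (fun s => -ψ (w.1, w.2 - s)) (D (w, s)) s := by
      intro s
      have h1 : HasDerivAt (fun s : ℝ => (w.1, w.2 - s)) ((0 : E N), (-1 : ℝ)) s :=
        (hasDerivAt_const _ _).prodMk ((hasDerivAt_id s).const_sub w.2)
      have h2 := ((hψ.differentiable (w.1, w.2 - s)).hasFDerivAt.comp_hasDerivAt s h1).neg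
      convert! h2 using 1
      have : ((0 : E N), (-1 : ℝ)) = -((0 : E N), (1 : ℝ)) := by simp
      rw [this, _root_.map_neg, neg_neg]
    rw [intervalIntegral.integral_eq_sub_of_hasDerivAt (fun s _ => hd s)
      ((hDc.comp (by fun_prop : Continuous fun s : ℝ => (w, s))).intervalIntegrable _ _)]
    simp; ring
  have hi2 : IntervalIntegrable (fun s => ∫ w, φ w * D (w, s) ∂(measYXi L)) volume 0 h := by
    rw [intervalIntegrable_iff_integrableOn_Ioc_of_le hh.le]
    exact hint.integral_prod_right
  have hi1 : IntervalIntegrable (fun s => ∫ y, ψ (y, -s) ∂(cellMeasure L)) volume 0 h := by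
    rw [intervalIntegrable_iff_integrableOn_Ioc_of_le hh.le]
    have : Integrable (fun p : ℝ × E N => ψ (p.2, -p.1))
        ((volume.restrict (Ioc 0 h)).prod (cellMeasure L)) := by
      refine Integrable.of_bound (C := C)
        (hψ.smooth.continuous.comp (by fun_prop)).aestronglyMeasurable ?_
      have a1 : ∀ᵐ p ∂((volume.restrict (Ioc 0 h)).prod (cellMeasure L)), p.2 ∈ cell L :=
        Measure.quasiMeasurePreserving_snd.ae (ae_restrict_mem (measurableSet_cell L))
      filter_upwards [a1] with p hp
      exact hC _ hp
    exact this.integral_prod_left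
  rw [hswap, ← intervalIntegral.integral_add hi1 hi2]
  -- For fixed s the integrand is the expression of `KinNonneg` for ψ shifted by s in ξ.
  refine intervalIntegral.integral_nonneg hh.le fun s _ => ?_
  have := hφ _ (hψ.shift s) fun w => h0 _
  convert this using 2
  · simp
  · refine integral_congr_ae (Eventually.of_forall fun w => ?_)
    simp only
    rw [deriv_snd_eq (hψ.shift s).differentiable]
    congr 1
    rw [hD]
    simp only
    have e : (fun v : E N × ℝ => ψ (v.1, v.2 - s)) = fun v => ψ (v + (0, -s)) := by
      funext v; congr 1; simp [Prod.ext_iff, sub_eq_add_neg]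
    rw [e, fderiv_comp_add_right]
    congr 2
    simp [Prod.ext_iff, sub_eq_add_neg]

theorem integral_shift_mul (φ ψ : E N × ℝ → ℝ) (h : ℝ) :
    ∫ w, φ (w.1, w.2 + h) * ψ w ∂(measYXi L) = ∫ w, φ w * ψ (w.1, w.2 - h) ∂(measYXi L) := by
  have := (measurePreserving_shift L h).integral_comp
    (MeasurableEquiv.prodCongr (MeasurableEquiv.refl _)
      (MeasurableEquiv.addRight h)).measurableEmbedding
    (fun w : E N × ℝ => φ w * ψ (w.1, w.2 - h))
  rw [← this]
  simp

theorem integral_indicator_mul {ψ : E N × ℝ → ℝ} {h : ℝ} (hh : 0 ≤ h)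
    (hi : Integrable (fun w : E N × ℝ => (Ioc (-h) 0).indicator (fun _ => (1 : ℝ)) w.2 * ψ w)
      (measYXi L)) :
    ∫ w, (Ioc (-h) 0).indicator (fun _ => (1 : ℝ)) w.2 * ψ w ∂(measYXi L) =
      ∫ s in (0 : ℝ)..h, ∫ y, ψ (y, -s) ∂(cellMeasure L) := by
  rw [measYXi] at hi ⊢
  rw [integral_prod_symm _ hi,
    intervalIntegral.integral_comp_neg (fun s => ∫ y, ψ (y, s) ∂(cellMeasure L)), neg_zero,
    intervalIntegral.integral_of_le (by linarith), ← integral_indicator measurableSet_Ioc]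
  congr 1
  funext s
  by_cases hs : s ∈ Ioc (-h) 0 <;> simp [hs]

theorem memLp_indicator_Ioc (L : Fin N → ℝ) {h : ℝ} (p : ℝ≥0∞) :
    MemLp (fun w : E N × ℝ => (Ioc (-h) 0).indicator (fun _ => (1 : ℝ)) w.2) p (measYXi L) := by
  have hind : Measurable fun w : E N × ℝ => (Ioc (-h) 0).indicator (fun _ => (1 : ℝ)) w.2 :=
    (measurable_const.indicator measurableSet_Ioc).comp measurable_snd
  refine memLp_of_bounded_slab hind.aestronglyMeasurable (R := h) (C := 1) (fun w => ?_)
    (Eventually.of_forall fun w hw => ?_) p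
  · by_cases hm : w.2 ∈ Ioc (-h) 0 <;> simp [hm]
  · refine indicator_of_notMem (fun hm => ?_) _
    rw [abs_of_nonpos hm.2] at hw
    linarith [hm.1]

/-- By the integrated inequality and a shift of variables, the function 1_{(-h,0]}(ξ) - φ(ξ + h) +
φ(ξ) has non-negative pairing with every non-negative periodized test function, hence is
non-negative almost everywhere. The indicator is the increment of 1_{ξ>0} over a step h. -/
theorem KinNonneg.kinMono (hL : ∀ i, 0 < L i) {φ : E N × ℝ → ℝ} (hφ : KinNonneg L φ)
    (hφ2 : MemLp φ 2 (measYXi L)) : KinMono L φ := by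
  intro h hh
  set F : E N × ℝ → ℝ := fun w =>
    (Ioc (-h) 0).indicator (fun _ => (1 : ℝ)) w.2 - φ (w.1, w.2 + h) + φ w with hF
  have hind2 := memLp_indicator_Ioc L (h := h) 2
  have hsh : MemLp (fun w : E N × ℝ => φ (w.1, w.2 + h)) 2 (measYXi L) :=
    hφ2.comp_measurePreserving (measurePreserving_shift L h)
  have hF2 : MemLp F 2 (measYXi L) := (hind2.sub hsh).add hφ2
  have hae : ∀ᵐ w ∂(measYXi L), 0 ≤ F w := by
    rw [measYXi_eq]
    refine ae_nonneg_of_periodize hL (π := ContinuousLinearMap.fst ℝ (E N) ℝ)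
      (ι := ContinuousLinearMap.inl ℝ (E N) ℝ) (fun _ => rfl) volume ?_ ?_
    · rw [← measYXi_eq]
      exact hF2.locallyIntegrable (by norm_num)
    · intro g hgs hgc hg0
      rw [← measYXi_eq]
      have hψ := isTestYXi_periodize hL hgs hgc
      set ψ := periodize L (ContinuousLinearMap.inl ℝ (E N) ℝ) g
      have hψ0 : ∀ w, 0 ≤ ψ w := periodize_nonneg hg0
      have key := hφ.integrated hφ2 hψ hψ0 hh
      have i1 : Integrable (fun w : E N × ℝ =>
          (Ioc (-h) 0).indicator (fun _ => (1 : ℝ)) w.2 * ψ w) (measYXi L) :=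
        hind2.integrable_mul (hψ.memLp 2)
      have i2 : Integrable (fun w : E N × ℝ => φ (w.1, w.2 + h) * ψ w) (measYXi L) :=
        hsh.integrable_mul (hψ.memLp 2)
      have i3 : Integrable (fun w : E N × ℝ => φ w * ψ w) (measYXi L) :=
        hφ2.integrable_mul (hψ.memLp 2)
      have i4 : Integrable (fun w : E N × ℝ => φ w * ψ (w.1, w.2 - h)) (measYXi L) :=
        hφ2.integrable_mul ((hψ.shift h).memLp 2)
      have e1 : ∫ w, F w * ψ w ∂(measYXi L) =
          (∫ w, (Ioc (-h) 0).indicator (fun _ => (1 : ℝ)) w.2 * ψ w ∂(measYXi L)) -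
          (∫ w, φ (w.1, w.2 + h) * ψ w ∂(measYXi L)) + ∫ w, φ w * ψ w ∂(measYXi L) := by
        have i12 := integral_add (i1.sub i2) i3
        simp only [Pi.sub_apply] at i12
        rw [← integral_sub i1 i2, ← i12]
        refine integral_congr_ae (Eventually.of_forall fun w => ?_)
        simp only [hF]; ring
      rw [e1, integral_shift_mul, integral_indicator_mul hh.le i1]
      simp only [mul_sub] at key
      rw [integral_sub i3 i4] at key
      linarith
  filter_upwards [hae] with w hw
  simp only [hF] at hw
  linarith

end Constraint

/-! ### Recovery of the measure; the constraint set is closed and convex -/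

section Constraint

variable {N : ℕ} {L : Fin N → ℝ}

theorem integrable_of_slab {φ : E N × ℝ → ℝ} (hφ : MemLp φ 2 (measYXi L)) {R : ℝ}
    (h : ∀ᵐ w ∂(measYXi L), R < |w.2| → φ w = 0) : Integrable φ (measYXi L) := by
  have hbm : MeasurableSet (slab L R) := (isCompact_slab L _).isClosed.measurableSet
  have hb2 : MemLp ((slab L R).indicator fun _ => (1 : ℝ)) 2 (measYXi L) := by
    refine memLp_of_eq_zero_off_compact ((measurable_const.indicator hbm).aestronglyMeasurable)
      (isCompact_slab L R) (C := 1) (fun w hw => ?_) (Eventually.of_forall fun w hw => ?_) 2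
    · rw [indicator_of_mem hw, abs_one]
    · rw [indicator_of_notMem hw]
  have h1 : Integrable (fun w => φ w * (slab L R).indicator (fun _ => (1 : ℝ)) w) (measYXi L) :=
    hφ.integrable_mul hb2
  refine h1.congr ?_
  filter_upwards [h, ae_mem_slab L R] with w hw1 hw2
  by_cases hm : w ∈ slab L R
  · rw [indicator_of_mem hm, mul_one]
  · rw [hw1 (hw2 hm), zero_mul]

theorem hasDerivAt_shift {ψ : E N × ℝ → ℝ} (hψ : Differentiable ℝ ψ) (w : E N × ℝ) (s : ℝ) :
    HasDerivAt (fun s => ψ (w.1, w.2 - s)) (-fderiv ℝ ψ (w.1, w.2 - s) (0, 1)) s := by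
  have h1 : HasDerivAt (fun s : ℝ => (w.1, w.2 - s)) ((0 : E N), (-1 : ℝ)) s :=
    (hasDerivAt_const _ _).prodMk ((hasDerivAt_id s).const_sub w.2)
  have h2 := (hψ (w.1, w.2 - s)).hasFDerivAt.comp_hasDerivAt s h1
  convert! h2 using 1
  have : ((0 : E N), (-1 : ℝ)) = -((0 : E N), (1 : ℝ)) := by simp
  rw [this, _root_.map_neg]

theorem IsTestYXi.hasDerivAt_integral_shift {φ ψ : E N × ℝ → ℝ} (hψ : IsTestYXi L ψ)
    (hφ : Integrable φ (measYXi L)) :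
    HasDerivAt (fun s => ∫ w, φ w * ψ (w.1, w.2 - s) ∂(measYXi L))
      (-∫ w, φ w * deriv (fun s => ψ (w.1, s)) w.2 ∂(measYXi L)) 0 := by
  obtain ⟨C, hC0, hC, hC'⟩ := hψ.exists_bound
  have hn : ‖((0 : E N), (1 : ℝ))‖ = 1 := by simp [Prod.norm_def]
  have key := hasDerivAt_integral_of_dominated_loc_of_deriv_le (μ := measYXi L) (x₀ := (0 : ℝ))
    (s := univ) (F := fun s w => φ w * ψ (w.1, w.2 - s))
    (F' := fun s w => φ w * -fderiv ℝ ψ (w.1, w.2 - s) (0, 1)) (bound := fun w => ‖φ w‖ * C)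
    univ_mem ?_ ?_ ?_ ?_ ?_ ?_
  · have e : -∫ w, φ w * deriv (fun s => ψ (w.1, s)) w.2 ∂(measYXi L) =
        ∫ w, φ w * -fderiv ℝ ψ (w.1, w.2 - 0) (0, 1) ∂(measYXi L) := ?_
    · rw [e]; exact key.2
    rw [← integral_neg]
    refine integral_congr_ae (Eventually.of_forall fun w => ?_)
    simp only [deriv_snd_eq hψ.differentiable, sub_zero]
    ring
  · refine Eventually.of_forall fun s => hφ.1.mul ?_
    exact (hψ.smooth.continuous.comp (by fun_prop)).aestronglyMeasurable
  · refine (hφ.norm.mul_const C).mono (hφ.1.mul ?_) ?_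
    · exact (hψ.smooth.continuous.comp (by fun_prop)).aestronglyMeasurable
    · filter_upwards [ae_fst_mem_cell L] with w hw
      rw [norm_mul, norm_mul, norm_norm, Real.norm_of_nonneg hC0]
      exact mul_le_mul_of_nonneg_left (hC _ hw) (norm_nonneg _)
  · refine hφ.1.mul (Continuous.aestronglyMeasurable ?_)
    exact ((hψ.continuous_fderiv.comp (by fun_prop)).clm_apply continuous_const).neg
  · filter_upwards [ae_fst_mem_cell L] with w hw s _
    rw [norm_mul, norm_neg]
    refine mul_le_mul_of_nonneg_left ?_ (norm_nonneg _)
    have := (fderiv ℝ ψ (w.1, w.2 - s)).le_opNorm (0, 1)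
    rw [hn, mul_one] at this
    exact this.trans (hC' _ hw)
  · exact hφ.norm.mul_const C
  · exact Eventually.of_forall fun w s _ => (hasDerivAt_shift hψ.differentiable w s).const_mul _

theorem IsTestYXi.apply_fold {ψ : E N × ℝ → ℝ} (hψ : IsTestYXi L ψ) (w : E N × ℝ) :
    ψ (fold L w.1, w.2) = ψ w := by
  have := periodic_latt (L := L) (ContinuousLinearMap.inl ℝ (E N) ℝ : E N →+ E N × ℝ) (f := ψ)
    (fun x i => by
      have := hψ.periodic x.1 x.2 i
      convert this using 2
      simp [Prod.ext_iff]) (-cellFloor L w.1) w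
  rw [← this]
  congr 1
  ext1
  · simp [fold, latt_neg, sub_eq_add_neg]
  · simp

theorem IsTestYXi.exists_bound_all (hL : ∀ i, 0 < L i) {ψ : E N × ℝ → ℝ} (hψ : IsTestYXi L ψ) :
    ∃ C, ∀ w, |ψ w| ≤ C := by
  obtain ⟨C, -, hC, -⟩ := hψ.exists_bound
  exact ⟨C, fun w => by rw [← hψ.apply_fold w]; exact hC _ (fold_mem_cell hL _)⟩

/-- The difference quotients approximating the measure `ν = δ(ξ) - ∂_ξ φ`. -/
def kinDensity (φ : E N × ℝ → ℝ) (h : ℝ) (w : E N × ℝ) : ℝ :=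
  h⁻¹ * ((Ioc (-h) 0).indicator (fun _ => (1 : ℝ)) w.2 - φ (w.1, w.2 + h) + φ w)

theorem integral_kinDensity_mul {φ : E N × ℝ → ℝ} (hφ : Integrable φ (measYXi L))
    {ψ : E N × ℝ → ℝ} (hψ : Continuous ψ) {C : ℝ} (hC : ∀ w, |ψ w| ≤ C) {h : ℝ} (hh : 0 ≤ h) :
    ∫ w, kinDensity φ h w * ψ w ∂(measYXi L) =
      h⁻¹ * ((∫ s in (0 : ℝ)..h, ∫ y, ψ (y, -s) ∂(cellMeasure L)) -
        (∫ w, φ w * ψ (w.1, w.2 - h) ∂(measYXi L)) + ∫ w, φ w * ψ w ∂(measYXi L)) := by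
  have i1 : Integrable (fun w : E N × ℝ =>
      (Ioc (-h) 0).indicator (fun _ => (1 : ℝ)) w.2 * ψ w) (measYXi L) :=
    (memLp_one_iff_integrable.1 (memLp_indicator_Ioc L 1)).mul_bdd hψ.aestronglyMeasurable
      (Eventually.of_forall hC)
  have i3 : Integrable (fun w : E N × ℝ => φ w * ψ w) (measYXi L) :=
    hφ.mul_bdd hψ.aestronglyMeasurable (Eventually.of_forall hC)
  have hsh : Integrable (fun w : E N × ℝ => φ (w.1, w.2 + h)) (measYXi L) :=
    (measurePreserving_shift L h).integrable_comp_of_integrable hφ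
  have i2 : Integrable (fun w : E N × ℝ => φ (w.1, w.2 + h) * ψ w) (measYXi L) :=
    hsh.mul_bdd hψ.aestronglyMeasurable (Eventually.of_forall hC)
  have i12 := integral_add (i1.sub i2) i3
  simp only [Pi.sub_apply] at i12
  rw [integral_sub i1 i2, integral_shift_mul, integral_indicator_mul hh i1] at i12
  rw [← i12, ← integral_const_mul]
  refine integral_congr_ae (Eventually.of_forall fun w => ?_)
  simp only [kinDensity]; ring

theorem integrable_kinDensity {φ : E N × ℝ → ℝ} (hφ : Integrable φ (measYXi L)) (h : ℝ) :
    Integrable (kinDensity φ h) (measYXi L) :=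
  (((memLp_one_iff_integrable.1 (memLp_indicator_Ioc L 1)).sub
    ((measurePreserving_shift L h).integrable_comp_of_integrable hφ)).add hφ).const_mul _

theorem ae_kinDensity_eq_zero {φ : E N × ℝ → ℝ} {M : ℝ}
    (hM : ∀ᵐ w ∂(measYXi L), M < |w.2| → φ w = 0) {h : ℝ} (hh : 0 ≤ h) (hh1 : h ≤ 1) :
    ∀ᵐ w ∂(measYXi L), |M| + 1 < |w.2| → kinDensity φ h w = 0 := by
  filter_upwards [hM, (measurePreserving_shift L h).quasiMeasurePreserving.ae hM] with w h1 h2 hw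
  have e1 : φ w = 0 := h1 (by linarith [le_abs_self M])
  have e2 : φ (w.1, w.2 + h) = 0 := by
    refine h2 ?_
    have := abs_sub_abs_le_abs_sub w.2 (-h)
    rw [abs_neg, abs_of_nonneg hh, sub_neg_eq_add] at this
    change M < |w.2 + h|
    linarith [le_abs_self M]
  have e3 : w.2 ∉ Ioc (-h) 0 := by
    intro hm
    rw [abs_of_nonpos hm.2] at hw
    linarith [hm.1, abs_nonneg M]
  simp [kinDensity, e1, e2, e3]

/-- The densities `kinDensity` are non-negative by monotonicity, have the same total mass |Y|, and
live in a fixed compact slab. A weak limit as h → 0 therefore exists, and the pairing of the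
densities with a test function is a difference quotient that converges to ∫ ψ(y, 0) dy + ∫ φ ∂_ξ ψ.
-/
theorem KinMono.hasKineticDerivative (hL : ∀ i, 0 < L i) {φ : E N × ℝ → ℝ} (hφ : KinMono L φ)
    (hφ2 : MemLp φ 2 (measYXi L)) {M : ℝ} (hM : ∀ᵐ w ∂(measYXi L), M < |w.2| → φ w = 0) :
    HasKineticDerivative L φ := by
  have hφi := integrable_of_slab hφ2 hM
  set h : ℕ → ℝ := fun n => 1 / (n + 1) with hh
  have hpos : ∀ n, 0 < h n := fun n => by simp only [hh]; positivity
  have hle : ∀ n, h n ≤ 1 := fun n => by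
    simp only [hh]; rw [div_le_one (by positivity)]; linarith [(Nat.cast_nonneg n : (0 : ℝ) ≤ n)]
  have hlim : Tendsto h atTop (𝓝[≠] 0) := by
    rw [tendsto_nhdsWithin_iff]
    exact ⟨tendsto_one_div_add_atTop_nhds_zero_nat, Eventually.of_forall fun n => (hpos n).ne'⟩
  have hD0 : ∀ n, ∀ᵐ w ∂(measYXi L), 0 ≤ kinDensity φ (h n) w := by
    intro n
    filter_upwards [hφ (h n) (hpos n)] with w hw
    exact mul_nonneg (inv_nonneg.2 (hpos n).le) (by linarith)
  have hDi : ∀ n, Integrable (kinDensity φ (h n)) (measYXi L) := fun n =>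
    integrable_kinDensity hφi _
  set C : ℝ≥0 := (cellMeasure L).real univ |>.toNNReal with hC
  set ν' : ℕ → Measure (E N × ℝ) := fun n =>
    (measYXi L).withDensity fun w => ENNReal.ofReal (kinDensity φ (h n) w) with hν'
  -- Against the constant 1 the two terms in φ cancel by shift invariance, and the indicator
  -- contributes h⁻¹ · h · |Y|.
  have hmass : ∀ n, ν' n univ = C := by
    intro n
    have e := integral_kinDensity_mul hφi (ψ := fun _ => (1 : ℝ)) continuous_const (C := 1)
      (fun _ => by simp) (hpos n).le
    simp only [mul_one, integral_const, smul_eq_mul, intervalIntegral.integral_const, sub_zero,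
      sub_add_cancel] at e
    rw [inv_mul_cancel_left₀ (hpos n).ne'] at e
    rw [hν']
    simp only
    rw [withDensity_apply _ MeasurableSet.univ, Measure.restrict_univ,
      ← ofReal_integral_eq_lintegral_ofReal (hDi n) (hD0 n), e]
    rfl
  have hfin : ∀ n, IsFiniteMeasure (ν' n) := fun n => ⟨by rw [hmass]; exact ENNReal.coe_lt_top⟩
  set νF : ℕ → FiniteMeasure (E N × ℝ) := fun n => ⟨ν' n, hfin n⟩ with hνF
  have hslab : ∀ n, ν' n (slab L (|M| + 1))ᶜ = 0 := by
    intro n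
    have hbm : MeasurableSet (slab L (|M| + 1)) := (isCompact_slab L _).isClosed.measurableSet
    rw [hν']
    simp only
    rw [withDensity_apply _ hbm.compl]
    refine (lintegral_eq_zero_iff' ?_).2 ?_
    · exact ((hDi n).1.aemeasurable.ennreal_ofReal).restrict
    · rw [EventuallyEq, ae_restrict_iff' hbm.compl]
      filter_upwards [ae_kinDensity_eq_zero hM (hpos n).le (hle n), ae_mem_slab L (|M| + 1)]
        with w h1 h2 hw
      rw [h1 (h2 hw)]; simp
  have hcompact := isCompact_setOfPred_finiteMeasure_le_of_isCompact C
    (isCompact_slab L (|M| + 1))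
  -- A limit along an ultrafilter takes the place of the extraction of a subsequence.
  obtain ⟨ν₀, hν₀, hconv⟩ := hcompact.ultrafilter_le_nhds ((hyperfilter ℕ).map νF) (by
    rw [le_principal_iff, Ultrafilter.coe_map, mem_map]
    refine Eventually.of_forall fun n => ⟨?_, ?_⟩
    · rw [← ENNReal.coe_le_coe, FiniteMeasure.ennreal_mass]
      exact (hmass n).le
    · rw [← ENNReal.coe_eq_zero, FiniteMeasure.ennreal_coeFn_eq_coeFn_toMeasure]
      exact hslab n)
  have hconv' : Tendsto νF (hyperfilter ℕ) (𝓝 ν₀) := hconv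
  rw [FiniteMeasure.tendsto_iff_forall_integral_tendsto] at hconv'
  -- The limit lives on the closed box and may charge the faces left out of the half-open cell.
  -- Folding moves this mass back into the cell, and periodic test functions do not notice.
  set T : E N × ℝ → E N × ℝ := fun w => (fold L w.1, w.2) with hT
  have hTm : Measurable T := ((measurable_fold L).comp measurable_fst).prodMk measurable_snd
  refine ⟨(ν₀ : Measure (E N × ℝ)).map T, ?_, ?_, ?_⟩
  · have : IsFiniteMeasure ((ν₀ : Measure (E N × ℝ)).map T) := Measure.isFiniteMeasure_map _ _
    infer_instance
  · rw [Measure.map_apply hTm ((measurableSet_cell L).prod MeasurableSet.univ).compl]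
    convert measure_empty (μ := (ν₀ : Measure (E N × ℝ)))
    ext w
    simp [hT, fold_mem_cell hL]
  · intro ψ hψ
    obtain ⟨B, hB⟩ := hψ.exists_bound_all hL
    obtain ⟨B', hB0, hB', -⟩ := hψ.exists_bound
    have hψc := hψ.smooth.continuous
    rw [integral_map hTm.aemeasurable hψc.aestronglyMeasurable]
    have e1 : ∫ w, ψ (T w) ∂(ν₀ : Measure (E N × ℝ)) = ∫ w, ψ w ∂(ν₀ : Measure (E N × ℝ)) :=
      integral_congr_ae (Eventually.of_forall fun w => hψ.apply_fold w)
    rw [e1]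
    have l1 := hconv' (BoundedContinuousFunction.ofNormedAddCommGroup ψ hψc B hB)
    simp only [BoundedContinuousFunction.coe_ofNormedAddCommGroup] at l1
    set J : ℝ → ℝ := fun s => ∫ y, ψ (y, -s) ∂(cellMeasure L) with hJ
    have hJc : Continuous J := by
      refine continuous_of_dominated (bound := fun _ => B) (fun s => ?_) (fun s => ?_)
        (integrable_const _) ?_
      · exact (hψc.comp (by fun_prop)).aestronglyMeasurable
      · exact Eventually.of_forall fun y => hB _
      · exact Eventually.of_forall fun y => hψc.comp (by fun_prop)
    -- The pairing of `kinDensity φ h` with ψ equals h⁻¹ (Z(h) - Z(0)).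
    set Z : ℝ → ℝ := fun s => (∫ r in (0 : ℝ)..s, J r) -
      ∫ w, φ w * ψ (w.1, w.2 - s) ∂(measYXi L) with hZ
    have hZd : HasDerivAt Z (J 0 - -∫ w, φ w * deriv (fun s => ψ (w.1, s)) w.2 ∂(measYXi L)) 0 :=
      (intervalIntegral.integral_hasDerivAt_right (hJc.intervalIntegrable _ _)
        hJc.stronglyMeasurable.stronglyMeasurableAtFilter hJc.continuousAt).sub
        (hψ.hasDerivAt_integral_shift hφi)
    have l2 := ((hasDerivAt_iff_tendsto_slope_zero.1 hZd).comp hlim).mono_left Nat.hyperfilter_le_atTop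
    have e2 : ∀ n, ∫ w, ψ w ∂(νF n : Measure (E N × ℝ)) =
        ((fun t => t⁻¹ • (Z (0 + t) - Z 0)) ∘ h) n := by
      intro n
      change ∫ w, ψ w ∂(ν' n) = _
      rw [hν']
      simp only
      rw [integral_withDensity_eq_integral_toReal_smul₀ (hDi n).1.aemeasurable.ennreal_ofReal
        (Eventually.of_forall fun _ => ENNReal.ofReal_lt_top)]
      have e3 : ∫ w, (ENNReal.ofReal (kinDensity φ (h n) w)).toReal • ψ w ∂(measYXi L) =
          ∫ w, kinDensity φ (h n) w * ψ w ∂(measYXi L) := by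
        refine integral_congr_ae ?_
        filter_upwards [hD0 n] with w hw
        rw [ENNReal.toReal_ofReal hw, smul_eq_mul]
      rw [e3, integral_kinDensity_mul hφi hψc hB (hpos n).le]
      simp only [hZ, Function.comp_apply, zero_add, intervalIntegral.integral_same, sub_zero,
        smul_eq_mul, hJ]
      ring
    simp only [e2] at l1
    have := tendsto_nhds_unique l1 l2
    rw [this]
    simp only [hJ, neg_zero]
    ring

/-- Functions in the constraint set have the sign of `ξ` and are bounded by `1`. -/
theorem KinMono.sign_bounds {φ : E N × ℝ → ℝ} (hφ : KinMono L φ) {M : ℝ} (hM0 : 0 ≤ M)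
    (hM : ∀ᵐ w ∂(measYXi L), M < |w.2| → φ w = 0) :
    ∀ᵐ w ∂(measYXi L), (0 < w.2 → 0 ≤ φ w ∧ φ w ≤ 1) ∧ (w.2 ≤ 0 → -1 ≤ φ w ∧ φ w ≤ 0) := by
  -- For |ξ| ≤ M both ξ + h and ξ - h lie outside [-M, M], where φ vanishes. Monotonicity between ξ
  -- - h, ξ and ξ + h then gives all four bounds.
  set h : ℝ := 2 * M + 1 with hh
  have hpos : 0 < h := by positivity
  have mp := measurePreserving_shift L h
  have mn := measurePreserving_shift L (-h)
  filter_upwards [hM, mp.quasiMeasurePreserving.ae hM, mn.quasiMeasurePreserving.ae hM,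
    hφ h hpos, mn.quasiMeasurePreserving.ae (hφ h hpos)] with w h0 h1 h2 h3 h4
  simp only [neg_add_cancel_right] at h4
  by_cases hw : M < |w.2|
  · rw [h0 hw]; norm_num
  · have hw' := abs_le.1 (not_lt.1 hw)
    have e1 : φ (w.1, w.2 + h) = 0 := h1 (by
      rw [abs_of_nonneg (by linarith)]; simp only [hh]; linarith)
    have e2 : φ (w.1, w.2 + -h) = 0 := h2 (by
      rw [abs_of_nonpos (by linarith)]; simp only [hh]; linarith)
    rw [e1] at h3
    rw [e2] at h4
    constructor
    · intro hp
      rw [indicator_of_notMem (by simp [hp])] at h3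
      rw [indicator_of_mem (by constructor <;> linarith)] at h4
      constructor <;> linarith
    · intro hn
      rw [indicator_of_mem (by constructor <;> linarith)] at h3
      rw [indicator_of_notMem (by simp; intro; linarith)] at h4
      constructor <;> linarith

/-- Monotone odd functions below the identity preserve the kinetic inequality. -/
theorem KinMono.comp {φ : E N × ℝ → ℝ} (hφ : KinMono L φ)
    (hb : ∀ᵐ w ∂(measYXi L), (0 < w.2 → 0 ≤ φ w ∧ φ w ≤ 1) ∧ (w.2 ≤ 0 → -1 ≤ φ w ∧ φ w ≤ 0))
    {β : ℝ → ℝ} (hodd : ∀ s, β (-s) = -β s) (hmono : MonotoneOn β (Icc 0 1))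
    (h0 : β 0 = 0) (hle : ∀ s ∈ Icc (0 : ℝ) 1, β s ≤ s) : KinMono L fun w => β (φ w) := by
  have hnn : ∀ s ∈ Icc (0 : ℝ) 1, 0 ≤ β s := fun s hs => by
    rw [← h0]; exact hmono ⟨le_rfl, zero_le_one⟩ hs hs.1
  intro h hh
  filter_upwards [hφ h hh, hb, (measurePreserving_shift L h).quasiMeasurePreserving.ae hb]
    with w h1 h2 h3
  set p := φ w
  set q := φ (w.1, w.2 + h)
  -- If the step crosses ξ = 0, then φ goes from p ≤ 0 to q ≥ 0, and β(q) + β(-p) ≤ q - p ≤ 1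
  -- because β lies below the identity. If it does not cross, monotonicity of the odd function β
  -- suffices.
  by_cases hw : w.2 ∈ Ioc (-h) 0
  · rw [indicator_of_mem hw] at h1 ⊢
    obtain ⟨p1, p2⟩ := h2.2 hw.2
    obtain ⟨q1, q2⟩ := h3.1 (by linarith [hw.1])
    have a1 := hle q ⟨q1, q2⟩
    have a2 := hle (-p) ⟨by linarith, by linarith⟩
    rw [hodd] at a2
    linarith
  · rw [indicator_of_notMem hw] at h1 ⊢
    rcases lt_or_ge 0 w.2 with hp | hn
    · obtain ⟨p1, p2⟩ := h2.1 hp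
      obtain ⟨q1, q2⟩ := h3.1 (by linarith)
      have := hmono ⟨q1, q2⟩ ⟨p1, p2⟩ (by linarith)
      linarith
    · have hn' : w.2 + h ≤ 0 := by
        by_contra hc
        exact hw ⟨by linarith, hn⟩
      obtain ⟨p1, p2⟩ := h2.2 hn
      obtain ⟨q1, q2⟩ := h3.2 hn'
      have := hmono (a := -p) (b := -q) ⟨by linarith, by linarith⟩ ⟨by linarith, by linarith⟩
        (by linarith)
      rw [hodd, hodd] at this
      linarith

/-- The null set ξ = -h is excluded: there ξ + h = 0, where χ vanishes, while χ(-h, u) may equal -1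
and the indicator is zero. -/
theorem kinMono_chi {u : E N → ℝ} : KinMono L fun w => chi w.2 (u w.1) := by
  intro h hh
  have hne : ∀ᵐ w ∂(measYXi L), w.2 ≠ -h :=
    Measure.quasiMeasurePreserving_snd.ae (Measure.ae_ne volume (-h))
  filter_upwards [hne] with w hw
  by_cases hm : w.2 ∈ Ioc (-h) 0
  · rw [indicator_of_mem hm]
    obtain ⟨m1, m2⟩ := hm
    simp only [chi]
    split_ifs <;> linarith
  · rw [indicator_of_notMem hm]
    have hm' : w.2 < -h ∨ 0 < w.2 := by
      by_contra hc
      simp only [not_or, not_lt] at hc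
      exact hm ⟨lt_of_le_of_ne hc.1 (Ne.symm hw), hc.2⟩
    simp only [chi]
    split_ifs <;> grind

variable {A : E N × ℝ → E N} {M : ℝ}

/-- The existential quantifier over ν is replaced by linear inequalities in φ, a form from which
convexity and closedness can be read off. -/
theorem mem_constraintSet_iff (hL : ∀ i, 0 < L i) {φ : L2YXi L} :
    φ ∈ constraintSet L A M ↔ (∀ᵐ w ∂(measYXi L), M < |w.2| → φ w = 0) ∧ IsDivFree L A φ ∧
      KinNonneg L φ := by
  constructor
  · rintro ⟨h1, h2, h3⟩
    exact ⟨h1, h2, h3.kinNonneg⟩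
  · rintro ⟨h1, h2, h3⟩
    exact ⟨h1, h2, (h3.kinMono hL (Lp.memLp φ)).hasKineticDerivative hL (Lp.memLp φ) h1⟩

theorem kinMono_of_mem (hL : ∀ i, 0 < L i) {φ : L2YXi L} (h : φ ∈ constraintSet L A M) :
    KinMono L φ := ((mem_constraintSet_iff hL).1 h).2.2.kinMono hL (Lp.memLp φ)

theorem zero_mem_constraintSet (hL : ∀ i, 0 < L i) : (0 : L2YXi L) ∈ constraintSet L A M := by
  have h0 : (0 : L2YXi L) =ᵐ[measYXi L] 0 := Lp.coeFn_zero _ _ _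
  rw [mem_constraintSet_iff hL]
  refine ⟨?_, ?_, ?_⟩
  · filter_upwards [h0] with w hw _
    rw [hw]; rfl
  · intro ψ _
    refine integral_eq_zero_of_ae ?_
    filter_upwards [h0] with w hw
    rw [hw]; simp
  · intro ψ _ hψ0
    have : ∫ w, (0 : L2YXi L) w * deriv (fun s => ψ (w.1, s)) w.2 ∂(measYXi L) = 0 := by
      refine integral_eq_zero_of_ae ?_
      filter_upwards [h0] with w hw
      rw [hw]; simp
    rw [this, add_zero]
    exact integral_nonneg fun y => hψ0 _

theorem integral_comb_mul {X : Type*} [MeasurableSpace X] {μ : Measure X} (φ φ' : Lp ℝ 2 μ)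
    (a b : ℝ) {u : X → ℝ} (hu : MemLp u 2 μ) :
    ∫ w, (a • φ + b • φ') w * u w ∂μ = a * ∫ w, φ w * u w ∂μ + b * ∫ w, φ' w * u w ∂μ := by
  simp only [← inner_toLp_eq _ hu]
  rw [inner_add_left, real_inner_smul_left, real_inner_smul_left]

theorem convex_constraintSet (hL : ∀ i, 0 < L i) (hA : IsDivFreeFlux L A) :
    Convex ℝ (constraintSet L A M) := by
  intro φ hφ φ' hφ' a b ha hb hab
  rw [mem_constraintSet_iff hL] at hφ hφ' ⊢
  refine ⟨?_, ?_, ?_⟩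
  · filter_upwards [hφ.1, hφ'.1, Lp.coeFn_add (a • φ) (b • φ'), Lp.coeFn_smul a φ,
      Lp.coeFn_smul b φ'] with w h1 h2 h3 h4 h5 hw
    rw [h3, Pi.add_apply, h4, h5, Pi.smul_apply, Pi.smul_apply, h1 hw, h2 hw]; simp
  · intro ψ hψ
    rw [integral_comb_mul _ _ _ _ (hψ.memLp_transport hA 2), hφ.2.1 ψ hψ, hφ'.2.1 ψ hψ]; simp
  · intro ψ hψ h0
    rw [integral_comb_mul _ _ _ _ (hψ.memLp_deriv 2)]
    have h1 := mul_nonneg ha (hφ.2.2 ψ hψ h0)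
    have h2 := mul_nonneg hb (hφ'.2.2 ψ hψ h0)
    have h3 : ∫ y, ψ (y, 0) ∂(cellMeasure L) = a * ∫ y, ψ (y, 0) ∂(cellMeasure L) +
      b * ∫ y, ψ (y, 0) ∂(cellMeasure L) := by rw [← add_mul, hab, one_mul]
    linarith

theorem isClosed_support (M : ℝ) :
    IsClosed {φ : L2YXi L | ∀ᵐ w ∂(measYXi L), M < |w.2| → φ w = 0} := by
  refine IsSeqClosed.isClosed fun φ φ₀ hφ hlim => ?_
  obtain ⟨ns, -, hns⟩ := (tendstoInMeasure_of_tendsto_Lp hlim).exists_seq_tendsto_ae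
  filter_upwards [hns, ae_all_iff.2 hφ] with w h1 h2 hw
  refine tendsto_nhds_unique h1 ?_
  simp [h2 _ hw]

theorem isClosed_constraintSet (hL : ∀ i, 0 < L i) (hA : IsDivFreeFlux L A) :
    IsClosed (constraintSet L A M) := by
  have : constraintSet L A M = {φ : L2YXi L | ∀ᵐ w ∂(measYXi L), M < |w.2| → φ w = 0} ∩
      ({φ : L2YXi L | IsDivFree L A φ} ∩ {φ : L2YXi L | KinNonneg L φ}) := by
    ext φ; exact mem_constraintSet_iff hL
  rw [this]
  refine (isClosed_support M).inter (IsClosed.inter ?_ ?_)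
  · simp only [IsDivFree, Set.ofPred_forall]
    refine isClosed_iInter fun ψ => isClosed_iInter fun hψ => ?_
    exact isClosed_eq (continuous_integral_mul (hψ.memLp_transport hA 2)) continuous_const
  · simp only [KinNonneg, Set.ofPred_forall]
    refine isClosed_iInter fun ψ => isClosed_iInter fun hψ => isClosed_iInter fun _ => ?_
    exact isClosed_le continuous_const
      (continuous_const.add (continuous_integral_mul (hψ.memLp_deriv 2)))

end Constraint

/-! ### Limits and derivatives of curves in L² -/

section LpCurves

variable {X : Type*} [MeasurableSpace X] {μ : Measure X}

theorem norm_sq_Lp_eq (u : Lp ℝ 2 μ) : ‖u‖ ^ 2 = ∫ x, u x ^ 2 ∂μ := by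
  rw [← real_inner_self_eq_norm_sq, L2.inner_def]
  simp only [inner_real_eq_mul, sq]

/-- Dominated convergence in `L²`. -/
theorem tendsto_Lp_of_dominated {ι : Type*} {l : Filter ι} [l.IsCountablyGenerated]
    {c : ι → Lp ℝ 2 μ} {c₀ : Lp ℝ 2 μ} {G : ι → X → ℝ} {G₀ : X → ℝ}
    (hc : ∀ i, c i =ᵐ[μ] G i) (hc₀ : c₀ =ᵐ[μ] G₀) {b : X → ℝ} (hb : MemLp b 2 μ)
    (hle : ∀ᶠ i in l, ∀ᵐ x ∂μ, |G i x| ≤ b x)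
    (hlim : ∀ᵐ x ∂μ, Tendsto (fun i => G i x) l (𝓝 (G₀ x))) : Tendsto c l (𝓝 c₀) := by
  rw [tendsto_iff_norm_sub_tendsto_zero]
  have e : ∀ i, ‖c i - c₀‖ ^ 2 = ∫ x, (G i x - c₀ x) ^ 2 ∂μ := by
    intro i
    rw [norm_sq_Lp_eq]
    refine integral_congr_ae ?_
    filter_upwards [hc i, Lp.coeFn_sub (c i) c₀] with x h1 h2
    rw [h2, Pi.sub_apply, h1]
  have h1 : Tendsto (fun i => ∫ x, (G i x - c₀ x) ^ 2 ∂μ) l (𝓝 (∫ _, (0 : ℝ) ∂μ)) := by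
    have hbi : Integrable (fun x => (b x + |c₀ x|) ^ 2) μ :=
      (memLp_two_iff_integrable_sq (hb.1.add (Lp.aestronglyMeasurable c₀).norm)).1
        (hb.add (Lp.memLp c₀).norm)
    refine tendsto_integral_filter_of_dominated_convergence _ ?_ ?_ hbi ?_
    · refine Eventually.of_forall fun i => ?_
      exact (((Lp.aestronglyMeasurable (c i)).congr (hc i)).sub (Lp.aestronglyMeasurable c₀)).pow 2
    · filter_upwards [hle] with i hi
      filter_upwards [hi] with x h1
      rw [Real.norm_eq_abs, abs_of_nonneg (sq_nonneg _), ← sq_abs]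
      refine pow_le_pow_left₀ (abs_nonneg _) ((abs_sub _ _).trans ?_) 2
      linarith
    · filter_upwards [hlim, hc₀] with x h1 h2
      have := ((h1.sub_const (c₀ x)).pow 2)
      rwa [h2, sub_self, zero_pow (by norm_num), ← h2] at this
  simp only [integral_zero] at h1
  have h2 := h1.sqrt
  simp only [← e, Real.sqrt_sq (norm_nonneg _), Real.sqrt_zero] at h2
  exact h2

/-- Differentiation in `L²` from pointwise differentiation and domination. -/
theorem hasDerivAt_Lp_of_dominated {c : ℝ → Lp ℝ 2 μ} {c' : Lp ℝ 2 μ} {G G' : ℝ → X → ℝ} {t₀ : ℝ}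
    (hc : ∀ t, c t =ᵐ[μ] G t) (hc' : c' =ᵐ[μ] G' t₀)
    (hd : ∀ x t, HasDerivAt (fun s => G s x) (G' t x) t) {b : X → ℝ} (hb : MemLp b 2 μ)
    (hle : ∀ᵐ x ∂μ, ∀ t, |t - t₀| ≤ 1 → |G' t x| ≤ b x) : HasDerivAt c c' t₀ := by
  rw [hasDerivAt_iff_tendsto_slope_zero]
  refine tendsto_Lp_of_dominated (G := fun s x => s⁻¹ * (G (t₀ + s) x - G t₀ x)) (G₀ := G' t₀)
    (fun s => ?_) hc' hb ?_ ?_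
  · filter_upwards [hc (t₀ + s), hc t₀, Lp.coeFn_smul s⁻¹ (c (t₀ + s) - c t₀),
      Lp.coeFn_sub (c (t₀ + s)) (c t₀)] with x h1 h2 h3 h4
    rw [h3, Pi.smul_apply, h4, Pi.sub_apply, h1, h2, smul_eq_mul]
  · have h1 : ∀ᶠ s in 𝓝[≠] (0 : ℝ), s ∈ Metric.closedBall (0 : ℝ) 1 :=
      mem_nhdsWithin_of_mem_nhds (Metric.closedBall_mem_nhds _ one_pos)
    filter_upwards [h1, self_mem_nhdsWithin] with s hs hs0
    rw [mem_closedBall_zero_iff, Real.norm_eq_abs] at hs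
    filter_upwards [hle] with x hx
    -- By the mean value inequality the difference quotients inherit the majorant of the derivative.
    have key := (convex_closedBall t₀ (1 : ℝ)).norm_image_sub_le_of_norm_hasDerivWithin_le
      (f := fun t => G t x) (f' := fun t => G' t x) (C := b x)
      (fun t _ => (hd x t).hasDerivWithinAt)
      (fun t ht => hx t (by rwa [mem_closedBall_iff_norm] at ht))
      (Metric.mem_closedBall_self zero_le_one)
      (by rw [mem_closedBall_iff_norm]; simpa using hs : t₀ + s ∈ _)
    rw [add_sub_cancel_left, Real.norm_eq_abs, Real.norm_eq_abs] at key
    rw [abs_mul, abs_inv, inv_mul_le_iff₀ (abs_pos.2 hs0)]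
    linarith
  · refine Eventually.of_forall fun x => ?_
    have := hasDerivAt_iff_tendsto_slope_zero.1 (hd x t₀)
    simpa using this

end LpCurves

/-! ### The free transport group -/

section Transport

variable {N : ℕ} {L : Fin N → ℝ} {A : E N × ℝ → E N}

/-- The flow of the transport equation, backwards in time. -/
def flowMap (A : E N × ℝ → E N) (t : ℝ) (z : E N × E N × ℝ) : E N × E N × ℝ :=
  (z.1 - t • velocity A z.2.1 z.2.2, z.2)

theorem flowMap_add (s t : ℝ) (z : E N × E N × ℝ) :
    flowMap A (s + t) z = flowMap A t (flowMap A s z) := by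
  simp only [flowMap, add_smul]
  congr 1; abel

theorem flowMap_zero (z : E N × E N × ℝ) : flowMap A 0 z = z := by simp [flowMap]

theorem continuous_flowMap (hA : IsDivFreeFlux L A) :
    Continuous fun p : ℝ × E N × E N × ℝ => flowMap A p.1 p.2 := by
  have h := (continuous_velocity hA).comp
    (by fun_prop : Continuous fun p : ℝ × E N × E N × ℝ => p.2.2)
  exact ((continuous_fst.comp continuous_snd).sub (continuous_fst.smul h)).prodMk
    (continuous_snd.comp continuous_snd)

/-- For fixed (y, ξ) the flow is a translation in x, so after exchanging the factors it is a skew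
product of measure-preserving maps. -/
theorem measurePreserving_flowMap (hA : IsDivFreeFlux L A) (t : ℝ) :
    MeasurePreserving (flowMap A t) (measXYXi L) (measXYXi L) := by
  have hv : Measurable fun w : E N × ℝ => velocity A w.1 w.2 := (continuous_velocity hA).measurable
  have h1 : MeasurePreserving (fun p : (E N × ℝ) × E N => (id p.1, p.2 - t • velocity A p.1.1 p.1.2))
      ((measYXi L).prod volume) ((measYXi L).prod volume) := by
    refine (MeasurePreserving.id (measYXi L)).skew_product
      (g := fun w x => x - t • velocity A w.1 w.2) ?_ (Eventually.of_forall fun w => ?_)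
    · exact measurable_snd.sub ((hv.comp measurable_fst).const_smul t)
    · simpa only [sub_eq_add_neg] using
        (measurePreserving_add_right (volume : Measure (E N)) (-(t • velocity A w.1 w.2))).map_eq
  exact (Measure.measurePreserving_swap.comp h1).comp Measure.measurePreserving_swap

/-- The free transport group on `L²(ℝ^N × Y × ℝ)`. -/
def transport (hA : IsDivFreeFlux L A) (t : ℝ) : L2XYXi L →L[ℝ] L2XYXi L :=
  (Lp.compMeasurePreservingₗᵢ ℝ (flowMap A t) (measurePreserving_flowMap hA t)).toContinuousLinearMap

theorem coeFn_transport (hA : IsDivFreeFlux L A) (t : ℝ) (F : L2XYXi L) :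
    transport hA t F =ᵐ[measXYXi L] fun z => F (flowMap A t z) :=
  Lp.coeFn_compMeasurePreserving F (measurePreserving_flowMap hA t)

theorem coeFn_transport_of_ae (hA : IsDivFreeFlux L A) (t : ℝ) {F : L2XYXi L}
    {G : E N × E N × ℝ → ℝ} (h : F =ᵐ[measXYXi L] G) :
    transport hA t F =ᵐ[measXYXi L] fun z => G (flowMap A t z) :=
  (coeFn_transport hA t F).trans
    ((measurePreserving_flowMap hA t).quasiMeasurePreserving.ae_eq_comp h)

theorem isIsometryGroup_transport (hA : IsDivFreeFlux L A) : IsIsometryGroup (transport hA) := by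
  refine ⟨fun t v => ?_, fun s t v => ?_, fun v => ?_, fun v => ?_⟩
  · exact Lp.norm_compMeasurePreserving v (measurePreserving_flowMap hA t)
  · apply Lp.ext
    filter_upwards [coeFn_transport hA (s + t) v,
      coeFn_transport_of_ae hA s (coeFn_transport hA t v)] with z h1 h2
    rw [h1, h2, flowMap_add]
  · apply Lp.ext
    filter_upwards [coeFn_transport hA 0 v] with z h1
    rw [h1, flowMap_zero]
  · let Φ : C(ℝ × E N × E N × ℝ, E N × E N × ℝ) := ⟨_, continuous_flowMap hA⟩
    exact Continuous.compMeasurePreservingLp (g := fun t => Φ.curry t) continuous_const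
      Φ.curry.continuous (fun t => measurePreserving_flowMap hA t) (by norm_num)

theorem inner_transport (hA : IsDivFreeFlux L A) (t : ℝ) (F G : L2XYXi L) :
    inner ℝ (transport hA t F) (transport hA t G) = inner ℝ F G :=
  (Lp.compMeasurePreservingₗᵢ ℝ (flowMap A t) (measurePreserving_flowMap hA t)).inner_map_map F G

theorem inner_transport_left (hA : IsDivFreeFlux L A) (t : ℝ) (F G : L2XYXi L) :
    inner ℝ (transport hA (-t) F) G = inner ℝ F (transport hA t G) := by
  have hS := isIsometryGroup_transport hA
  rw [← inner_transport hA t, ← hS.map_add, add_neg_cancel, hS.map_zero]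

/-- The compact box containing the supports of the test functions. -/
def box (L : Fin N → ℝ) (R : ℝ) : Set (E N × E N × ℝ) := Metric.closedBall 0 R ×ˢ slab L R

theorem isCompact_box (L : Fin N → ℝ) (R : ℝ) : IsCompact (box L R) :=
  (isCompact_closedBall _ _).prod (isCompact_slab L R)

theorem ae_mem_cell_XYXi (L : Fin N → ℝ) : ∀ᵐ z ∂(measXYXi L), z.2.1 ∈ cell L :=
  Measure.quasiMeasurePreserving_snd.ae (ae_fst_mem_cell L)

theorem mem_box {z : E N × E N × ℝ} {R : ℝ} (h1 : z.2.1 ∈ cell L) (h2 : ‖z.1‖ ≤ R)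
    (h3 : |z.2.2| ≤ R) : z ∈ box L R :=
  ⟨mem_closedBall_zero_iff.2 h2, cell_subset_closedCell h1, abs_le.1 h3⟩

theorem memLp_box_indicator (L : Fin N → ℝ) (R C : ℝ) (p : ℝ≥0∞) :
    MemLp ((box L R).indicator fun _ => C) p (measXYXi L) := by
  have hm := (isCompact_box L R).isClosed.measurableSet
  refine memLp_of_eq_zero_off_compact ((measurable_const.indicator hm).aestronglyMeasurable)
    (isCompact_box L R) (C := |C|) (fun w hw => ?_) (Eventually.of_forall fun w hw => ?_) p
  · rw [indicator_of_mem hw]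
  · rw [indicator_of_notMem hw]

theorem exists_velocity_bound (hA : IsDivFreeFlux L A) (R : ℝ) :
    ∃ V, 0 ≤ V ∧ ∀ w : E N × ℝ, w.1 ∈ cell L → |w.2| ≤ R → ‖velocity A w.1 w.2‖ ≤ V := by
  obtain ⟨C, hC⟩ := (isCompact_slab L R).exists_bound_of_continuousOn
    (continuous_velocity hA).continuousOn
  exact ⟨max C 0, le_max_right _ _, fun w h1 h2 =>
    (hC w ⟨cell_subset_closedCell h1, abs_le.1 h2⟩).trans (le_max_left _ _)⟩

/-- Bounds for continuous functions with compact support in `(x, ξ)` along the flow. -/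
theorem exists_dominating (hA : IsDivFreeFlux L A) {u : ℝ × E N × E N × ℝ → ℝ} (hu : Continuous u)
    {R : ℝ} (h : ∀ t z, R < ‖z.1‖ ∨ R < |z.2.2| → u (t, z) = 0) (t₀ r : ℝ) :
    ∃ b : E N × E N × ℝ → ℝ, MemLp b 2 (measXYXi L) ∧ ∀ z : E N × E N × ℝ, z.2.1 ∈ cell L →
      ∀ t, |t - t₀| ≤ r → |u (t, flowMap A (-t) z)| ≤ b z := by
  obtain ⟨V, hV0, hV⟩ := exists_velocity_bound hA R
  obtain ⟨C, hC⟩ := ((isCompact_closedBall t₀ r).prod (isCompact_box L R)).exists_bound_of_continuousOn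
    hu.continuousOn
  -- Along the flow x moves by at most |t| V, and |t| ≤ |t₀| + |r| on the time interval considered.
  set R' := |R| + (|t₀| + |r|) * V with hR'
  refine ⟨(box L R').indicator fun _ => |C|, memLp_box_indicator L R' _ 2, fun z hz t ht => ?_⟩
  by_cases h0 : R < ‖(flowMap A (-t) z).1‖ ∨ R < |z.2.2|
  · rw [h t _ h0, abs_zero]
    exact indicator_nonneg (fun _ _ => abs_nonneg _) _
  · simp only [not_or, not_lt] at h0
    have h1 : |u (t, flowMap A (-t) z)| ≤ C :=
      hC (t, flowMap A (-t) z) ⟨by rwa [mem_closedBall_iff_norm], mem_box hz h0.1 h0.2⟩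
    rw [indicator_of_mem]
    · exact h1.trans (le_abs_self _)
    have ht' : |t| ≤ |t₀| + |r| := by
      have := abs_sub_abs_le_abs_sub t t₀
      linarith [le_abs_self r]
    have hv := hV z.2 hz h0.2
    refine mem_box hz ?_ ?_
    · have e : z.1 = (flowMap A (-t) z).1 - t • velocity A z.2.1 z.2.2 := by simp [flowMap]
      rw [e]
      refine (norm_sub_le _ _).trans (add_le_add (h0.1.trans (le_abs_self _)) ?_)
      rw [norm_smul, Real.norm_eq_abs]
      exact mul_le_mul ht' hv (norm_nonneg _) (by positivity)
    · have : 0 ≤ (|t₀| + |r|) * V := by positivity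
      linarith [h0.2, le_abs_self R]

theorem memLp_of_continuous_box {u : E N × E N × ℝ → ℝ} (hu : Continuous u) {R : ℝ}
    (h : ∀ z, R < ‖z.1‖ ∨ R < |z.2.2| → u z = 0) (p : ℝ≥0∞) : MemLp u p (measXYXi L) := by
  obtain ⟨C, hC⟩ := (isCompact_box L R).exists_bound_of_continuousOn hu.continuousOn
  refine memLp_of_eq_zero_off_compact hu.aestronglyMeasurable (isCompact_box L R) hC ?_ p
  filter_upwards [ae_mem_cell_XYXi L] with z hz hn
  refine h z ?_
  by_contra hc
  simp only [not_or, not_lt] at hc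
  exact hn (mem_box hz hc.1 hc.2)

end Transport

/-! ### From Duhamel's formula to the weak formulation -/

section Weak

variable {H : Type*} [NormedAddCommGroup H] [InnerProductSpace ℝ H] [CompleteSpace H]

/-- The weak form of Duhamel's formula, tested with a curve `e` having the derivative `m` along
the group. -/
theorem IsMild.integral_pairing_eq_zero {S : ℝ → H →L[ℝ] H} {P : H → H} {lam T : ℝ} {f₀ : H}
    {f : C(Icc (0 : ℝ) T, H)} (hS : IsIsometryGroup S) (hP : Continuous P) (hT : 0 < T)
    (hf : IsMild S P lam f₀ hT.le f) (hadj : ∀ t u v, inner ℝ (S t u) v = inner ℝ u (S (-t) v))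
    {e m : ℝ → H} (hm : Continuous m) (he : ∀ t, HasDerivAt (fun s => S (-s) (e s)) (S (-t) (m t)) t)
    (h0 : e 0 = 0) (h1 : e T = 0) :
    ∫ t in (0 : ℝ)..T, (inner ℝ (IccExtend hT.le f t) (m t) -
      lam * inner ℝ (IccExtend hT.le f t) (e t) +
      lam * inner ℝ (P (IccExtend hT.le f t)) (e t)) = 0 := by
  have hFc : Continuous (IccExtend hT.le f) := f.continuous.Icc_extend'
  have hcont := continuous_duhamel_integrand hS hP lam hFc
  obtain ⟨Fc, hFcd⟩ : ∃ Fc : ℝ → H, Fc = fun t => f₀ + lam • ∫ s in (0 : ℝ)..t,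
    Real.exp (lam * s) • S (-s) (P (IccExtend hT.le f s)) := ⟨_, rfl⟩
  have hFd : ∀ t, HasDerivAt Fc
      (lam • Real.exp (lam * t) • S (-t) (P (IccExtend hT.le f t))) t := by
    intro t
    rw [hFcd]
    exact ((intervalIntegral.integral_hasDerivAt_right (hcont.intervalIntegrable _ _)
      hcont.stronglyMeasurable.stronglyMeasurableAtFilter hcont.continuousAt).const_smul
        lam).const_add f₀
  have hmild : ∀ t ∈ Icc 0 T, IccExtend hT.le f t = Real.exp (-(lam * t)) • S t (Fc t) := by
    intro t ht
    rw [IccExtend_of_mem hT.le f ht, hf ⟨t, ht⟩, hFcd]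
    rfl
  generalize IccExtend hT.le f = F at *
  have hFcc : Continuous Fc := continuous_iff_continuousAt.2 fun t => (hFd t).continuousAt
  obtain ⟨G, hG⟩ : ∃ G : ℝ → H, G = fun t => Real.exp (-(lam * t)) • S t (Fc t) := ⟨_, rfl⟩
  have hSe : Continuous fun s => S (-s) (e s) :=
    continuous_iff_continuousAt.2 fun t => (he t).continuousAt
  have hcancel : ∀ t v, S t (S (-t) v) = v := fun t v => by
    rw [← hS.map_add, add_neg_cancel, hS.map_zero]
  have hec : Continuous e := by
    refine (hS.continuous_uncurry.comp (continuous_id.prodMk hSe)).congr fun t => ?_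
    exact hcancel _ _
  have hGc : Continuous G := by
    rw [hG]
    exact (by fun_prop : Continuous fun t : ℝ => Real.exp (-(lam * t))).smul
      (hS.continuous_uncurry.comp (continuous_id.prodMk hFcc))
  have hed : ∀ t, HasDerivAt (fun t : ℝ => Real.exp (-(lam * t)))
      (-lam * Real.exp (-(lam * t))) t := by
    intro t
    have := (((hasDerivAt_id t).const_mul lam).neg).exp
    convert! this using 1
    simp; ring
  -- On [0, T] the differentiated quantity is ⟨f(t), e(t)⟩, written with the group moved onto e so
  -- that both factors are differentiable. Its derivative is the weak integrand, and it vanishes at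
  -- both ends.
  have hsd : ∀ t, HasDerivAt (fun t => Real.exp (-(lam * t)) * inner ℝ (Fc t) (S (-t) (e t)))
      (inner ℝ (G t) (m t) - lam * inner ℝ (G t) (e t) + lam * inner ℝ (P (F t)) (e t)) t := by
    intro t
    have := HasDerivAt.mul (hed t) (HasDerivAt.inner ℝ (hFd t) (he t))
    convert! this using 1
    have e2 : Real.exp (lam * t) * Real.exp (-(lam * t)) = 1 := by
      rw [← Real.exp_add, add_neg_cancel, Real.exp_zero]
    have e3 : inner ℝ (S (-t) (P (F t))) (S (-t) (e t)) = inner ℝ (P (F t)) (e t) := by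
      rw [hadj, neg_neg, hcancel]
    rw [hG]
    simp only [real_inner_smul_left]
    rw [e3, hadj, hadj]
    linear_combination -(lam * inner ℝ (P (F t)) (e t)) * e2
  have key := intervalIntegral.integral_eq_sub_of_hasDerivAt (a := 0) (b := T) (fun t _ => hsd t)
    (Continuous.intervalIntegrable
      (((hGc.inner hm).sub (continuous_const.mul (hGc.inner hec))).add
        (continuous_const.mul ((hP.comp hFc).inner hec))) _ _)
  rw [h0, h1, _root_.map_zero, _root_.map_zero, inner_zero_right, inner_zero_right, mul_zero,
    mul_zero, sub_zero] at key
  refine Eq.trans ?_ key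
  refine intervalIntegral.integral_congr fun t ht => ?_
  rw [uIcc_of_le hT.le] at ht
  rw [hmild t ht, hG]

end Weak

/-! ### Test functions as curves in L² -/

section EvolTest

variable {N : ℕ} {L : Fin N → ℝ} {A : E N × ℝ → E N} {T : ℝ} {φ : ℝ × E N × E N × ℝ → ℝ}

theorem IsEvolTest.exists_support (hφ : IsEvolTest L T φ) :
    ∃ R : ℝ, ∀ t z, R < ‖z.1‖ ∨ R < |z.2.2| → φ (t, z) = 0 := by
  obtain ⟨δ, -, R, hR⟩ := hφ.support
  refine ⟨R, fun t z hz => ?_⟩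
  by_contra hne
  have := hR t z.1 z.2.1 z.2.2 hne
  rcases hz with h | h <;> linarith

theorem IsEvolTest.differentiable (hφ : IsEvolTest L T φ) : Differentiable ℝ φ :=
  hφ.smooth.differentiable (by simp)

theorem IsEvolTest.apply_zero (hφ : IsEvolTest L T φ) (z : E N × E N × ℝ) : φ (0, z) = 0 := by
  obtain ⟨δ, hδ, R, hR⟩ := hφ.support
  by_contra hne
  have := hR 0 z.1 z.2.1 z.2.2 hne
  linarith

theorem IsEvolTest.apply_end (hφ : IsEvolTest L T φ) (z : E N × E N × ℝ) : φ (T, z) = 0 := by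
  obtain ⟨δ, hδ, R, hR⟩ := hφ.support
  by_contra hne
  have := hR T z.1 z.2.1 z.2.2 hne
  linarith

/-- The material derivative `∂_t φ + a · ∇_x φ`. -/
def material (A : E N × ℝ → E N) (φ : ℝ × E N × E N × ℝ → ℝ) (p : ℝ × E N × E N × ℝ) : ℝ :=
  fderiv ℝ φ p (1, velocity A p.2.2.1 p.2.2.2, 0)

theorem material_eq (hφ : Differentiable ℝ φ) (t : ℝ) (z : E N × E N × ℝ) :
    deriv (fun s => φ (s, z)) t +
      fderiv ℝ (fun x' => φ (t, x', z.2)) z.1 (velocity A z.2.1 z.2.2) = material A φ (t, z) := by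
  have h1 : HasDerivAt (fun s : ℝ => (s, z)) ((1 : ℝ), (0 : E N × E N × ℝ)) t :=
    (hasDerivAt_id _).prodMk (hasDerivAt_const _ _)
  have e1 := ((hφ (t, z)).hasFDerivAt.comp_hasDerivAt t h1).deriv
  have h2 : HasFDerivAt (fun x' : E N => (t, x', z.2))
      ((ContinuousLinearMap.inr ℝ ℝ (E N × E N × ℝ)).comp
        (ContinuousLinearMap.inl ℝ (E N) (E N × ℝ))) z.1 :=
    (hasFDerivAt_prodMk_right t (z.1, z.2)).comp z.1 (hasFDerivAt_prodMk_left z.1 z.2)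
  have e2 := (HasFDerivAt.comp z.1 (hφ (t, z)).hasFDerivAt h2).fderiv
  change deriv (φ ∘ fun s => (s, z)) t + fderiv ℝ (φ ∘ fun x' => (t, x', z.2)) z.1 _ = _
  rw [e1, e2, material]
  simp only [ContinuousLinearMap.comp_apply, ContinuousLinearMap.inr_apply,
    ContinuousLinearMap.inl_apply]
  rw [← _root_.map_add]
  simp

theorem continuous_material (hA : IsDivFreeFlux L A) (hφ : IsEvolTest L T φ) :
    Continuous (material A φ) := by
  have h := (continuous_velocity hA).comp
    (by fun_prop : Continuous fun p : ℝ × E N × E N × ℝ => p.2.2)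
  exact (hφ.smooth.continuous_fderiv (by simp)).clm_apply
    (continuous_const.prodMk (h.prodMk continuous_const))

theorem material_eq_zero {R : ℝ}
    (hR : ∀ t z, R < ‖z.1‖ ∨ R < |z.2.2| → φ (t, z) = 0) (t : ℝ) (z : E N × E N × ℝ)
    (hz : R < ‖z.1‖ ∨ R < |z.2.2|) : material A φ (t, z) = 0 := by
  have h1 : Continuous fun p : ℝ × E N × E N × ℝ => ‖p.2.1‖ := by fun_prop
  have h2 : Continuous fun p : ℝ × E N × E N × ℝ => |p.2.2.2| := by fun_prop
  have ho : IsOpen {p : ℝ × E N × E N × ℝ | R < ‖p.2.1‖ ∨ R < |p.2.2.2|} :=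
    (isOpen_lt continuous_const h1).union (isOpen_lt continuous_const h2)
  have : φ =ᶠ[𝓝 (t, z)] fun _ => (0 : ℝ) := by
    filter_upwards [ho.mem_nhds hz] with p hp
    exact hR p.1 p.2 hp
  rw [material, this.fderiv_eq]
  simp

theorem IsEvolTest.memLp (hφ : IsEvolTest L T φ) (t : ℝ) :
    MemLp (fun z => φ (t, z)) 2 (measXYXi L) := by
  obtain ⟨R, hR⟩ := hφ.exists_support
  exact memLp_of_continuous_box (hφ.smooth.continuous.comp (by fun_prop)) (hR t) 2

theorem IsEvolTest.memLp_material (hA : IsDivFreeFlux L A) (hφ : IsEvolTest L T φ) (t : ℝ) :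
    MemLp (fun z => material A φ (t, z)) 2 (measXYXi L) := by
  obtain ⟨R, hR⟩ := hφ.exists_support
  exact memLp_of_continuous_box ((continuous_material hA hφ).comp (by fun_prop))
    (material_eq_zero hR t) 2

/-- The time slice of a test function as an element of `L²`. -/
def evolLp (hφ : IsEvolTest L T φ) (t : ℝ) : L2XYXi L := (hφ.memLp t).toLp _

/-- The time slice of the material derivative of a test function as an element of `L²`. -/
def materialLp (hA : IsDivFreeFlux L A) (hφ : IsEvolTest L T φ) (t : ℝ) : L2XYXi L :=
  (hφ.memLp_material hA t).toLp _

theorem hasDerivAt_flow (hφ : Differentiable ℝ φ) (z : E N × E N × ℝ) (t : ℝ) :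
    HasDerivAt (fun s => φ (s, flowMap A (-s) z)) (material A φ (t, flowMap A (-t) z)) t := by
  have h1 : HasDerivAt (fun s : ℝ => (s, flowMap A (-s) z))
      ((1 : ℝ), velocity A z.2.1 z.2.2, (0 : E N × ℝ)) t := by
    refine (hasDerivAt_id _).prodMk (HasDerivAt.prodMk ?_ (hasDerivAt_const _ _))
    have := (((hasDerivAt_id t).neg).smul_const (velocity A z.2.1 z.2.2)).const_sub z.1
    convert! this using 1
    simp
  exact (hφ _).hasFDerivAt.comp_hasDerivAt t h1

/-- Pulled back along the flow, a test function has the pulled-back material derivative as its time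
derivative. Only t is differentiated, so no regularity of a in (y, ξ) beyond continuity enters. -/
theorem hasDerivAt_transport_evolLp (hA : IsDivFreeFlux L A) (hφ : IsEvolTest L T φ) (t : ℝ) :
    HasDerivAt (fun s => transport hA (-s) (evolLp hφ s))
      (transport hA (-t) (materialLp hA hφ t)) t := by
  obtain ⟨R, hR⟩ := hφ.exists_support
  obtain ⟨b, hb, hle⟩ := exists_dominating (L := L) hA (continuous_material hA hφ)
    (material_eq_zero hR) t 1
  refine hasDerivAt_Lp_of_dominated (G := fun s z => φ (s, flowMap A (-s) z))
    (G' := fun s z => material A φ (s, flowMap A (-s) z))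
    (fun s => coeFn_transport_of_ae hA _ (hφ.memLp s).coeFn_toLp)
    (coeFn_transport_of_ae hA _ (hφ.memLp_material hA t).coeFn_toLp)
    (fun z s => hasDerivAt_flow hφ.differentiable z s) hb ?_
  filter_upwards [ae_mem_cell_XYXi L] with z hz s hs
  exact hle z hz s hs

theorem continuous_transport_materialLp (hA : IsDivFreeFlux L A) (hφ : IsEvolTest L T φ) :
    Continuous fun t => transport hA (-t) (materialLp hA hφ t) := by
  obtain ⟨R, hR⟩ := hφ.exists_support
  rw [continuous_iff_continuousAt]
  intro t
  obtain ⟨b, hb, hle⟩ := exists_dominating (L := L) hA (continuous_material hA hφ)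
    (material_eq_zero hR) t 1
  refine tendsto_Lp_of_dominated (G := fun s z => material A φ (s, flowMap A (-s) z))
    (fun s => coeFn_transport_of_ae hA _ (hφ.memLp_material hA s).coeFn_toLp)
    (coeFn_transport_of_ae hA _ (hφ.memLp_material hA t).coeFn_toLp) hb ?_ ?_
  · have h1 : ∀ᶠ s in 𝓝 t, s ∈ Metric.closedBall t 1 := Metric.closedBall_mem_nhds _ one_pos
    filter_upwards [h1] with s hs
    filter_upwards [ae_mem_cell_XYXi L] with z hz
    exact hle z hz s (by rwa [mem_closedBall_iff_norm] at hs)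
  · refine Eventually.of_forall fun z => ?_
    have : Continuous fun s => material A φ (s, flowMap A (-s) z) :=
      (continuous_material hA hφ).comp (continuous_id.prodMk
        ((continuous_flowMap hA).comp (continuous_neg.prodMk continuous_const)))
    exact this.tendsto t

/-- Continuity is first obtained for the pulled-back curve, where domination is available; the
jointly continuous group then transports it forward. -/
theorem continuous_materialLp (hA : IsDivFreeFlux L A) (hφ : IsEvolTest L T φ) :
    Continuous (materialLp hA hφ) := by
  have hS := isIsometryGroup_transport hA
  have := hS.continuous_uncurry.comp (continuous_id.prodMk (continuous_transport_materialLp hA hφ))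
  refine this.congr fun t => ?_
  simp only [Function.comp_apply, id]
  rw [← hS.map_add, add_neg_cancel, hS.map_zero]

theorem continuous_evolLp (hA : IsDivFreeFlux L A) (hφ : IsEvolTest L T φ) :
    Continuous (evolLp hφ) := by
  have hS := isIsometryGroup_transport hA
  have h1 : Continuous fun s => transport hA (-s) (evolLp hφ s) :=
    continuous_iff_continuousAt.2 fun t => (hasDerivAt_transport_evolLp hA hφ t).continuousAt
  have := hS.continuous_uncurry.comp (continuous_id.prodMk h1)
  refine this.congr fun t => ?_
  simp only [Function.comp_apply, id]
  rw [← hS.map_add, add_neg_cancel, hS.map_zero]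

/-- The weak formulation at a fixed time. -/
def evolPairing (hA : IsDivFreeFlux L A) (hφ : IsEvolTest L T φ) (lam : ℝ) (F G : L2XYXi L)
    (t : ℝ) : ℝ :=
  inner ℝ F (materialLp hA hφ t) - lam * inner ℝ F (evolLp hφ t) + lam * inner ℝ G (evolLp hφ t)

theorem integral_evol_eq (hA : IsDivFreeFlux L A) (hφ : IsEvolTest L T φ) (lam : ℝ)
    (F G : L2XYXi L) (t : ℝ) :
    ∫ z, (F z * (deriv (fun s => φ (s, z)) t
        + fderiv ℝ (fun x' => φ (t, x', z.2)) z.1 (velocity A z.2.1 z.2.2) - lam * φ (t, z))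
      + lam * G z * φ (t, z)) ∂(measXYXi L) = evolPairing hA hφ lam F G t := by
  have hm := hφ.memLp_material hA t
  have hp := hφ.memLp t
  have i1 := integrable_Lp_mul F hm
  have i2 := integrable_Lp_mul F hp
  have i3 := integrable_Lp_mul G hp
  rw [evolPairing, materialLp, evolLp, inner_toLp_eq, inner_toLp_eq, inner_toLp_eq,
    ← integral_const_mul, ← integral_const_mul, ← integral_sub i1 (i2.const_mul _)]
  have := integral_add (i1.sub (i2.const_mul lam)) (i3.const_mul lam)
  simp only [Pi.sub_apply] at this
  rw [← this]
  refine integral_congr_ae (Eventually.of_forall fun z => ?_)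
  simp only
  rw [material_eq hφ.differentiable]
  ring

variable {K : Set (L2YXi L)} {u₀ : E N × E N → ℝ} {F₀ : L2XYXi L} {lam : ℝ}

/-- The weak formulation in terms of `L²`-valued curves. -/
theorem isBGKSolution_iff (hL : ∀ i, 0 < L i) (hA : IsDivFreeFlux L A) (hT : 0 < T)
    (hF₀ : F₀ =ᵐ[measXYXi L] initialDatum u₀) (f : XT L T) :
    IsBGKSolution L A u₀ lam T f ↔ f ⟨0, le_rfl, hT.le⟩ = F₀ ∧
      ∀ φ, ∀ hφ : IsEvolTest L T φ, ∫ t in (0 : ℝ)..T, evolPairing hA hφ lam (IccExtend hT.le f t)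
        (sliceProj (constraintSet L A (supNorm L u₀)) (IccExtend hT.le f t)) t = 0 := by
  have h0 := zero_mem_constraintSet (A := A) (M := supNorm L u₀) hL
  have hc := isClosed_constraintSet (M := supNorm L u₀) hL hA
  have hx := convex_constraintSet (M := supNorm L u₀) hL hA
  have e : ∀ φ, ∀ hφ : IsEvolTest L T φ, ∀ g : Set.Icc (0 : ℝ) T → L2XYXi L,
      (∀ t, g t = sliceProj (constraintSet L A (supNorm L u₀)) (f t)) →
      ∫ t : Set.Icc (0 : ℝ) T, (∫ z,
        (f t z * (deriv (fun s => φ (s, z)) (t : ℝ)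
            + fderiv ℝ (fun x' => φ ((t : ℝ), x', z.2)) z.1 (velocity A z.2.1 z.2.2)
            - lam * φ ((t : ℝ), z))
          + lam * g t z * φ ((t : ℝ), z)) ∂(measXYXi L))
        ∂((volume : Measure ℝ).comap Subtype.val) =
      ∫ t in (0 : ℝ)..T, evolPairing hA hφ lam (IccExtend hT.le f t)
        (sliceProj (constraintSet L A (supNorm L u₀)) (IccExtend hT.le f t)) t := by
    intro φ hφ g hg
    rw [intervalIntegral.integral_of_le hT.le, ← integral_Icc_eq_integral_Ioc,
      ← integral_subtype_comap measurableSet_Icc]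
    refine integral_congr_ae (Eventually.of_forall fun t => ?_)
    simp only
    rw [integral_evol_eq hA hφ, IccExtend_val, hg t]
  constructor
  · rintro ⟨h1, g, hg, hw⟩
    refine ⟨Lp.ext ((h1 _ rfl).trans hF₀.symm), fun φ hφ => ?_⟩
    rw [← e φ hφ g fun t => (isSliceProj_iff h0 hc hx).1 (hg t)]
    exact hw φ hφ
  · rintro ⟨h1, hw⟩
    refine ⟨fun t ht => ?_, fun t => sliceProj _ (f t),
      fun t => isSliceProj_sliceProj h0 hc hx _, fun φ hφ => ?_⟩
    · have : t = ⟨0, le_rfl, hT.le⟩ := Subtype.ext ht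
      rw [this, h1]
      exact hF₀
    · rw [e φ hφ _ fun _ => rfl]
      exact hw φ hφ

/-- Mild solutions satisfy the weak formulation. -/
theorem IsMild.integral_evolPairing_eq_zero (hA : IsDivFreeFlux L A) (hT : 0 < T)
    {P : L2XYXi L → L2XYXi L} (hP : Continuous P) {f : XT L T}
    (hf : IsMild (transport hA) P lam F₀ hT.le f) (hφ : IsEvolTest L T φ) :
    ∫ t in (0 : ℝ)..T, evolPairing hA hφ lam (IccExtend hT.le f t) (P (IccExtend hT.le f t)) t
      = 0 := by
  have z0 : evolLp hφ 0 = 0 := by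
    apply Lp.ext
    filter_upwards [(hφ.memLp 0).coeFn_toLp, Lp.coeFn_zero ℝ 2 (measXYXi L)] with z h1 h2
    rw [evolLp, h1, h2, hφ.apply_zero]; rfl
  have zT : evolLp hφ T = 0 := by
    apply Lp.ext
    filter_upwards [(hφ.memLp T).coeFn_toLp, Lp.coeFn_zero ℝ 2 (measXYXi L)] with z h1 h2
    rw [evolLp, h1, h2, hφ.apply_end]; rfl
  exact hf.integral_pairing_eq_zero (isIsometryGroup_transport hA) hP hT
    (fun t u v => by simpa using inner_transport_left hA (-t) u v) (continuous_materialLp hA hφ)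
    (hasDerivAt_transport_evolLp hA hφ) z0 zT

end EvolTest

/-! ### Transported test functions for a nonsmooth velocity -/

section WeakToMild

variable {N : ℕ} {L : Fin N → ℝ} {A : E N × ℝ → E N} {T : ℝ}

/-- Periodic functions of `(y, ξ)` take all their values on `cell L × ℝ`. -/
theorem apply_fold_eq {α : Type*} {b : E N × ℝ → α}
    (hb : ∀ (y : E N) (ξ : ℝ) (i : Fin N), b (y + EuclideanSpace.single i (L i), ξ) = b (y, ξ))
    (w : E N × ℝ) : b (fold L w.1, w.2) = b w := by
  have h := periodic_latt (L := L) (X := E N × ℝ) (AddMonoidHom.inl (E N) ℝ) (f := b)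
    (fun x i => by
      have := hb x.1 x.2 i
      simpa [Prod.ext_iff, Prod.add_def] using this) (-cellFloor L w.1) w
  rw [← h, fold, sub_eq_add_neg, ← latt_neg]
  simp [Prod.add_def]

/-- Smooth periodic approximation of the velocity field. -/
theorem exists_smooth_approx (hL : ∀ i, 0 < L i) (hA : IsDivFreeFlux L A) (R : ℝ) {ε : ℝ}
    (hε : 0 < ε) : ∃ b : E N × ℝ → E N, ContDiff ℝ ∞ b ∧
      (∀ (y : E N) (ξ : ℝ) (i : Fin N), b (y + EuclideanSpace.single i (L i), ξ) = b (y, ξ)) ∧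
      ∀ w, |w.2| ≤ R → ‖velocity A w.1 w.2 - b w‖ ≤ ε := by
  have hac := continuous_velocity hA
  obtain ⟨a, ha⟩ : ∃ a : E N × ℝ → E N, a = fun w => velocity A w.1 w.2 := ⟨_, rfl⟩
  rw [← ha] at hac
  have hap : ∀ (y : E N) (ξ : ℝ) (i : Fin N), a (y + EuclideanSpace.single i (L i), ξ) = a (y, ξ) := by
    intro y ξ i
    rw [ha]
    exact velocity_periodic hA y ξ i
  -- Uniform continuity comes from the compact slab; periodicity of a and of its mollification then
  -- transfers the estimate to all y.
  have hu := (isCompact_slab L R).uniformContinuousAt_of_continuousAt a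
    (fun w _ => hac.continuousAt) (Metric.dist_mem_uniformity hε)
  obtain ⟨δ, hδ, hd⟩ := Metric.mem_uniformity_dist.1 hu
  let φ : ContDiffBump (0 : E N × ℝ) := ⟨δ / 2, δ, by positivity, by linarith⟩
  have hper : ∀ (y : E N) (ξ : ℝ) (i : Fin N),
      (convolution (φ.normed volume) a (ContinuousLinearMap.lsmul ℝ ℝ) volume)
        (y + EuclideanSpace.single i (L i), ξ) =
      (convolution (φ.normed volume) a (ContinuousLinearMap.lsmul ℝ ℝ) volume) (y, ξ) := by
    intro y ξ i
    unfold convolution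
    refine integral_congr_ae (Eventually.of_forall fun v => ?_)
    have := hap (y - v.1) (ξ - v.2) i
    simp only
    congr 1
    rw [show ((y, ξ) - v : E N × ℝ) = (y - v.1, ξ - v.2) from rfl, ← this]
    congr 1
    simp [Prod.ext_iff]
    abel
  refine ⟨convolution (φ.normed volume) a (ContinuousLinearMap.lsmul ℝ ℝ) volume,
    φ.hasCompactSupport_normed.contDiff_convolution_left _ φ.contDiff_normed
      hac.locallyIntegrable, hper, fun w hw => ?_⟩
  have h1 : velocity A w.1 w.2 = a w := by rw [ha]
  rw [h1, ← apply_fold_eq hap w, ← apply_fold_eq hper w, ← dist_eq_norm, dist_comm]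
  refine φ.dist_normed_convolution_le hac.aestronglyMeasurable fun v hv => ?_
  rw [dist_comm]
  refine (hd ?_ ?_).le
  · rw [dist_comm]; exact hv
  · exact ⟨cell_subset_closedCell (fold_mem_cell hL _), abs_le.1 hw⟩

variable {h : E N × E N × ℝ → ℝ} {κ : ℝ → ℝ} {R : ℝ}

/-- A smooth b stands in for a, as h(x - t a, y, ξ) would in general not be smooth. The support
stays compact because |t| ≤ T on the support of κ and b is bounded for |ξ| ≤ R. -/
theorem isEvolTest_transported {b : E N × ℝ → E N} (hb : ContDiff ℝ ∞ b)
    (hbp : ∀ (y : E N) (ξ : ℝ) (i : Fin N), b (y + EuclideanSpace.single i (L i), ξ) = b (y, ξ))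
    {V : ℝ} (hV : ∀ w, |w.2| ≤ R → ‖b w‖ ≤ V) (hs : ContDiff ℝ ∞ h)
    (hp : ∀ z i, h (z + inclY N (EuclideanSpace.single i (L i))) = h z)
    (hR : ∀ z, R < ‖z.1‖ ∨ R < |z.2.2| → h z = 0) (hκ : ContDiff ℝ ∞ κ)
    (hκs : ∃ δ > 0, ∀ t, κ t ≠ 0 → δ ≤ t ∧ t ≤ T - δ) :
    IsEvolTest L T fun p => κ p.1 * h (p.2.1 - p.1 • b p.2.2, p.2.2) := by
  refine ⟨?_, ?_, ?_⟩
  · have h2 : ContDiff ℝ ∞ fun p : ℝ × E N × E N × ℝ => (p.2.1 - p.1 • b p.2.2, p.2.2) := by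
      have : ContDiff ℝ ∞ fun p : ℝ × E N × E N × ℝ => b p.2.2 := hb.comp (by fun_prop)
      fun_prop
    exact (hκ.comp contDiff_fst).mul (hs.comp h2)
  · intro t x y ξ i
    simp only
    rw [hbp, ← hp (x - t • b (y, ξ), y, ξ) i]
    simp [inclY, Prod.add_def]
  · obtain ⟨δ, hδ, hδ'⟩ := hκs
    refine ⟨δ, hδ, max R (R + T * V), fun t x y ξ hne => ?_⟩
    obtain ⟨h1, h2⟩ := hδ' t (left_ne_zero_of_mul hne)
    have h3 := right_ne_zero_of_mul hne
    have h4 : ‖x - t • b (y, ξ)‖ ≤ R := by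
      by_contra hc
      exact h3 (hR _ (Or.inl (not_le.1 hc)))
    have h5 : |ξ| ≤ R := by
      by_contra hc
      exact h3 (hR _ (Or.inr (not_le.1 hc)))
    refine ⟨h1, h2, le_max_of_le_right ?_, le_max_of_le_left h5⟩
    have h6 := hV (y, ξ) h5
    have h7 : ‖t • b (y, ξ)‖ ≤ T * V := by
      rw [norm_smul, Real.norm_eq_abs, abs_of_nonneg (by linarith)]
      exact mul_le_mul (by linarith) h6 (norm_nonneg _) (by linarith)
    calc ‖x‖ = ‖(x - t • b (y, ξ)) + t • b (y, ξ)‖ := by rw [sub_add_cancel]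
      _ ≤ _ := norm_add_le _ _
      _ ≤ _ := by linarith

theorem norm_le_of_box_bound {c : L2XYXi L} {G : E N × E N × ℝ → ℝ} (hc : c =ᵐ[measXYXi L] G)
    {C : ℝ} {r : ℝ} (h : ∀ z : E N × E N × ℝ, z.2.1 ∈ cell L → |G z| ≤ C)
    (h0 : ∀ z, r < ‖z.1‖ ∨ r < |z.2.2| → G z = 0) :
    ‖c‖ ≤ C * ‖(memLp_box_indicator L r 1 2).toLp _‖ := by
  refine Lp.norm_le_mul_norm_of_ae_le_mul ?_
  filter_upwards [hc, (memLp_box_indicator L r 1 2).coeFn_toLp, ae_mem_cell_XYXi L]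
    with z h1 h2 hz
  rw [h1, h2, Real.norm_eq_abs]
  by_cases hb : z ∈ box L r
  · simpa [indicator_of_mem hb] using h z hz
  · have : r < ‖z.1‖ ∨ r < |z.2.2| := by
      by_contra! hcon
      exact hb (mem_box hz hcon.1 hcon.2)
    rw [h0 z this, indicator_of_notMem hb]
    simp

/-- Transported test functions are almost constant along the flow. -/
theorem exists_evolTest_approx (hL : ∀ i, 0 < L i) (hA : IsDivFreeFlux L A) (hT : 0 < T)
    (hs : ContDiff ℝ ∞ h) (hp : ∀ z i, h (z + inclY N (EuclideanSpace.single i (L i))) = h z)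
    (hR : ∀ z, R < ‖z.1‖ ∨ R < |z.2.2| → h z = 0) (hκ : ContDiff ℝ ∞ κ)
    (hκs : ∃ δ > 0, ∀ t, κ t ≠ 0 → δ ≤ t ∧ t ≤ T - δ) {H : L2XYXi L}
    (hH : H =ᵐ[measXYXi L] h) :
    ∃ C, ∀ ε, 0 < ε → ε ≤ 1 → ∃ φ, ∃ hφ : IsEvolTest L T φ, ∀ t ∈ Icc 0 T,
      ‖transport hA (-t) (evolLp hφ t) - κ t • H‖ ≤ C * ε ∧
      ‖transport hA (-t) (materialLp hA hφ t) - deriv κ t • H‖ ≤ C * ε := by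
  have hd : Differentiable ℝ h := hs.differentiable (by simp)
  have hκd : Differentiable ℝ κ := hκ.differentiable (by simp)
  have hR' : ∀ z, R < ‖z.1‖ ∨ R < |z.2.2| → fderiv ℝ h z = 0 := by
    intro z hz
    have h1 : Continuous fun p : E N × E N × ℝ => ‖p.1‖ := by fun_prop
    have h2 : Continuous fun p : E N × E N × ℝ => |p.2.2| := by fun_prop
    have ho : IsOpen {p : E N × E N × ℝ | R < ‖p.1‖ ∨ R < |p.2.2|} :=
      (isOpen_lt continuous_const h1).union (isOpen_lt continuous_const h2)
    have : h =ᶠ[𝓝 z] fun _ => (0 : ℝ) := by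
      filter_upwards [ho.mem_nhds hz] with p hp using hR p hp
    rw [this.fderiv_eq]
    simp
  obtain ⟨D, hD⟩ : ∃ D, ∀ z : E N × E N × ℝ, z.2.1 ∈ cell L → ‖fderiv ℝ h z‖ ≤ D := by
    obtain ⟨D, hD⟩ := (isCompact_box L R).exists_bound_of_continuousOn
      (hs.continuous_fderiv (by simp)).continuousOn
    refine ⟨max D 0, fun z hz => ?_⟩
    by_cases hb : R < ‖z.1‖ ∨ R < |z.2.2|
    · rw [hR' z hb, norm_zero]; exact le_max_right _ _
    · push Not at hb
      exact (hD z (mem_box hz hb.1 hb.2)).trans (le_max_left _ _)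
  have hlip : ∀ (x x' : E N) (w : E N × ℝ), w.1 ∈ cell L → |h (x', w) - h (x, w)| ≤ D * ‖x' - x‖ := by
    intro x x' w hw
    have hg : ∀ p : E N, HasFDerivAt (fun p => h (p, w))
        ((fderiv ℝ h (p, w)).comp (ContinuousLinearMap.inl ℝ (E N) (E N × ℝ))) p := fun p =>
      (hd (p, w)).hasFDerivAt.comp p (hasFDerivAt_prodMk_left p w)
    refine Convex.norm_image_sub_le_of_norm_hasFDerivWithin_le (𝕜 := ℝ) (s := univ)
      (f := fun p => h (p, w)) (fun p _ => (hg p).hasFDerivWithinAt) (fun p _ => ?_) convex_univ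
      (mem_univ _) (mem_univ _)
    refine (ContinuousLinearMap.opNorm_comp_le _ _).trans ?_
    calc _ ≤ ‖fderiv ℝ h (p, w)‖ * 1 :=
          mul_le_mul_of_nonneg_left (ContinuousLinearMap.norm_inl_le_one ℝ (E N) (E N × ℝ)) (norm_nonneg _)
      _ ≤ D := by rw [mul_one]; exact hD _ hw
  obtain ⟨B₀, hB₀⟩ := isCompact_Icc.exists_bound_of_continuousOn (s := Icc 0 T)
    hκ.continuous.continuousOn
  obtain ⟨B₁, hB₁⟩ := isCompact_Icc.exists_bound_of_continuousOn (s := Icc 0 T)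
    (hκ.continuous_deriv (by simp)).continuousOn
  obtain ⟨V, hV0, hV⟩ := exists_velocity_bound (L := L) hA R
  have hT0 : (0 : ℝ) ∈ Icc 0 T := ⟨le_rfl, hT.le⟩
  have hB₀0 := (norm_nonneg _).trans (hB₀ 0 hT0)
  have hB₁0 := (norm_nonneg _).trans (hB₁ 0 hT0)
  have hD0 : 0 ≤ max D 0 := le_max_right _ _
  have hcell : ∀ y : E N, fold L y ∈ cell L := fold_mem_cell hL
  set q := ‖(memLp_box_indicator L (R + T) 1 2).toLp _‖ with hq
  -- The constant collects pointwise errors: D T ε for h evaluated at a point displaced by t (a -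
  -- b), and D ε for the derivative along a - b, weighted by bounds B₀, B₁ of κ, κ'. The factor q is
  -- the L² norm of the indicator of a box containing all supports.
  refine ⟨(B₀ * (max D 0 * T) + B₁ * (max D 0 * T) + B₀ * max D 0) * q, fun ε hε hε1 => ?_⟩
  obtain ⟨b, hbs, hbp, hb⟩ := exists_smooth_approx hL hA R hε
  have hbV : ∀ w, |w.2| ≤ R → ‖b w‖ ≤ V + 1 := by
    intro w hw
    rw [← apply_fold_eq hbp w]
    have h1 := hb (fold L w.1, w.2) hw
    have h2 := hV (fold L w.1, w.2) (hcell _) hw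
    have h3 := norm_sub_norm_le (b (fold L w.1, w.2)) (velocity A (fold L w.1) w.2)
    rw [norm_sub_rev] at h3
    simp only at h1 h2
    linarith
  have hφ := isEvolTest_transported hbs hbp hbV hs hp hR hκ hκs
  refine ⟨_, hφ, fun t ht => ?_⟩
  obtain ⟨d, hdd⟩ : ∃ d : E N × ℝ → E N, d = fun w => velocity A w.1 w.2 - b w := ⟨_, rfl⟩
  have hdb : ∀ w, |w.2| ≤ R → ‖d w‖ ≤ ε := by intro w hw; rw [hdd]; exact hb w hw
  -- Along the true flow the two displacements nearly cancel: what remains is t (a - b), of size at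
  -- most T ε where |ξ| ≤ R.
  have hflow : ∀ (s : ℝ) (z : E N × E N × ℝ),
      ((flowMap A (-s) z).1 - s • b (flowMap A (-s) z).2, (flowMap A (-s) z).2)
        = (z.1 + s • d z.2, z.2) := by
    intro s z
    simp only [flowMap, hdd, Prod.mk.injEq, and_true]
    module
  have hmat : ∀ z, material A (fun p => κ p.1 * h (p.2.1 - p.1 • b p.2.2, p.2.2))
      (t, flowMap A (-t) z) = deriv κ t * h (z.1 + t • d z.2, z.2) +
        κ t * fderiv ℝ h (z.1 + t • d z.2, z.2) (d z.2, 0) := by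
    intro z
    refine (hasDerivAt_flow hφ.differentiable z t).unique ?_
    have e : (fun s => κ s * h ((flowMap A (-s) z).1 - s • b (flowMap A (-s) z).2,
        (flowMap A (-s) z).2)) = fun s => κ s * h (z.1 + s • d z.2, z.2) := by
      funext s; rw [hflow]
    simp only
    rw [e]
    have h1 : HasDerivAt (fun s : ℝ => (z.1 + s • d z.2, z.2)) (d z.2, 0) t := by
      refine HasDerivAt.prodMk ?_ (hasDerivAt_const _ _)
      simpa using ((hasDerivAt_id t).smul_const (d z.2)).const_add z.1
    exact (hκd t).hasDerivAt.mul ((hd _).hasFDerivAt.comp_hasDerivAt t h1)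
  -- The restriction ε ≤ 1 keeps the residual displacement below T, so all functions involved vanish
  -- outside the box of size R + T, uniformly in ε.
  have hzero : ∀ z, R + T < ‖z.1‖ ∨ R + T < |z.2.2| → h z = 0 ∧ h (z.1 + t • d z.2, z.2) = 0 ∧
      fderiv ℝ h (z.1 + t • d z.2, z.2) = 0 := by
    intro z hz
    have hz1 : R < ‖z.1‖ ∨ R < |z.2.2| := hz.imp (fun h => by linarith) (fun h => by linarith)
    have hz2 : R < ‖z.1 + t • d z.2‖ ∨ R < |z.2.2| := by
      by_cases hw : R < |z.2.2|
      · exact Or.inr hw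
      · push Not at hw
        rcases hz with hz | hz
        · left
          have h1 : ‖t • d z.2‖ ≤ T := by
            rw [norm_smul, Real.norm_eq_abs, abs_of_nonneg ht.1]
            have := mul_le_mul ht.2 (hdb z.2 hw) (norm_nonneg _) hT.le
            nlinarith
          have h2 : ‖z.1‖ ≤ ‖z.1 + t • d z.2‖ + ‖t • d z.2‖ := by
            have := norm_sub_le (z.1 + t • d z.2) (t • d z.2)
            rwa [add_sub_cancel_right] at this
          linarith
        · linarith
    exact ⟨hR _ hz1, hR _ hz2, hR' _ hz2⟩
  have hdiff : ∀ z : E N × E N × ℝ, z.2.1 ∈ cell L →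
      |h (z.1 + t • d z.2, z.2) - h z| ≤ max D 0 * T * ε := by
    intro z hz
    by_cases hw : |z.2.2| ≤ R
    · refine (hlip z.1 (z.1 + t • d z.2) z.2 hz).trans ?_
      rw [add_sub_cancel_left, norm_smul, Real.norm_eq_abs, abs_of_nonneg ht.1, mul_assoc]
      exact mul_le_mul (le_max_left _ _)
        (mul_le_mul ht.2 (hdb _ hw) (norm_nonneg _) hT.le) (by have := ht.1; positivity) hD0
    · push Not at hw
      rw [hR z (Or.inr hw), hR (z.1 + t • d z.2, z.2) (Or.inr hw)]
      simp; positivity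
  have hder : ∀ z : E N × E N × ℝ, z.2.1 ∈ cell L →
      |fderiv ℝ h (z.1 + t • d z.2, z.2) (d z.2, 0)| ≤ max D 0 * ε := by
    intro z hz
    by_cases hw : |z.2.2| ≤ R
    · refine ((fderiv ℝ h (z.1 + t • d z.2, z.2)).le_opNorm _).trans ?_
      refine mul_le_mul ((hD (z.1 + t • d z.2, z.2) hz).trans (le_max_left _ _)) ?_ (norm_nonneg _) hD0
      rw [Prod.norm_def]
      simpa [hε.le] using hdb _ hw
    · push Not at hw
      rw [hR' (z.1 + t • d z.2, z.2) (Or.inr hw)]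
      simp; positivity
  have hq0 : 0 ≤ q := norm_nonneg _
  constructor
  · have hae : (transport hA (-t) (evolLp hφ t) - κ t • H : L2XYXi L) =ᵐ[measXYXi L]
        fun z => κ t * (h (z.1 + t • d z.2, z.2) - h z) := by
      filter_upwards [coeFn_transport_of_ae hA (-t) (hφ.memLp t).coeFn_toLp, hH,
        Lp.coeFn_sub (transport hA (-t) (evolLp hφ t)) (κ t • H), Lp.coeFn_smul (κ t) H]
        with z h1 h2 h3 h4
      rw [h3, Pi.sub_apply, h4, Pi.smul_apply, h2, evolLp, h1]
      rw [hflow, smul_eq_mul, mul_sub]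
    refine (norm_le_of_box_bound (C := B₀ * (max D 0 * T * ε)) hae (r := R + T)
      (fun z hz => ?_) (fun z hz => ?_)).trans ?_
    · rw [abs_mul]
      exact mul_le_mul (hB₀ t ht) (hdiff z hz) (abs_nonneg _) hB₀0
    · rw [(hzero z hz).1, (hzero z hz).2.1]; simp
    · have : 0 ≤ (B₁ * (max D 0 * T) + B₀ * max D 0) * q * ε := by positivity
      rw [← hq]
      nlinarith
  · have hae : (transport hA (-t) (materialLp hA hφ t) - deriv κ t • H : L2XYXi L) =ᵐ[measXYXi L]
        fun z => deriv κ t * (h (z.1 + t • d z.2, z.2) - h z) +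
          κ t * fderiv ℝ h (z.1 + t • d z.2, z.2) (d z.2, 0) := by
      filter_upwards [coeFn_transport_of_ae hA (-t) (hφ.memLp_material hA t).coeFn_toLp, hH,
        Lp.coeFn_sub (transport hA (-t) (materialLp hA hφ t)) (deriv κ t • H),
        Lp.coeFn_smul (deriv κ t) H] with z h1 h2 h3 h4
      rw [h3, Pi.sub_apply, h4, Pi.smul_apply, h2, materialLp, h1]
      rw [hmat, smul_eq_mul]
      ring
    refine (norm_le_of_box_bound (C := B₁ * (max D 0 * T * ε) + B₀ * (max D 0 * ε)) hae
      (r := R + T) (fun z hz => ?_) (fun z hz => ?_)).trans ?_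
    · refine (abs_add_le _ _).trans ?_
      rw [abs_mul, abs_mul]
      exact add_le_add (mul_le_mul (hB₁ t ht) (hdiff z hz) (abs_nonneg _) hB₁0)
        (mul_le_mul (hB₀ t ht) (hder z hz) (abs_nonneg _) hB₀0)
    · rw [(hzero z hz).1, (hzero z hz).2.1, (hzero z hz).2.2]; simp
    · have : 0 ≤ (B₀ * (max D 0 * T)) * q * ε := by positivity
      rw [← hq]
      nlinarith

end WeakToMild

/-! ### Passing to the limit and removing the time test function -/

section Abstract

variable {H : Type*} [NormedAddCommGroup H] [InnerProductSpace ℝ H] {S : ℝ → H →L[ℝ] H}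

theorem IsIsometryGroup.continuous_neg_apply (hS : IsIsometryGroup S) {G : ℝ → H}
    (hG : Continuous G) : Continuous fun t => S (-t) (G t) :=
  hS.continuous_uncurry.comp (continuous_neg.prodMk hG)

theorem IsIsometryGroup.inner_map (hS : IsIsometryGroup S) (t : ℝ) (u v : H) :
    inner ℝ (S t u) (S t v) = inner ℝ u v := by
  rw [real_inner_eq_norm_add_mul_self_sub_norm_mul_self_sub_norm_mul_self_div_two,
    real_inner_eq_norm_add_mul_self_sub_norm_mul_self_sub_norm_mul_self_div_two,
    ← _root_.map_add, hS.norm_map, hS.norm_map, hS.norm_map]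

/-- If the weak formulation holds for test curves `e` that are almost `κ • v` along the group,
it holds for `κ • v`. -/
theorem integral_eq_zero_of_approx (hS : IsIsometryGroup S) {T lam C : ℝ} (hT : 0 < T)
    {F Q : ℝ → H} (hF : Continuous F) (hQ : Continuous Q) {κ κ' : ℝ → ℝ} (hκ : Continuous κ)
    (hκ' : Continuous κ') {v : H}
    (h : ∀ ε, 0 < ε → ε ≤ 1 → ∃ e m : ℝ → H, Continuous e ∧ Continuous m ∧
      ∫ t in (0 : ℝ)..T, (inner ℝ (F t) (m t) - lam * inner ℝ (F t) (e t) +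
        lam * inner ℝ (Q t) (e t)) = 0 ∧
      ∀ t ∈ Icc 0 T, ‖S (-t) (e t) - κ t • v‖ ≤ C * ε ∧ ‖S (-t) (m t) - κ' t • v‖ ≤ C * ε) :
    ∫ t in (0 : ℝ)..T, ((κ' t - lam * κ t) * inner ℝ (S (-t) (F t)) v +
      lam * κ t * inner ℝ (S (-t) (Q t)) v) = 0 := by
  obtain ⟨B₀, hB₀⟩ := isCompact_Icc.exists_bound_of_continuousOn (s := Icc 0 T) hF.continuousOn
  obtain ⟨B₁, hB₁⟩ := isCompact_Icc.exists_bound_of_continuousOn (s := Icc 0 T) hQ.continuousOn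
  have hT0 : (0 : ℝ) ∈ Icc 0 T := ⟨le_rfl, hT.le⟩
  have hB₀0 := (norm_nonneg _).trans (hB₀ 0 hT0)
  have hB₁0 := (norm_nonneg _).trans (hB₁ 0 hT0)
  obtain ⟨D, hD⟩ : ∃ D : ℝ → ℝ, D = fun t => (κ' t - lam * κ t) * inner ℝ (S (-t) (F t)) v +
      lam * κ t * inner ℝ (S (-t) (Q t)) v := ⟨_, rfl⟩
  have hDc : Continuous D := by
    rw [hD]
    exact ((hκ'.sub (continuous_const.mul hκ)).mul
      ((hS.continuous_neg_apply hF).inner continuous_const)).add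
      ((continuous_const.mul hκ).mul ((hS.continuous_neg_apply hQ).inner continuous_const))
  rw [← hD]
  have key : ∀ ε, 0 < ε → ε ≤ 1 →
      |∫ t in (0 : ℝ)..T, D t| ≤ (B₀ + |lam| * B₀ + |lam| * B₁) * (C * ε) * T := by
    intro ε hε hε1
    obtain ⟨e, m, hec, hmc, hem, hle⟩ := h ε hε hε1
    have hpc : Continuous fun t => inner ℝ (F t) (m t) - lam * inner ℝ (F t) (e t) +
        lam * inner ℝ (Q t) (e t) :=
      ((hF.inner hmc).sub (continuous_const.mul (hF.inner hec))).add
        (continuous_const.mul (hQ.inner hec))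
    have e1 := intervalIntegral.integral_sub (hDc.intervalIntegrable 0 T)
      (hpc.intervalIntegrable 0 T) (μ := volume)
    rw [hem, sub_zero] at e1
    rw [← e1, ← Real.norm_eq_abs]
    refine (intervalIntegral.norm_integral_le_of_norm_le_const
      (C := (B₀ + |lam| * B₀ + |lam| * B₁) * (C * ε)) fun t ht => ?_).trans
      (by rw [sub_zero, abs_of_pos hT])
    rw [uIoc_of_le hT.le] at ht
    have ht' : t ∈ Icc 0 T := ⟨ht.1.le, ht.2⟩
    obtain ⟨h1, h2⟩ := hle t ht'
    -- Applying S(-t) to both entries of each inner product leaves only the two approximation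
    -- errors, each of size C ε.
    have e2 : D t - (inner ℝ (F t) (m t) - lam * inner ℝ (F t) (e t) +
        lam * inner ℝ (Q t) (e t)) = -inner ℝ (S (-t) (F t)) (S (-t) (m t) - κ' t • v) +
          lam * inner ℝ (S (-t) (F t)) (S (-t) (e t) - κ t • v) -
          lam * inner ℝ (S (-t) (Q t)) (S (-t) (e t) - κ t • v) := by
      rw [inner_sub_right, inner_sub_right, inner_sub_right, hS.inner_map, hS.inner_map,
        hS.inner_map, inner_smul_right, inner_smul_right, inner_smul_right, hD]
      ring
    have b1 : ∀ G G' : H, ∀ B, ‖G‖ ≤ B → ‖G'‖ ≤ C * ε → 0 ≤ B →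
        |inner ℝ (S (-t) G) G'| ≤ B * (C * ε) := by
      intro G G' B hG hG' hB
      refine (abs_real_inner_le_norm _ _).trans ?_
      rw [hS.norm_map]
      exact mul_le_mul hG hG' (norm_nonneg _) hB
    have c1 := b1 (F t) _ B₀ (hB₀ t ht') h2 hB₀0
    have c2 := b1 (F t) _ B₀ (hB₀ t ht') h1 hB₀0
    have c3 := b1 (Q t) _ B₁ (hB₁ t ht') h1 hB₁0
    rw [e2, Real.norm_eq_abs]
    have d1 := mul_le_mul_of_nonneg_left c2 (abs_nonneg lam)
    have d2 := mul_le_mul_of_nonneg_left c3 (abs_nonneg lam)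
    rw [← abs_mul] at d1 d2
    refine (abs_sub _ _).trans ?_
    have := abs_add_le (-inner ℝ (S (-t) (F t)) (S (-t) (m t) - κ' t • v))
      (lam * inner ℝ (S (-t) (F t)) (S (-t) (e t) - κ t • v))
    rw [abs_neg] at this
    linarith
  have hlim : Tendsto (fun ε : ℝ => (B₀ + |lam| * B₀ + |lam| * B₁) * (C * ε) * T)
      (𝓝[>] 0) (𝓝 0) := by
    have : Continuous fun ε : ℝ => (B₀ + |lam| * B₀ + |lam| * B₁) * (C * ε) * T := by fun_prop
    have := this.tendsto 0
    simp only [mul_zero, zero_mul] at this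
    exact this.mono_left nhdsWithin_le_nhds
  have hle : |∫ t in (0 : ℝ)..T, D t| ≤ 0 := by
    refine ge_of_tendsto hlim ?_
    filter_upwards [Ioc_mem_nhdsGT (zero_lt_one' ℝ)] with ε hε
    exact key ε hε.1 hε.2
  exact abs_nonpos_iff.1 hle

/-- Duhamel's formula tested with a vector `v`. -/
theorem inner_duhamel_eq_zero [CompleteSpace H] (hS : IsIsometryGroup S) {T lam : ℝ} (hT : 0 < T)
    {F Q : ℝ → H} (hF : Continuous F) (hQ : Continuous Q) {v : H}
    (h : ∀ κ : ℝ → ℝ, ContDiff ℝ ∞ κ → (∃ δ > 0, ∀ t, κ t ≠ 0 → δ ≤ t ∧ t ≤ T - δ) →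
      ∫ t in (0 : ℝ)..T, ((deriv κ t - lam * κ t) * inner ℝ (S (-t) (F t)) v +
        lam * κ t * inner ℝ (S (-t) (Q t)) v) = 0) {t : ℝ} (ht : t ∈ Icc 0 T) :
    inner ℝ (Real.exp (lam * t) • S (-t) (F t) -
      (F 0 + lam • ∫ s in (0 : ℝ)..t, Real.exp (lam * s) • S (-s) (Q s))) v = 0 := by
  have hexp : Continuous fun t : ℝ => Real.exp (lam * t) := by fun_prop
  have hU : Continuous fun t => Real.exp (lam * t) * inner ℝ (S (-t) (F t)) v :=
    hexp.mul ((hS.continuous_neg_apply hF).inner continuous_const)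
  have hV : Continuous fun t => lam * (Real.exp (lam * t) * inner ℝ (S (-t) (Q t)) v) :=
    continuous_const.mul (hexp.mul ((hS.continuous_neg_apply hQ).inner continuous_const))
  have hcont : Continuous fun s => Real.exp (lam * s) • S (-s) (Q s) :=
    hexp.smul (hS.continuous_neg_apply hQ)
  have hbr := eq_add_integral_of_weak_deriv hT hU hV (fun θ hθ hθc hθs => ?_) t ht
  · simp only [mul_zero, Real.exp_zero, one_mul, neg_zero, hS.map_zero] at hbr
    rw [inner_sub_left, inner_add_left, real_inner_smul_left, real_inner_smul_left, sub_eq_zero,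
      hbr, intervalIntegral.integral_const_mul]
    congr 2
    rw [real_inner_comm, ← innerSL_apply_apply ℝ,
      ← ContinuousLinearMap.intervalIntegral_comp_comm _ (hcont.intervalIntegrable _ _)]
    refine intervalIntegral.integral_congr fun s _ => ?_
    simp only [innerSL_apply_apply]
    rw [inner_smul_right, real_inner_comm]
  -- With κ = e^{lam t} θ one has κ' - lam κ = e^{lam t} θ', which turns the weak identity into the
  -- hypothesis of the du Bois-Reymond lemma.
  · have hκ : ContDiff ℝ ∞ fun t => Real.exp (lam * t) * θ t :=
      (Real.contDiff_exp.comp (contDiff_const.mul contDiff_id)).mul hθ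
    have hκs : ∃ δ > 0, ∀ t, Real.exp (lam * t) * θ t ≠ 0 → δ ≤ t ∧ t ≤ T - δ := by
      obtain ⟨δ, hδ, hsub⟩ := hθc.isCompact.exists_cthickening_subset_open isOpen_Ioo hθs
      refine ⟨δ, hδ, fun t ht => ?_⟩
      have hts := subset_tsupport θ (right_ne_zero_of_mul ht)
      have hm1 : t - δ ∈ Ioo 0 T := hsub (Metric.mem_cthickening_of_dist_le _ t _ _ hts
        (by rw [Real.dist_eq, sub_sub_cancel_left, abs_neg, abs_of_pos hδ]))
      have hm2 : t + δ ∈ Ioo 0 T := hsub (Metric.mem_cthickening_of_dist_le _ t _ _ hts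
        (by rw [Real.dist_eq, add_sub_cancel_left, abs_of_pos hδ]))
      exact ⟨by linarith [hm1.1], by linarith [hm2.2]⟩
    refine Eq.trans ?_ (h _ hκ hκs)
    refine intervalIntegral.integral_congr fun s _ => ?_
    have hd : deriv (fun t => Real.exp (lam * t) * θ t) s =
        lam * Real.exp (lam * s) * θ s + Real.exp (lam * s) * deriv θ s := by
      have h1 : HasDerivAt (fun t : ℝ => Real.exp (lam * t)) (lam * Real.exp (lam * s)) s := by
        have := ((hasDerivAt_id s).const_mul lam).exp
        simpa [mul_comm] using this
      exact (h1.mul (hθ.differentiable (by simp) s).hasDerivAt).deriv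
    rw [hd]
    ring

end Abstract

/-! ### Equivalence of weak and mild solutions -/

section WeakIsMild

variable {N : ℕ} {L : Fin N → ℝ} {A : E N × ℝ → E N} {T : ℝ}

/-- An element of `L²` orthogonal to all periodized test functions vanishes. -/
theorem eq_zero_of_inner_periodize (hL : ∀ i, 0 < L i) {G : L2XYXi L}
    (h : ∀ g : E N × E N × ℝ → ℝ, ContDiff ℝ ∞ g → HasCompactSupport g →
      ∫ z, G z * periodize L (inclY N) g z ∂(measXYXi L) = 0) : G = 0 := by
  have hli : LocallyIntegrable (fun z => G z) (measXYXi L) :=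
    (Lp.memLp G).locallyIntegrable (by norm_num)
  suffices hz : ∀ᵐ z ∂(measXYXi L), G z = 0 by
    apply Lp.ext
    filter_upwards [hz, Lp.coeFn_zero ℝ 2 (measXYXi L)] with z a c
    rw [c, a, Pi.zero_apply]
  generalize (G : E N × E N × ℝ → ℝ) = u at *
  rw [measXYXi_eq] at hli
  -- Both G and -G have non-negative pairings with non-negative periodized functions.
  have h1 := ae_nonneg_of_periodize hL (π := projY N) (ι := inclY N) projY_inclY volume hli
    (fun g hg hc _ => by rw [← measXYXi_eq, h g hg hc])
  have h2 := ae_nonneg_of_periodize hL (π := projY N) (ι := inclY N) projY_inclY volume hli.neg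
    (fun g hg hc _ => by
      rw [← measXYXi_eq]
      simp only [Pi.neg_apply, neg_mul]
      rw [integral_neg, h g hg hc, neg_zero])
  rw [← measXYXi_eq] at h1 h2
  filter_upwards [h1, h2] with z a b
  rw [Pi.neg_apply] at b
  linarith

variable {lam : ℝ} {F₀ : L2XYXi L} {P : L2XYXi L → L2XYXi L} {f : XT L T}

/-- Weak solutions are mild solutions. -/
theorem isMild_of_weak (hL : ∀ i, 0 < L i) (hA : IsDivFreeFlux L A) (hT : 0 < T)
    (hP : Continuous P) (h0 : f ⟨0, le_rfl, hT.le⟩ = F₀)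
    (hw : ∀ φ, ∀ hφ : IsEvolTest L T φ, ∫ t in (0 : ℝ)..T, evolPairing hA hφ lam
      (IccExtend hT.le f t) (P (IccExtend hT.le f t)) t = 0) :
    IsMild (transport hA) P lam F₀ hT.le f := by
  have hS := isIsometryGroup_transport hA
  have hFc : Continuous (IccExtend hT.le f) := f.continuous.Icc_extend'
  have hF0 : IccExtend hT.le f 0 = F₀ := by
    rw [IccExtend_of_mem hT.le f ⟨le_rfl, hT.le⟩, h0]
  -- This is Duhamel's formula with S(t) and the exponential moved to the left; it is checked
  -- against a family of test functions that separates points of L².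
  have key : ∀ t ∈ Icc 0 T, Real.exp (lam * t) • transport hA (-t) (IccExtend hT.le f t) =
      F₀ + lam • ∫ s in (0 : ℝ)..t, Real.exp (lam * s) • transport hA (-s)
        (P (IccExtend hT.le f s)) := by
    intro t ht
    rw [← sub_eq_zero]
    refine eq_zero_of_inner_periodize hL fun g hg hgc => ?_
    have hs := contDiff_periodize hL (projY N) (inclY N) projY_inclY hgc hg
    have hp : ∀ z i, periodize L (inclY N) g (z + inclY N (EuclideanSpace.single i (L i))) =
      periodize L (inclY N) g z := periodize_periodic _ _
    obtain ⟨R, hR⟩ : ∃ R, ∀ z : E N × E N × ℝ, R < ‖z.1‖ ∨ R < |z.2.2| →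
        periodize L (inclY N) g z = 0 := by
      obtain ⟨R, hR⟩ := hgc.isCompact.isBounded.exists_norm_le
      refine ⟨R, fun z hz => periodize_eq_zero fun k => ?_⟩
      by_contra hne
      have h1 := hR _ (subset_tsupport g hne)
      rw [Prod.norm_def, Prod.norm_def] at h1
      simp only [inclY, ContinuousLinearMap.comp_apply, ContinuousLinearMap.inl_apply,
        ContinuousLinearMap.inr_apply, Prod.fst_add, Prod.snd_add, add_zero, sup_le_iff,
        Real.norm_eq_abs] at h1
      rcases hz with hz | hz
      · linarith [h1.1]
      · linarith [h1.2.2]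
    generalize periodize L (inclY N) g = h at *
    have hm : MemLp h 2 (measXYXi L) := memLp_of_continuous_box hs.continuous hR 2
    rw [← inner_toLp_eq _ hm, ← hF0]
    refine inner_duhamel_eq_zero hS hT hFc (hP.comp hFc) (fun κ hκ hκs => ?_) ht
    obtain ⟨C, hC⟩ := exists_evolTest_approx hL hA hT hs hp hR hκ hκs hm.coeFn_toLp
    refine integral_eq_zero_of_approx (C := C) hS hT hFc (hP.comp hFc) hκ.continuous
      (hκ.continuous_deriv (by simp)) fun ε hε hε1 => ?_
    obtain ⟨φ, hφ, hφe⟩ := hC ε hε hε1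
    exact ⟨evolLp hφ, materialLp hA hφ, continuous_evolLp hA hφ, continuous_materialLp hA hφ,
      hw φ hφ, hφe⟩
  intro t
  have h1 := key t t.2
  rw [duhamel, ← h1, _root_.map_smul, ← hS.map_add, add_neg_cancel, hS.map_zero, smul_smul,
    ← Real.exp_add, neg_add_cancel, Real.exp_zero, one_smul, IccExtend_val]

variable {u₀ : E N × E N → ℝ}

theorem isBGKSolution_iff_isMild (hL : ∀ i, 0 < L i) (hA : IsDivFreeFlux L A) (hT : 0 < T)
    (hF₀ : F₀ =ᵐ[measXYXi L] initialDatum u₀) (f : XT L T) :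
    IsBGKSolution L A u₀ lam T f ↔
      IsMild (transport hA) (sliceProj (constraintSet L A (supNorm L u₀))) lam F₀ hT.le f := by
  have hP : Continuous (sliceProj (constraintSet L A (supNorm L u₀))) :=
    (lipschitzWith_sliceProj (zero_mem_constraintSet hL) (isClosed_constraintSet hL hA)
      (convex_constraintSet hL hA)).continuous
  rw [isBGKSolution_iff hL hA hT hF₀]
  constructor
  · rintro ⟨h0, hw⟩
    exact isMild_of_weak hL hA hT hP h0 hw
  · intro h
    refine ⟨?_, fun φ hφ => h.integral_evolPairing_eq_zero hA hT hP hφ⟩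
    rw [h ⟨0, le_rfl, hT.le⟩, duhamel]
    simp [(isIsometryGroup_transport hA).map_zero]

end WeakIsMild

/-! ### Mollification and the commutator estimate -/

section Mollify

set_option linter.unusedSectionVars false

variable {W : Type*} [NormedAddCommGroup W] [NormedSpace ℝ W] [MeasurableSpace W] [BorelSpace W]
  [FiniteDimensional ℝ W] (μ : Measure W) [μ.IsAddHaarMeasure]

/-- `div (a q) = 0` in the sense of distributions on the whole space. -/
def IsWeakDivFree (a : W → W) (q : W → ℝ) : Prop :=
  ∀ ψ : W → ℝ, ContDiff ℝ ∞ ψ → HasCompactSupport ψ → ∫ w, q w * fderiv ℝ ψ w (a w) ∂μ = 0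

/-- A smooth probability density supported in the unit ball. -/
def unitKernel : W → ℝ := (⟨1 / 2, 1, by norm_num, by norm_num⟩ : ContDiffBump (0 : W)).normed μ

/-- The mollifier `ε^{-d} ρ(v / ε)`. -/
def mollifier (ε : ℝ) (v : W) : ℝ :=
  (ε ^ Module.finrank ℝ W)⁻¹ * unitKernel μ (ε⁻¹ • v)

theorem contDiff_unitKernel : ContDiff ℝ ∞ (unitKernel μ) := ContDiffBump.contDiff_normed _

theorem unitKernel_nonneg (v : W) : 0 ≤ unitKernel μ v := ContDiffBump.nonneg_normed _ _

theorem unitKernel_eq_zero {v : W} (hv : 1 < ‖v‖) : unitKernel μ v = 0 := by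
  have h := ContDiffBump.support_normed_eq (μ := μ)
    (⟨1 / 2, 1, by norm_num, by norm_num⟩ : ContDiffBump (0 : W))
  by_contra hne
  have : v ∈ Function.support (unitKernel μ) := hne
  rw [unitKernel, h, mem_ball_zero_iff] at this
  linarith

theorem integral_unitKernel : ∫ v, unitKernel μ v ∂μ = 1 := ContDiffBump.integral_normed _

theorem contDiff_mollifier (ε : ℝ) : ContDiff ℝ ∞ (mollifier μ ε) :=
  contDiff_const.mul ((contDiff_unitKernel μ).comp (contDiff_const_smul _))

theorem mollifier_nonneg {ε : ℝ} (hε : 0 < ε) (v : W) : 0 ≤ mollifier μ ε v :=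
  mul_nonneg (by positivity) (unitKernel_nonneg μ _)

theorem mollifier_eq_zero {ε : ℝ} (hε : 0 < ε) {v : W} (hv : v ∉ Metric.closedBall 0 ε) :
    mollifier μ ε v = 0 := by
  rw [mem_closedBall_zero_iff, not_le] at hv
  rw [mollifier, unitKernel_eq_zero, mul_zero]
  rw [norm_smul, norm_inv, Real.norm_of_nonneg hε.le, inv_mul_eq_div]
  exact (one_lt_div hε).2 hv

theorem hasCompactSupport_mollifier {ε : ℝ} (hε : 0 < ε) : HasCompactSupport (mollifier μ ε) :=
  HasCompactSupport.intro (isCompact_closedBall 0 ε) fun _ hv => mollifier_eq_zero μ hε hv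

theorem integral_mollifier {ε : ℝ} (hε : 0 < ε) : ∫ v, mollifier μ ε v ∂μ = 1 := by
  simp only [mollifier]
  rw [integral_const_mul, Measure.integral_comp_inv_smul, integral_unitKernel, abs_of_pos (by positivity)]
  rw [smul_eq_mul, mul_one]
  exact inv_mul_cancel₀ (by positivity)

theorem fderiv_mollifier_eq_zero {ε : ℝ} (hε : 0 < ε) {v : W} (hv : v ∉ Metric.closedBall 0 ε) :
    fderiv ℝ (mollifier μ ε) v = 0 := by
  have : mollifier μ ε =ᶠ[𝓝 v] fun _ => (0 : ℝ) := by
    filter_upwards [Metric.isClosed_closedBall.isOpen_compl.mem_nhds hv] with u hu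
    exact mollifier_eq_zero μ hε hu
  rw [this.fderiv_eq]
  simp

/-- By scaling, each derivative costs a factor ε⁻¹, with one constant for all ε. In the commutator
this factor is absorbed by the Lipschitz increment of the vector field. -/
theorem exists_mollifier_bound : ∃ C, 0 ≤ C ∧ ∀ ε, 0 < ε → ∀ v : W,
    |mollifier μ ε v| ≤ C * (ε ^ Module.finrank ℝ W)⁻¹ ∧
      ‖fderiv ℝ (mollifier μ ε) v‖ * ε ≤ C * (ε ^ Module.finrank ℝ W)⁻¹ := by
  have hc : HasCompactSupport (unitKernel μ) := ContDiffBump.hasCompactSupport_normed _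
  obtain ⟨C₀, hC₀⟩ := hc.exists_bound_of_continuous (contDiff_unitKernel μ).continuous
  obtain ⟨C₁, hC₁⟩ := (hc.fderiv (𝕜 := ℝ)).exists_bound_of_continuous
    ((contDiff_unitKernel μ).continuous_fderiv (by simp))
  refine ⟨max C₀ C₁, le_max_of_le_left ((norm_nonneg _).trans (hC₀ 0)), fun ε hε v => ⟨?_, ?_⟩⟩
  · rw [mollifier, abs_mul, abs_of_nonneg (by positivity), mul_comm]
    exact mul_le_mul_of_nonneg_right ((hC₀ _).trans (le_max_left _ _)) (by positivity)
  · have h1 : HasFDerivAt (mollifier μ ε) ((ε ^ Module.finrank ℝ W)⁻¹ •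
        ((fderiv ℝ (unitKernel μ) (ε⁻¹ • v)).comp (ε⁻¹ • ContinuousLinearMap.id ℝ W))) v := by
      refine HasFDerivAt.const_mul ?_ _
      have hd : Differentiable ℝ (unitKernel μ) := (contDiff_unitKernel μ).differentiable (by simp)
      exact (hd _).hasFDerivAt.comp v ((hasFDerivAt_id v).const_smul ε⁻¹)
    rw [h1.fderiv, norm_smul, ContinuousLinearMap.comp_smul, ContinuousLinearMap.comp_id, norm_smul,
      Real.norm_of_nonneg (by positivity), Real.norm_of_nonneg (by positivity)]
    have h2 := (hC₁ (ε⁻¹ • v)).trans (le_max_right C₀ C₁)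
    have h3 : (ε ^ Module.finrank ℝ W)⁻¹ * (ε⁻¹ * ‖fderiv ℝ (unitKernel μ) (ε⁻¹ • v)‖) * ε =
        ‖fderiv ℝ (unitKernel μ) (ε⁻¹ • v)‖ * (ε ^ Module.finrank ℝ W)⁻¹ := by
      field_simp
    rw [h3]
    exact mul_le_mul_of_nonneg_right h2 (by positivity)

variable {q : W → ℝ}

theorem integrable_mul_of_bounded {G : W → ℝ} (hG : Continuous G) (hGc : HasCompactSupport G)
    (hq : AEStronglyMeasurable q μ) {c : ℝ} (hc : ∀ w, |q w| ≤ c) :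
    Integrable (fun w => G w * q w) μ :=
  (hG.integrable_of_hasCompactSupport hGc).mul_bdd hq (Eventually.of_forall hc)

/-- Integrals against concentrated kernels are controlled by averages over small balls. -/
theorem abs_integral_kernel_le (hq : AEStronglyMeasurable q μ) {c : ℝ} (hc : ∀ w, |q w| ≤ c)
    {G : W → ℝ} {C ε : ℝ} (hε : 0 < ε) (hG0 : ∀ t, t ∉ Metric.closedBall (0 : W) ε → G t = 0)
    (hC : ∀ t, |G t| ≤ C * (ε ^ Module.finrank ℝ W)⁻¹) (w : W) :
    |∫ t, G t * (q (w - t) - q w) ∂μ| ≤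
      C * μ.real (Metric.closedBall 0 1) * ⨍ v in Metric.closedBall w ε, ‖q v - q w‖ ∂μ := by
  have hm : MeasurableSet (Metric.closedBall w ε) := Metric.isClosed_closedBall.measurableSet
  have hcon : IntegrableOn (fun v => ‖q v - q w‖) (Metric.closedBall w ε) μ := by
    have hfin : μ (Metric.closedBall w ε) < ⊤ := (isCompact_closedBall w ε).measure_lt_top
    refine Measure.integrableOn_of_bounded (M := c + c) hfin.ne
      (hq.sub aestronglyMeasurable_const).norm (Eventually.of_forall fun v => ?_)
    rw [norm_norm]
    exact (norm_sub_le _ _).trans (add_le_add (hc _) (hc _))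
  have hi : Integrable ((Metric.closedBall w ε).indicator fun v => ‖q v - q w‖) μ :=
    hcon.integrable_indicator hm
  have hle := norm_integral_le_of_norm_le (μ := μ) (f := fun t => G t * (q (w - t) - q w))
    (g := fun t => C * (ε ^ Module.finrank ℝ W)⁻¹ *
      (Metric.closedBall w ε).indicator (fun v => ‖q v - q w‖) (w - t))
    ((hi.comp_sub_left w).const_mul _) (Eventually.of_forall fun t => ?_)
  · rw [integral_const_mul, integral_sub_left_eq_self, integral_indicator hm] at hle
    rw [setAverage_eq, smul_eq_mul, Measure.addHaar_real_closedBall' μ w hε.le, mul_inv]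
    refine hle.trans (le_of_eq ?_)
    have hpos : μ.real (Metric.closedBall (0 : W) 1) ≠ 0 :=
      (ENNReal.toReal_pos (Metric.measure_closedBall_pos μ _ one_pos).ne'
        (isCompact_closedBall _ _).measure_lt_top.ne).ne'
    field_simp
  · simp only [norm_mul, Real.norm_eq_abs]
    by_cases ht : t ∈ Metric.closedBall (0 : W) ε
    · have : w - t ∈ Metric.closedBall w ε := by
        rw [mem_closedBall_iff_norm, sub_sub_cancel_left, norm_neg]
        exact mem_closedBall_zero_iff.1 ht
      rw [indicator_of_mem this]
      exact mul_le_mul_of_nonneg_right (hC t) (abs_nonneg _)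
    · rw [hG0 t ht, abs_zero, zero_mul]
      refine mul_nonneg ((abs_nonneg _).trans (hC t)) (indicator_nonneg (fun _ _ => abs_nonneg _) _)

/-- The mollification `ρ_ε ⋆ q`. -/
def mollify (ε : ℝ) (q : W → ℝ) : W → ℝ :=
  convolution (mollifier μ ε) q (ContinuousLinearMap.mul ℝ ℝ) μ

theorem mollify_apply (ε : ℝ) (q : W → ℝ) (w : W) :
    mollify μ ε q w = ∫ t, mollifier μ ε t * q (w - t) ∂μ := rfl

theorem locallyIntegrable_of_bounded (hq : AEStronglyMeasurable q μ) {c : ℝ}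
    (hc : ∀ w, |q w| ≤ c) : LocallyIntegrable q μ :=
  (locallyIntegrable_const c).mono hq (Eventually.of_forall fun w => by
    rw [Real.norm_eq_abs, Real.norm_eq_abs]; exact (hc w).trans (le_abs_self c))

theorem contDiff_mollify {ε : ℝ} (hε : 0 < ε) (hq : LocallyIntegrable q μ) :
    ContDiff ℝ ∞ (mollify μ ε q) :=
  (hasCompactSupport_mollifier μ hε).contDiff_convolution_left _ (contDiff_mollifier μ ε) hq

theorem abs_mollify_le {ε : ℝ} (hε : 0 < ε) {c : ℝ} (hc : ∀ w, |q w| ≤ c) (w : W) :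
    |mollify μ ε q w| ≤ c := by
  have hm := (contDiff_mollifier μ ε).continuous.integrable_of_hasCompactSupport
    (hasCompactSupport_mollifier μ hε) (μ := μ)
  have := norm_integral_le_of_norm_le (μ := μ) (f := fun t => mollifier μ ε t * q (w - t))
    (hm.mul_const c) (Eventually.of_forall fun t => by
      rw [norm_mul, Real.norm_of_nonneg (mollifier_nonneg μ hε t)]
      exact mul_le_mul_of_nonneg_left (hc _) (mollifier_nonneg μ hε t))
  rw [integral_mul_const, integral_mollifier μ hε, one_mul] at this
  exact this

theorem fderiv_mollify {ε : ℝ} (hε : 0 < ε) (hq : LocallyIntegrable q μ) (w v : W) :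
    fderiv ℝ (mollify μ ε q) w v = ∫ t, fderiv ℝ (mollifier μ ε) t v * q (w - t) ∂μ := by
  have hc := hasCompactSupport_mollifier μ hε
  have hs := contDiff_mollifier μ ε
  have h := hc.hasFDerivAt_convolution_left (ContinuousLinearMap.mul ℝ ℝ)
    (hs.of_le (by exact_mod_cast le_top)) hq w
  have hcf : Continuous (fderiv ℝ (mollifier μ ε)) := hs.continuous_fderiv (by simp)
  have hex := (hc.fderiv (𝕜 := ℝ)).convolutionExists_left
    ((ContinuousLinearMap.mul ℝ ℝ).precompL W) hcf hq w
  rw [mollify, h.fderiv, convolution_def, ContinuousLinearMap.integral_apply hex]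
  rfl

variable {a : W → W}

/-- DiPerna–Lions: the commutator of a Lipschitz vector field with mollification. -/
theorem abs_fderiv_mollify_le {C : ℝ}
    (hC : ∀ ε, 0 < ε → ∀ v : W,
      ‖fderiv ℝ (mollifier μ ε) v‖ * ε ≤ C * (ε ^ Module.finrank ℝ W)⁻¹)
    (ha : Continuous a) (hq : AEStronglyMeasurable q μ) {c : ℝ}
    (hc : ∀ w, |q w| ≤ c) (hdiv : IsWeakDivFree μ a q) (hdiv1 : IsWeakDivFree μ a fun _ => 1)
    {ε : ℝ} (hε : 0 < ε) {K : ℝ} (hK : 0 ≤ K) {w : W}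
    (hlip : ∀ t, ‖t‖ ≤ ε → ‖a w - a (w - t)‖ ≤ K * ‖t‖) :
    |fderiv ℝ (mollify μ ε q) w (a w)| ≤
      C * K * μ.real (Metric.closedBall 0 1) *
        ⨍ v in Metric.closedBall w ε, ‖q v - q w‖ ∂μ := by
  have hs := contDiff_mollifier μ ε
  have hcs := hasCompactSupport_mollifier μ hε
  have hcf : Continuous (fderiv ℝ (mollifier μ ε)) := hs.continuous_fderiv (by simp)
  have hd : Differentiable ℝ (mollifier μ ε) := hs.differentiable (by simp)
  -- The equation for p is tested with the reflected kernel v ↦ ρ_ε(w - v). It is used below for p =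
  -- q and, as the field itself is divergence free, for p = 1.
  have hzero : ∀ p : W → ℝ, IsWeakDivFree μ a p →
      ∫ t, fderiv ℝ (mollifier μ ε) t (a (w - t)) * p (w - t) ∂μ = 0 := by
    intro p hp
    have h1 := hp (fun v => mollifier μ ε (w - v)) (hs.comp (contDiff_const.sub contDiff_id))
      (hcs.comp_homeomorph (Homeomorph.subLeft w))
    rw [← integral_sub_left_eq_self _ μ w] at h1
    rw [← neg_eq_zero, ← integral_neg, ← h1]
    refine integral_congr_ae (Eventually.of_forall fun t => ?_)
    have h2 : HasFDerivAt (fun v => mollifier μ ε (w - v))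
        ((fderiv ℝ (mollifier μ ε) (w - (w - t))).comp (-ContinuousLinearMap.id ℝ W)) (w - t) :=
      (hd _).hasFDerivAt.comp (w - t) ((hasFDerivAt_id (w - t)).const_sub w)
    simp only
    rw [h2.fderiv, sub_sub_cancel]
    simp
    ring
  have cg1 : Continuous fun t => fderiv ℝ (mollifier μ ε) t (a w) := hcf.clm_apply continuous_const
  have cg2 : Continuous fun t => fderiv ℝ (mollifier μ ε) t (a (w - t)) :=
    hcf.clm_apply (ha.comp (continuous_const.sub continuous_id))
  have sg : ∀ b : W → W, HasCompactSupport fun t => fderiv ℝ (mollifier μ ε) t (b t) := fun b =>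
    HasCompactSupport.intro (isCompact_closedBall 0 ε) fun t ht => by
      rw [fderiv_mollifier_eq_zero μ hε ht]; simp
  have hqs : AEStronglyMeasurable (fun t => q (w - t)) μ :=
    hq.comp_quasiMeasurePreserving (quasiMeasurePreserving_sub_left μ w)
  have i1 := integrable_mul_of_bounded μ cg1 (sg fun _ => a w) hqs fun t => hc (w - t)
  have i2 := integrable_mul_of_bounded μ cg2 (sg fun t => a (w - t)) hqs fun t => hc (w - t)
  have i3 := cg1.integrable_of_hasCompactSupport (sg fun _ => a w) (μ := μ)
  have i4 := cg2.integrable_of_hasCompactSupport (sg fun t => a (w - t)) (μ := μ)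
  have h0 : ∫ t, fderiv ℝ (mollifier μ ε) t (a w) ∂μ = 0 := by
    have := integral_mul_fderiv_eq_neg_fderiv_mul_of_integrable (μ := μ) (f := fun _ : W => (1 : ℝ))
      (g := mollifier μ ε) (v := a w) (by simp) (by simpa using i3)
      (by simpa using hs.continuous.integrable_of_hasCompactSupport hcs) (by simp)
      (fun x _ => hd x)
    simpa using this
  -- Subtracting a(w - t) from a(w) is free by the equation for q, and subtracting q(w) from q(w -
  -- t) is free because ∇ρ_ε · a(w) and ∇ρ_ε(t) · a(w - t) both have integral zero. The first
  -- difference yields a factor |t| ≤ ε, the second decays in mean at Lebesgue points.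
  have e : fderiv ℝ (mollify μ ε q) w (a w) =
      ∫ t, fderiv ℝ (mollifier μ ε) t (a w - a (w - t)) * (q (w - t) - q w) ∂μ := by
    have e1 : ∀ t, fderiv ℝ (mollifier μ ε) t (a w - a (w - t)) * (q (w - t) - q w) =
        (fderiv ℝ (mollifier μ ε) t (a w) * q (w - t) -
          fderiv ℝ (mollifier μ ε) t (a (w - t)) * q (w - t)) -
        (fderiv ℝ (mollifier μ ε) t (a w) - fderiv ℝ (mollifier μ ε) t (a (w - t))) * q w := by
      intro t; rw [_root_.map_sub]; ring
    have i12 : Integrable (fun t => fderiv ℝ (mollifier μ ε) t (a w) * q (w - t) -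
        fderiv ℝ (mollifier μ ε) t (a (w - t)) * q (w - t)) μ := i1.sub i2
    have i34 : Integrable (fun t => (fderiv ℝ (mollifier μ ε) t (a w) -
        fderiv ℝ (mollifier μ ε) t (a (w - t))) * q w) μ := (i3.sub i4).mul_const _
    simp_rw [e1]
    rw [integral_sub i12 i34, integral_sub i1 i2,
      integral_mul_const, integral_sub i3 i4, h0, hzero q hdiv,
      ← fderiv_mollify μ hε (locallyIntegrable_of_bounded μ hq hc)]
    have := hzero _ hdiv1
    simp only [mul_one] at this
    rw [this]
    ring
  rw [e]
  refine abs_integral_kernel_le μ hq hc hε (fun t ht => ?_) (fun t => ?_) w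
  · rw [fderiv_mollifier_eq_zero μ hε ht]; simp
  · by_cases ht : t ∈ Metric.closedBall (0 : W) ε
    · have ht' := mem_closedBall_zero_iff.1 ht
      refine ((fderiv ℝ (mollifier μ ε) t).le_opNorm _).trans ?_
      have h1 : ‖a w - a (w - t)‖ ≤ K * ε :=
        (hlip t ht').trans (mul_le_mul_of_nonneg_left ht' hK)
      calc _ ≤ ‖fderiv ℝ (mollifier μ ε) t‖ * (K * ε) :=
            mul_le_mul_of_nonneg_left h1 (norm_nonneg _)
        _ = K * (‖fderiv ℝ (mollifier μ ε) t‖ * ε) := by ring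
        _ ≤ K * (C * (ε ^ Module.finrank ℝ W)⁻¹) := mul_le_mul_of_nonneg_left (hC ε hε t) hK
        _ = _ := by ring
    · rw [fderiv_mollifier_eq_zero μ hε ht]
      have := (mul_nonneg (norm_nonneg _) hε.le).trans (hC ε hε t)
      have := mul_nonneg hK this
      simp
      linarith

/-- Stated with the same ball average as the commutator estimate, so that a single application of
Lebesgue's differentiation theorem handles both. -/
theorem abs_mollify_sub_le {C : ℝ}
    (hC : ∀ ε, 0 < ε → ∀ v : W, |mollifier μ ε v| ≤ C * (ε ^ Module.finrank ℝ W)⁻¹)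
    (hq : AEStronglyMeasurable q μ) {c : ℝ} (hc : ∀ w, |q w| ≤ c)
    {ε : ℝ} (hε : 0 < ε) (w : W) :
    |mollify μ ε q w - q w| ≤ C * μ.real (Metric.closedBall 0 1) *
        ⨍ v in Metric.closedBall w ε, ‖q v - q w‖ ∂μ := by
  have hs := (contDiff_mollifier μ ε).continuous
  have hcs := hasCompactSupport_mollifier μ hε
  have hqs : AEStronglyMeasurable (fun t => q (w - t)) μ :=
    hq.comp_quasiMeasurePreserving (quasiMeasurePreserving_sub_left μ w)
  have i1 := integrable_mul_of_bounded μ hs hcs hqs fun t => hc (w - t)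
  have i2 := hs.integrable_of_hasCompactSupport hcs (μ := μ)
  have e : mollify μ ε q w - q w = ∫ t, mollifier μ ε t * (q (w - t) - q w) ∂μ := by
    simp_rw [mul_sub]
    rw [integral_sub i1 (i2.mul_const _), integral_mul_const, integral_mollifier μ hε, one_mul,
      mollify_apply]
  rw [e]
  exact abs_integral_kernel_le μ hq hc hε (fun t ht => mollifier_eq_zero μ hε ht) (hC ε hε) w

end Mollify

/-! ### Exchange of derivatives under the integral -/

section MixedDerivatives

variable {W : Type*} [NormedAddCommGroup W] [NormedSpace ℝ W] [MeasurableSpace W] [BorelSpace W]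
  [FiniteDimensional ℝ W] (μ : Measure W) [μ.IsAddHaarMeasure]

/-- Two integrations by parts exchange the directions of differentiation. -/
theorem integral_fderiv_mul_fderiv_comm {ψ g : W → ℝ} (hψ : ContDiff ℝ ∞ ψ)
    (hψc : HasCompactSupport ψ) (hg : ContDiff ℝ 1 g) (u v : W) :
    ∫ w, fderiv ℝ ψ w u * fderiv ℝ g w v ∂μ = ∫ w, fderiv ℝ ψ w v * fderiv ℝ g w u ∂μ := by
  have hgd : Differentiable ℝ g := hg.differentiable (by simp)
  have hfs : ContDiff ℝ ∞ (fderiv ℝ ψ) := hψ.fderiv_right (by simp)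
  have hfd : Differentiable ℝ (fderiv ℝ ψ) := hfs.differentiable (by simp)
  have hd2 : ∀ w u v, fderiv ℝ (fun w => fderiv ℝ ψ w u) w v = fderiv ℝ (fderiv ℝ ψ) w v u := by
    intro w u v
    have h1 : HasFDerivAt (fun w => fderiv ℝ ψ w u)
        ((ContinuousLinearMap.apply ℝ ℝ u).comp (fderiv ℝ (fderiv ℝ ψ) w)) w :=
      (ContinuousLinearMap.apply ℝ ℝ u).hasFDerivAt.comp w (hfd w).hasFDerivAt
    rw [h1.fderiv]
    rfl
  have hcs : ∀ u, HasCompactSupport fun w => fderiv ℝ ψ w u := fun u =>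
    (hψc.fderiv (𝕜 := ℝ)).comp_left (g := fun l : W →L[ℝ] ℝ => l u) (by simp)
  have hcs2 : ∀ u v, HasCompactSupport fun w => fderiv ℝ (fderiv ℝ ψ) w v u := fun u v =>
    ((hψc.fderiv (𝕜 := ℝ)).fderiv (𝕜 := ℝ)).comp_left
      (g := fun l : W →L[ℝ] W →L[ℝ] ℝ => l v u) (by simp)
  have hc1 : ∀ u, Continuous fun w => fderiv ℝ ψ w u := fun u =>
    hfs.continuous.clm_apply continuous_const
  have hc2 : ∀ u v, Continuous fun w => fderiv ℝ (fderiv ℝ ψ) w v u := fun u v =>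
    ((hfs.continuous_fderiv (by simp)).clm_apply continuous_const).clm_apply continuous_const
  have hgc : ∀ v, Continuous fun w => fderiv ℝ g w v := fun v =>
    (hg.continuous_fderiv (by simp)).clm_apply continuous_const
  -- Only ψ is differentiated twice, so g, a component of the flux, needs no second derivatives.
  have key : ∀ u v, ∫ w, fderiv ℝ ψ w u * fderiv ℝ g w v ∂μ =
      -∫ w, fderiv ℝ (fderiv ℝ ψ) w v u * g w ∂μ := by
    intro u v
    rw [integral_mul_fderiv_eq_neg_fderiv_mul_of_integrable (f := fun w => fderiv ℝ ψ w u)]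
    · simp_rw [hd2]
    · simp_rw [hd2]
      exact ((hc2 u v).mul hg.continuous).integrable_of_hasCompactSupport ((hcs2 u v).mul_right)
    · exact ((hc1 u).mul (hgc v)).integrable_of_hasCompactSupport ((hcs u).mul_right)
    · exact ((hc1 u).mul hg.continuous).integrable_of_hasCompactSupport ((hcs u).mul_right)
    · intro w _
      exact (hfd w).clm_apply (differentiableAt_const u)
    · intro w _
      exact hgd w
  rw [key u v, key v u]
  congr 1
  refine integral_congr_ae (Eventually.of_forall fun w => ?_)
  simp only
  rw [second_derivative_symmetric (f := ψ) (f' := fderiv ℝ ψ) (x := w)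
    (fun y => (hψ.differentiable (by simp) y).hasFDerivAt) (hfd w).hasFDerivAt]

end MixedDerivatives

/-! ### Divergence-free functions on the cell form an algebra -/

section Flux

variable {N : ℕ} {L : Fin N → ℝ} {A : E N × ℝ → E N}

/-- The vector field `(a, 0)` on `ℝ^N × ℝ`. -/
def kinField (A : E N × ℝ → E N) (w : E N × ℝ) : E N × ℝ := (velocity A w.1 w.2, 0)

theorem continuous_kinField (hA : IsDivFreeFlux L A) : Continuous (kinField A) :=
  (continuous_velocity hA).prodMk continuous_const

theorem locallyLipschitz_kinField (hA : IsDivFreeFlux L A) : LocallyLipschitz (kinField A) := by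
  have h := (((ContinuousLinearMap.inl ℝ (E N) ℝ).comp
    (ContinuousLinearMap.apply ℝ (E N) ((0 : E N), (1 : ℝ)))).lipschitz.locallyLipschitz).comp
      hA.lipschitz
  have e : kinField A = ((ContinuousLinearMap.inl ℝ (E N) ℝ).comp
      (ContinuousLinearMap.apply ℝ (E N) ((0 : E N), (1 : ℝ)))) ∘ fderiv ℝ A := by
    funext w
    simp [kinField, velocity_eq hA]
  rw [e]
  exact h

/-- The slab is enlarged by 1 to accommodate the mollification radii, which are at most one. -/
theorem exists_lipschitz_kinField (hA : IsDivFreeFlux L A) (R : ℝ) :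
    ∃ K, 0 ≤ K ∧ ∀ w : E N × ℝ, w.1 ∈ cell L → |w.2| ≤ R → ∀ t, ‖t‖ ≤ 1 →
      ‖kinField A w - kinField A (w - t)‖ ≤ K * ‖t‖ := by
  obtain ⟨K, hK⟩ := LocallyLipschitzOn.exists_lipschitzOnWith_of_compact
    ((isCompact_slab L R).cthickening (r := 1))
    ((locallyLipschitz_kinField hA).locallyLipschitzOn)
  refine ⟨K, K.2, fun w hw hR t ht => ?_⟩
  have hs : w ∈ slab L R := ⟨cell_subset_closedCell hw, abs_le.1 hR⟩
  have := hK.norm_sub_le (Metric.self_subset_cthickening _ hs)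
    (Metric.mem_cthickening_of_dist_le (w - t) w 1 _ hs (by simpa [dist_eq_norm] using ht))
  rwa [sub_sub_cancel] at this

theorem fderiv_fst_kinField {ψ : E N × ℝ → ℝ} (hψ : Differentiable ℝ ψ) (w : E N × ℝ) :
    fderiv ℝ (fun y' => ψ (y', w.2)) w.1 (velocity A w.1 w.2) = fderiv ℝ ψ w (kinField A w) :=
  fderiv_fst_eq hψ w _

/-- The velocity field is divergence free because the flux is. -/
theorem isWeakDivFree_one (hA : IsDivFreeFlux L A) :
    IsWeakDivFree (volume : Measure (E N × ℝ)) (kinField A) fun _ => 1 := by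
  intro ψ hψ hψc
  have hAd : Differentiable ℝ A := hA.contDiff.differentiable (by simp)
  have hAi : ∀ i, ContDiff ℝ 1 fun w => A w i := fun i =>
    (EuclideanSpace.proj i : E N →L[ℝ] ℝ).contDiff.comp hA.contDiff
  have hAf : ∀ i w v, fderiv ℝ (fun w => A w i) w v = fderiv ℝ A w v i := by
    intro i w v
    have h1 : HasFDerivAt (fun w => A w i)
        ((EuclideanSpace.proj i : E N →L[ℝ] ℝ).comp (fderiv ℝ A w)) w :=
      (EuclideanSpace.proj i : E N →L[ℝ] ℝ).hasFDerivAt.comp w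
        (hAd w).hasFDerivAt
    rw [h1.fderiv]
    rfl
  set e : Fin N → E N × ℝ := fun i => (EuclideanSpace.single i 1, 0) with he
  have hdec : ∀ w, fderiv ℝ ψ w (kinField A w) =
      ∑ i, fderiv ℝ ψ w (e i) * fderiv ℝ (fun w => A w i) w (0, 1) := by
    intro w
    have h1 : kinField A w = ∑ i, (fderiv ℝ A w (0, 1) i) • e i := by
      refine Prod.ext ?_ ?_
      · rw [Prod.fst_sum, kinField, velocity_eq hA]
        ext j
        simp [he, Pi.single_apply]
      · rw [Prod.snd_sum]
        simp [he, kinField]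
    rw [h1, _root_.map_sum]
    refine Finset.sum_congr rfl fun i _ => ?_
    rw [_root_.map_smul, smul_eq_mul, mul_comm, hAf]
  have hdiv : ∀ w, ∑ i, fderiv ℝ (fun w => A w i) w (e i) = 0 := by
    intro w
    rw [← hA.div_eq_zero w.1 w.2]
    refine Finset.sum_congr rfl fun i _ => ?_
    rw [hAf]
    have h1 : HasFDerivAt (fun y' => A (y', w.2))
        ((fderiv ℝ A w).comp (ContinuousLinearMap.inl ℝ (E N) ℝ)) w.1 :=
      (hAd w).hasFDerivAt.comp w.1 (hasFDerivAt_prodMk_left w.1 w.2)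
    rw [h1.fderiv]
    rfl
  have hint : ∀ i u v, Integrable (fun w => fderiv ℝ ψ w u * fderiv ℝ (fun w => A w i) w v) := by
    intro i u v
    refine Continuous.integrable_of_hasCompactSupport ?_ ?_
    · exact ((hψ.continuous_fderiv (by simp)).clm_apply continuous_const).mul
        (((hAi i).continuous_fderiv (by simp)).clm_apply continuous_const)
    · exact HasCompactSupport.mul_right ((hψc.fderiv (𝕜 := ℝ)).comp_left
        (g := fun l : E N × ℝ →L[ℝ] ℝ => l u) (by simp))
  simp_rw [one_mul, hdec]
  rw [integral_finsetSum _ fun i _ => hint i _ _]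
  -- Exchanging ∂_{y_i} and ∂_ξ turns ∑ ∂_i ψ ∂_ξ A_i into ∂_ξ ψ div_y A under the integral.
  simp_rw [integral_fderiv_mul_fderiv_comm volume hψ hψc (hAi _) (e _) (0, 1)]
  rw [← integral_finsetSum _ fun i _ => hint i _ _]
  simp_rw [← Finset.mul_sum, hdiv, mul_zero, integral_zero]

theorem fold_add_single (hL : ∀ i, 0 < L i) (y : E N) (i : Fin N) :
    fold L (y + EuclideanSpace.single i (L i)) = fold L y := by
  have h : EuclideanSpace.single i (L i) = latt L (Pi.single i 1) := by
    ext j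
    rw [latt_apply]
    by_cases hj : j = i
    · subst hj; simp
    · simp [hj]
  rw [h, fold_add_latt hL]

/-- The periodic extension of a function on the cell. -/
def periodicExt (L : Fin N → ℝ) (q : E N × ℝ → ℝ) (w : E N × ℝ) : ℝ := q (fold L w.1, w.2)

theorem measurable_periodicExt {q : E N × ℝ → ℝ} (hq : Measurable q) : Measurable (periodicExt L q) :=
  hq.comp (((measurable_fold L).comp measurable_fst).prodMk measurable_snd)

theorem periodicExt_of_mem (hL : ∀ i, 0 < L i) {q : E N × ℝ → ℝ} {w : E N × ℝ} (hw : w.1 ∈ cell L) :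
    periodicExt L q w = q w := by
  rw [periodicExt, fold_of_mem hL hw]

theorem periodicExt_add_single (hL : ∀ i, 0 < L i) (q : E N × ℝ → ℝ) (w : E N × ℝ) (i : Fin N) :
    periodicExt L q (w + (EuclideanSpace.single i (L i), 0)) = periodicExt L q w := by
  simp only [periodicExt, Prod.fst_add, Prod.snd_add, add_zero]
  rw [fold_add_single hL]

/-- Periodic divergence-free functions are divergence free on the whole space. -/
theorem IsDivFree.isWeakDivFree_periodicExt (hL : ∀ i, 0 < L i) (hA : IsDivFreeFlux L A)
    {q : E N × ℝ → ℝ} (hq : IsDivFree L A q) (hqm : Measurable q) {c : ℝ} (hc : ∀ w, |q w| ≤ c) :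
    IsWeakDivFree volume (kinField A) (periodicExt L q) := by
  intro ψ hψ hψc
  have hd : Differentiable ℝ ψ := hψ.differentiable (by simp)
  have hcs : HasCompactSupport fun w => fderiv ℝ ψ w (kinField A w) :=
    (hψc.fderiv (𝕜 := ℝ)).mono fun w hw => by
      intro h0
      apply hw
      simp only
      rw [h0]; simp
  have hcc : Continuous fun w => fderiv ℝ ψ w (kinField A w) :=
    (hψ.continuous_fderiv (by simp)).clm_apply (continuous_kinField hA)
  have hi : Integrable (fun w => periodicExt L q w * fderiv ℝ ψ w (kinField A w)) := by
    refine (integrable_mul_of_bounded volume hcc hcs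
      (measurable_periodicExt (L := L) hqm).aestronglyMeasurable fun w => hc _).congr
      (Eventually.of_forall fun w => mul_comm _ _)
  obtain ⟨S, hS1, hS2⟩ := periodize_eventuallyEq (L := L) hL (ContinuousLinearMap.fst ℝ (E N) ℝ)
    (ContinuousLinearMap.inl ℝ (E N) ℝ) (fun _ => rfl) hψc (Real.sqrt (∑ i, L i ^ 2) + 1)
  have hcell : ∀ z : E N × ℝ, z.1 ∈ cell L →
      ‖(ContinuousLinearMap.fst ℝ (E N) ℝ) z‖ < Real.sqrt (∑ i, L i ^ 2) + 1 := fun z hz => by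
    have := norm_le_of_mem_cell hz
    simp only [ContinuousLinearMap.coe_fst']
    linarith
  rw [integral_eq_setIntegral_cell (L := L) hL (π := ContinuousLinearMap.fst ℝ (E N) ℝ)
    (ι := ContinuousLinearMap.inl ℝ (E N) ℝ) (fun _ => rfl) volume hi (S := S), ← measYXi_eq]
  -- After unfolding, the periodic factors q and a come out of the sum over the lattice, and the
  -- translates of ∇ψ add up to the gradient of the periodization, an admissible test function.
  · rw [← hq _ (isTestYXi_periodize hL hψ hψc)]
    refine integral_congr_ae ?_
    filter_upwards [ae_fst_mem_cell L] with w hw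
    rw [fderiv_fst_kinField (isTestYXi_periodize hL hψ hψc).differentiable,
      fderiv_periodize hd (hS2 w (hcell w hw)), _root_.sum_apply, Finset.mul_sum]
    refine Finset.sum_congr rfl fun k _ => ?_
    have h1 : periodicExt L q (w + ContinuousLinearMap.inl ℝ (E N) ℝ (latt L k)) = q w := by
      simp only [periodicExt, ContinuousLinearMap.inl_apply, Prod.fst_add, Prod.snd_add, add_zero]
      rw [fold_add_latt hL, fold_of_mem hL hw]
    have h2 : kinField A (w + ContinuousLinearMap.inl ℝ (E N) ℝ (latt L k)) = kinField A w :=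
      periodic_latt (L := L) (X := E N × ℝ) (AddMonoidHom.inl (E N) ℝ) (f := kinField A)
        (fun x i => by simp [kinField, velocity_periodic hA]) k w
    rw [h1, h2]
  · intro z hz k hk
    have h1 := hS1 z (hcell z hz) k hk
    have : fderiv ℝ ψ (z + ContinuousLinearMap.inl ℝ (E N) ℝ (latt L k)) = 0 := by
      by_contra hne
      exact h1 (support_fderiv_subset ℝ hne)
    rw [this]
    simp

theorem setAverage_norm_le {W : Type*} [MeasurableSpace W] {μ : Measure W} {s : Set W}
    (hs : μ s < ⊤) {f : W → ℝ} {c : ℝ} (hc0 : 0 ≤ c) (hc : ∀ w, |f w| ≤ c) :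
    |⨍ w in s, f w ∂μ| ≤ c := by
  rw [setAverage_eq, smul_eq_mul, abs_mul, abs_of_nonneg (by positivity)]
  have := norm_setIntegral_le_of_norm_le_const (f := f) hs fun w _ => hc w
  rw [Real.norm_eq_abs] at this
  calc (μ.real s)⁻¹ * |∫ w in s, f w ∂μ| ≤ (μ.real s)⁻¹ * (c * μ.real s) :=
        mul_le_mul_of_nonneg_left this (by positivity)
    _ = c * ((μ.real s)⁻¹ * μ.real s) := by ring
    _ ≤ c * 1 := mul_le_mul_of_nonneg_left (inv_mul_le_one) hc0
    _ = c := mul_one c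

/-- Bounded divergence-free functions form an algebra. -/
theorem IsDivFree.mul (hL : ∀ i, 0 < L i) (hA : IsDivFreeFlux L A) {p q : E N × ℝ → ℝ}
    (hp : IsDivFree L A p) (hq : IsDivFree L A q) (hpm : Measurable p) (hqm : Measurable q)
    {c : ℝ} (hpc : ∀ w, |p w| ≤ c) (hqc : ∀ w, |q w| ≤ c) : IsDivFree L A fun w => p w * q w := by
  intro ψ hψ
  have hc0 : 0 ≤ c := (abs_nonneg _).trans (hpc 0)
  obtain ⟨Cρ, hCρ0, hCρ⟩ := exists_mollifier_bound (volume : Measure (E N × ℝ))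
  obtain ⟨R, hR0, hR⟩ := hψ.exists_support
  obtain ⟨K, hK0, hK⟩ := exists_lipschitz_kinField hA R
  obtain ⟨Cψ, hCψ0, hCψ, hCψ'⟩ := hψ.exists_bound
  obtain ⟨V, hV0, hV⟩ := exists_velocity_bound hA R
  have hqe := hq.isWeakDivFree_periodicExt hL hA hqm hqc
  have hqs : AEStronglyMeasurable (periodicExt L q) (volume : Measure (E N × ℝ)) :=
    (measurable_periodicExt hqm).aestronglyMeasurable
  have hqec : ∀ w, |periodicExt L q w| ≤ c := fun w => hqc _
  have hqli := locallyIntegrable_of_bounded volume hqs hqec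
  set ε : ℕ → ℝ := fun n => 1 / (n + 1) with hε
  have hεpos : ∀ n, 0 < ε n := fun n => by simp only [hε]; positivity
  have hεle : ∀ n, ε n ≤ 1 := fun n => by
    simp only [hε]; rw [div_le_one (by positivity)]; linarith [(Nat.cast_nonneg n : (0 : ℝ) ≤ n)]
  have hεlim : Tendsto ε atTop (𝓝[>] 0) :=
    tendsto_nhdsWithin_iff.2 ⟨tendsto_one_div_add_atTop_nhds_zero_nat,
      Eventually.of_forall hεpos⟩
  -- The mollified q is smooth and periodic, so Q_n ψ may be used in the equation for p. The product
  -- rule gives Q_n a·∇ψ + ψ a·∇Q_n, and the second term tends to zero by the commutator estimate.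
  obtain ⟨Q, hQ⟩ : ∃ Q : ℕ → E N × ℝ → ℝ, Q = fun n => mollify volume (ε n) (periodicExt L q) := ⟨_, rfl⟩
  have hQs : ∀ n, ContDiff ℝ ∞ (Q n) := fun n => by
    rw [hQ]; exact contDiff_mollify volume (hεpos n) hqli
  have hQd : ∀ n, Differentiable ℝ (Q n) := fun n => (hQs n).differentiable (by simp)
  have hQp : ∀ n (y : E N) (ξ : ℝ) (i : Fin N),
      Q n (y + EuclideanSpace.single i (L i), ξ) = Q n (y, ξ) := by
    intro n y ξ i
    simp only [hQ, mollify_apply]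
    refine integral_congr_ae (Eventually.of_forall fun t => ?_)
    simp only
    congr 1
    rw [← periodicExt_add_single hL q ((y, ξ) - t) i]
    congr 1
    simp [Prod.ext_iff]
    abel
  have hQc : ∀ n w, |Q n w| ≤ c := fun n w => by
    rw [hQ]; exact abs_mollify_le volume (hεpos n) hqec w
  have hQψ : ∀ n, IsTestYXi L fun w => Q n w * ψ w := fun n =>
    ⟨(hQs n).mul hψ.smooth, fun y ξ i => by rw [hQp, hψ.periodic], by
      obtain ⟨R, hR⟩ := hψ.support
      exact ⟨R, fun y ξ hne => hR y ξ (right_ne_zero_of_mul hne)⟩⟩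
  set m := (volume : Measure (E N × ℝ)).real (Metric.closedBall 0 1) with hm
  have hm0 : 0 ≤ m := measureReal_nonneg
  have havg : ∀ n w, |⨍ v in Metric.closedBall w (ε n), ‖periodicExt L q v - periodicExt L q w‖| ≤ c + c := by
    intro n w
    refine setAverage_norm_le (isCompact_closedBall _ _).measure_lt_top (by linarith) fun v => ?_
    rw [abs_norm]
    exact (norm_sub_le _ _).trans (add_le_add (hqec _) (hqec _))
  have hr : ∀ n (w : E N × ℝ), w.1 ∈ cell L → |w.2| ≤ R → |fderiv ℝ (Q n) w (kinField A w)| ≤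
      Cρ * K * m * ⨍ v in Metric.closedBall w (ε n), ‖periodicExt L q v - periodicExt L q w‖ := by
    intro n w hw hwR
    rw [hQ]
    exact abs_fderiv_mollify_le volume (fun ε hε v => (hCρ ε hε v).2) (continuous_kinField hA) hqs
      hqec hqe (isWeakDivFree_one hA) (hεpos n) hK0
      fun t ht => hK w hw hwR t (ht.trans (hεle n))
  have hrb : ∀ n (w : E N × ℝ), w.1 ∈ cell L → |w.2| ≤ R →
      |fderiv ℝ (Q n) w (kinField A w)| ≤ Cρ * K * m * (c + c) := fun n w hw hwR =>
    (hr n w hw hwR).trans (mul_le_mul_of_nonneg_left ((le_abs_self _).trans (havg n w))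
      (by positivity))
  -- Lebesgue points of the periodic extension: there the averages controlling both Q_n - q and
  -- a·∇Q_n tend to zero.
  have hleb : ∀ᵐ w ∂(measYXi L), Tendsto
      (fun n => ⨍ v in Metric.closedBall w (ε n), ‖periodicExt L q v - periodicExt L q w‖) atTop (𝓝 0) := by
    rw [measYXi_eq]
    refine ae_restrict_of_ae ?_
    filter_upwards [IsUnifLocDoublingMeasure.ae_tendsto_average_norm_sub volume hqli 1] with w hw
    exact hw (fun _ => w) ε hεlim (Eventually.of_forall fun n =>
      Metric.mem_closedBall_self (by rw [one_mul]; exact (hεpos n).le))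
  have hfψ : ∀ n w, fderiv ℝ (fun y' => Q n (y', w.2) * ψ (y', w.2)) w.1 (velocity A w.1 w.2) =
      Q n w * fderiv ℝ ψ w (kinField A w) + ψ w * fderiv ℝ (Q n) w (kinField A w) := by
    intro n w
    rw [fderiv_fst_kinField (ψ := fun w => Q n w * ψ w) (hQψ n).differentiable]
    have h1 : HasFDerivAt (fun w => Q n w * ψ w) (Q n w • fderiv ℝ ψ w + ψ w • fderiv ℝ (Q n) w) w :=
      (hQd n w).hasFDerivAt.mul (hψ.differentiable w).hasFDerivAt
    rw [h1.fderiv]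
    simp
  have hbound : MemLp ((slab L R).indicator fun _ => c * (c * (Cψ * V) + Cψ * (Cρ * K * m * (c + c))))
      1 (measYXi L) := by
    have hbm : MeasurableSet (slab L R) := (isCompact_slab L _).isClosed.measurableSet
    refine memLp_of_eq_zero_off_compact ((measurable_const.indicator hbm).aestronglyMeasurable)
      (isCompact_slab L R) (C := |c * (c * (Cψ * V) + Cψ * (Cρ * K * m * (c + c)))|)
      (fun w hw => ?_) (Eventually.of_forall fun w hw => ?_) 1
    · rw [indicator_of_mem hw]
    · rw [indicator_of_notMem hw]
  have key : Tendsto (fun n => ∫ w, p w * fderiv ℝ (fun y' => Q n (y', w.2) * ψ (y', w.2)) w.1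
      (velocity A w.1 w.2) ∂(measYXi L)) atTop (𝓝 (∫ w, p w * q w * fderiv ℝ (fun y' => ψ (y', w.2))
        w.1 (velocity A w.1 w.2) ∂(measYXi L))) := by
    refine tendsto_integral_of_dominated_convergence _ (fun n => ?_) (memLp_one_iff_integrable.1 hbound)
      (fun n => ?_) ?_
    · exact hpm.aestronglyMeasurable.mul ((hQψ n).memLp_transport hA 1).1
    · filter_upwards [ae_fst_mem_cell L] with w hw
      rw [hfψ]
      by_cases hwR : |w.2| ≤ R
      · have hs : w ∈ slab L R := ⟨cell_subset_closedCell hw, abs_le.1 hwR⟩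
        rw [indicator_of_mem hs, norm_mul]
        have h1 : |fderiv ℝ ψ w (kinField A w)| ≤ Cψ * V := by
          refine ((fderiv ℝ ψ w).le_opNorm _).trans (mul_le_mul (hCψ' w hw) ?_ (norm_nonneg _) hCψ0)
          rw [kinField, Prod.norm_def]
          simpa [hV0] using hV w hw hwR
        have h2 : |Q n w * fderiv ℝ ψ w (kinField A w) +
            ψ w * fderiv ℝ (Q n) w (kinField A w)| ≤
            c * (Cψ * V) + Cψ * (Cρ * K * m * (c + c)) := by
          refine (abs_add_le _ _).trans ?_
          rw [abs_mul, abs_mul]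
          exact add_le_add (mul_le_mul (hQc n w) h1 (abs_nonneg _) hc0)
            (mul_le_mul (hCψ w hw) (hrb n w hw hwR) (abs_nonneg _) hCψ0)
        exact mul_le_mul (hpc w) h2 (abs_nonneg _) hc0
      · rw [hR w (not_le.1 hwR), fderiv_eq_zero_of_slab hR (not_le.1 hwR)]
        simp only [_root_.zero_apply, mul_zero, zero_mul, add_zero, norm_zero]
        refine indicator_nonneg (fun _ _ => by positivity) _
    · filter_upwards [ae_fst_mem_cell L, hleb] with w hw hl
      simp_rw [hfψ]
      rw [fderiv_fst_kinField hψ.differentiable, mul_assoc]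
      refine Tendsto.const_mul _ ?_
      by_cases hwR : |w.2| ≤ R
      · have hq0 : Tendsto (fun n => Q n w) atTop (𝓝 (q w)) := by
          rw [tendsto_iff_norm_sub_tendsto_zero]
          refine squeeze_zero (fun _ => norm_nonneg _) (fun n => ?_)
            (by simpa using hl.const_mul (Cρ * m))
          rw [← periodicExt_of_mem hL (q := q) hw, hQ]
          exact abs_mollify_sub_le volume (fun ε hε v => (hCρ ε hε v).1) hqs hqec (hεpos n) w
        have hr0 : Tendsto (fun n => fderiv ℝ (Q n) w (kinField A w)) atTop (𝓝 0) := by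
          rw [tendsto_zero_iff_norm_tendsto_zero]
          exact squeeze_zero (fun _ => norm_nonneg _) (fun n => hr n w hw hwR)
            (by simpa using hl.const_mul (Cρ * K * m))
        simpa using (hq0.mul_const (fderiv ℝ ψ w (kinField A w))).add (hr0.const_mul (ψ w))
      · rw [hR w (not_le.1 hwR), fderiv_eq_zero_of_slab hR (not_le.1 hwR)]
        simp
  have hz : ∀ n, ∫ w, p w * fderiv ℝ (fun y' => Q n (y', w.2) * ψ (y', w.2)) w.1
      (velocity A w.1 w.2) ∂(measYXi L) = 0 := fun n => hp _ (hQψ n)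
  simp_rw [hz] at key
  exact (tendsto_nhds_unique key tendsto_const_nhds)

theorem IsDivFree.comb (hA : IsDivFreeFlux L A) {p q : E N × ℝ → ℝ}
    (hp : IsDivFree L A p) (hq : IsDivFree L A q) (hpm : Measurable p) (hqm : Measurable q)
    {c : ℝ} (hpc : ∀ w, |p w| ≤ c) (hqc : ∀ w, |q w| ≤ c) (r s : ℝ) :
    IsDivFree L A fun w => r * p w + s * q w := by
  intro ψ hψ
  have hi := memLp_one_iff_integrable.1 (hψ.memLp_transport hA 1)
  have hmul : ∀ {p : E N × ℝ → ℝ}, Measurable p → (∀ w, |p w| ≤ c) →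
      Integrable (fun w => p w * fderiv ℝ (fun y' => ψ (y', w.2)) w.1 (velocity A w.1 w.2))
        (measYXi L) := fun hm hc =>
    hi.bdd_mul hm.aestronglyMeasurable (Eventually.of_forall hc)
  have := integral_add ((hmul hpm hpc).const_mul r) ((hmul hqm hqc).const_mul s)
  rw [integral_const_mul, integral_const_mul, hp ψ hψ, hq ψ hψ] at this
  simp only [mul_zero, add_zero] at this
  rw [← this]
  refine integral_congr_ae (Eventually.of_forall fun w => ?_)
  simp only
  ring

end Flux

/-! ### Polynomial approximation of the sign -/

section Sharpening

/-- An odd cubic whose iterates sharpen to the sign function on `[-1, 1]`. -/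
def cubic (s : ℝ) : ℝ := s * (3 - s ^ 2) / 2

theorem cubic_neg (s : ℝ) : cubic (-s) = -cubic s := by unfold cubic; ring

theorem cubic_zero : cubic 0 = 0 := by simp [cubic]

theorem cubic_sub_mem {s t : ℝ} (hs : 0 ≤ s) (hst : s ≤ t) (ht : t ≤ 1) :
    0 ≤ cubic t - cubic s ∧ cubic t - cubic s ≤ 3 / 2 * (t - s) := by
  have e : cubic t - cubic s = (t - s) * ((3 - t ^ 2 - t * s - s ^ 2) / 2) := by
    unfold cubic; ring
  have h1 : t ^ 2 ≤ 1 := by nlinarith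
  have h2 : t * s ≤ 1 := by nlinarith
  have h3 : s ^ 2 ≤ 1 := by nlinarith
  have h4 : 0 ≤ t * s := mul_nonneg (hs.trans hst) hs
  rw [e]
  refine ⟨mul_nonneg (by linarith) (by linarith), ?_⟩
  rw [mul_comm]
  exact mul_le_mul_of_nonneg_right (by nlinarith [sq_nonneg t, sq_nonneg s]) (by linarith)

theorem cubic_mem {s : ℝ} (hs : s ∈ Icc (0 : ℝ) 1) : cubic s ∈ Icc s 1 := by
  obtain ⟨h0, h1⟩ := hs
  have e1 : cubic s - s = s * (1 - s) * (1 + s) / 2 := by unfold cubic; ring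
  have e2 : 1 - cubic s = (1 - s) ^ 2 * (2 + s) / 2 := by unfold cubic; ring
  have p1 : 0 ≤ s * (1 - s) * (1 + s) / 2 := by
    have : 0 ≤ 1 - s := by linarith
    positivity
  have p2 : 0 ≤ (1 - s) ^ 2 * (2 + s) / 2 := by positivity
  exact ⟨by linarith, by linarith⟩

/-- The distance to 1 shrinks by a fixed factor as long as s stays above s₀, and iterates of the
cubic do, since it lies above the identity on [0, 1]. Convergence to 1 is thus geometric. -/
theorem one_sub_cubic_le {s₀ s : ℝ} (hs : s₀ ≤ s) (h1 : s ≤ 1) :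
    1 - cubic s ≤ (1 - s) * (1 - s₀ / 2) := by
  have e : 1 - cubic s = (1 - s) * (1 - s / 2 - s ^ 2 / 2) := by unfold cubic; ring
  rw [e]
  exact mul_le_mul_of_nonneg_left (by nlinarith [sq_nonneg s]) (by linarith)

/-- Iterates of the cubic. -/
def sharpen (n : ℕ) : ℝ → ℝ := cubic^[n]

theorem sharpen_succ (n : ℕ) (s : ℝ) : sharpen (n + 1) s = cubic (sharpen n s) :=
  Function.iterate_succ_apply' _ _ _

theorem continuous_sharpen (n : ℕ) : Continuous (sharpen n) :=
  Continuous.iterate (by unfold cubic; fun_prop) n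

theorem sharpen_neg (n : ℕ) (s : ℝ) : sharpen n (-s) = -sharpen n s := by
  induction n with
  | zero => rfl
  | succ n ih => rw [sharpen_succ, sharpen_succ, ih, cubic_neg]

theorem sharpen_zero (n : ℕ) : sharpen n 0 = 0 := by
  induction n with
  | zero => rfl
  | succ n ih => rw [sharpen_succ, ih, cubic_zero]

theorem sharpen_mem (n : ℕ) {s : ℝ} (hs : s ∈ Icc (0 : ℝ) 1) : sharpen n s ∈ Icc s 1 := by
  induction n with
  | zero => exact ⟨le_rfl, hs.2⟩
  | succ n ih =>
    rw [sharpen_succ]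
    have := cubic_mem ⟨hs.1.trans ih.1, ih.2⟩
    exact ⟨ih.1.trans this.1, this.2⟩

/-- The slope bound (3/2)^n decides how large a multiple of the n-th iterate may be subtracted from
the identity without destroying monotonicity, namely (2/3)^n. -/
theorem sharpen_sub_mem (n : ℕ) {s t : ℝ} (hs : 0 ≤ s) (hst : s ≤ t) (ht : t ≤ 1) :
    0 ≤ sharpen n t - sharpen n s ∧ sharpen n t - sharpen n s ≤ (3 / 2) ^ n * (t - s) := by
  induction n with
  | zero => exact ⟨by simpa [sharpen] using hst, by simp [sharpen]⟩
  | succ n ih =>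
    rw [sharpen_succ, sharpen_succ]
    have h1 := sharpen_mem n (s := s) ⟨hs, hst.trans ht⟩
    have h2 := sharpen_mem n (s := t) ⟨hs.trans hst, ht⟩
    have h3 := cubic_sub_mem (hs.trans h1.1) (sub_nonneg.1 ih.1) h2.2
    refine ⟨h3.1, h3.2.trans ?_⟩
    rw [pow_succ']
    linarith [ih.2]

theorem abs_sharpen_le (n : ℕ) {s : ℝ} (hs : |s| ≤ 1) : |sharpen n s| ≤ 1 := by
  rcases le_total 0 s with h | h
  · have := sharpen_mem n ⟨h, (le_abs_self s).trans hs⟩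
    rw [abs_of_nonneg (h.trans this.1)]
    exact this.2
  · have := sharpen_mem n (s := -s) ⟨by linarith, (neg_le_abs s).trans hs⟩
    rw [sharpen_neg] at this
    rw [abs_of_nonpos (by linarith [this.1])]
    exact this.2

theorem tendsto_sharpen {s : ℝ} (h0 : 0 < s) (h1 : s ≤ 1) :
    Tendsto (fun n => sharpen n s) atTop (𝓝 1) := by
  have hle : ∀ n, 1 - sharpen n s ≤ (1 - s / 2) ^ n := by
    intro n
    induction n with
    | zero => simp [sharpen]; linarith
    | succ n ih =>
      have hm := sharpen_mem n (s := s) ⟨h0.le, h1⟩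
      rw [sharpen_succ, pow_succ]
      exact (one_sub_cubic_le hm.1 hm.2).trans
        (mul_le_mul_of_nonneg_right ih (by linarith))
  have hpow : Tendsto (fun n => (1 - s / 2) ^ n) atTop (𝓝 0) :=
    tendsto_pow_atTop_nhds_zero_of_lt_one (by linarith) (by linarith)
  refine tendsto_of_tendsto_of_tendsto_of_le_of_le (g := fun n => 1 - (1 - s / 2) ^ n)
    (h := fun _ => 1) (by simpa using hpow.const_sub 1) tendsto_const_nhds
    (fun n => ?_) fun n => (sharpen_mem n ⟨h0.le, h1⟩).2
  simp only
  linarith [hle n]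

theorem tendsto_mul_sharpen {s : ℝ} (hs : |s| ≤ 1) :
    Tendsto (fun n => s * sharpen n s) atTop (𝓝 |s|) := by
  rcases lt_trichotomy s 0 with h | h | h
  · have := (tendsto_sharpen (s := -s) (by linarith) ((neg_le_abs s).trans hs)).const_mul (-s)
    simp_rw [sharpen_neg, neg_mul_neg, mul_one] at this
    rwa [abs_of_neg h]
  · subst h; simp
  · have := (tendsto_sharpen h ((le_abs_self s).trans hs)).const_mul s
    rw [mul_one] at this
    rwa [abs_of_pos h]

end Sharpening

/-! ### The projection does not increase the L¹ norm -/

section L1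

variable {N : ℕ} {L : Fin N → ℝ} {A : E N × ℝ → E N} {M : ℝ}

theorem IsDivFree.congr {p q : E N × ℝ → ℝ} (hp : IsDivFree L A p) (h : p =ᵐ[measYXi L] q) :
    IsDivFree L A q := by
  intro ψ hψ
  rw [← hp ψ hψ]
  refine integral_congr_ae ?_
  filter_upwards [h] with w hw
  rw [hw]

theorem KinMono.congr {p q : E N × ℝ → ℝ} (hp : KinMono L p) (h : p =ᵐ[measYXi L] q) :
    KinMono L q := by
  intro s hs
  filter_upwards [hp s hs, h, (measurePreserving_shift L s).quasiMeasurePreserving.ae h]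
    with w h1 h2 h3
  rwa [← h2, ← h3]

/-- The cubic uses only products and linear combinations, so the algebra property suffices and no
general chain rule is required; the bound |p| ≤ 1 persists along the iteration. -/
theorem IsDivFree.sharpen (hL : ∀ i, 0 < L i) (hA : IsDivFreeFlux L A) {p : E N × ℝ → ℝ}
    (hp : IsDivFree L A p) (hpm : Measurable p) (hpc : ∀ w, |p w| ≤ 1) (n : ℕ) :
    IsDivFree L A fun w => sharpen n (p w) := by
  induction n with
  | zero => exact hp
  | succ n ih =>
    have hm := (continuous_sharpen n).measurable.comp hpm
    have hc : ∀ w, |_root_.sharpen n (p w)| ≤ 1 := fun w => abs_sharpen_le n (hpc w)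
    have hc2 : ∀ w, |_root_.sharpen n (p w) * _root_.sharpen n (p w)| ≤ 1 := fun w => by
      rw [abs_mul]; exact mul_le_one₀ (hc w) (abs_nonneg _) (hc w)
    have hc3 : ∀ w, |_root_.sharpen n (p w) * _root_.sharpen n (p w) *
        _root_.sharpen n (p w)| ≤ 1 := fun w => by
      rw [abs_mul]; exact mul_le_one₀ (hc2 w) (abs_nonneg _) (hc w)
    have h2 := ih.mul hL hA ih hm hm hc hc
    have h3 := h2.mul hL hA ih (hm.mul hm) hm hc2 hc
    have := ih.comb hA h3 hm ((hm.mul hm).mul hm) hc hc3 (3 / 2) (-1 / 2)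
    convert this using 2 with w
    rw [sharpen_succ, cubic]
    ring

/-- The projection onto the constraint set does not increase the `L¹` norm. -/
theorem lintegral_metricProj_le (hL : ∀ i, 0 < L i) (hA : IsDivFreeFlux L A) (hM : 0 ≤ M)
    (f : L2YXi L) :
    ∫⁻ w, ‖metricProj (constraintSet L A M) f w‖ₑ ∂(measYXi L) ≤ ∫⁻ w, ‖f w‖ₑ ∂(measYXi L) := by
  have h0 : (0 : L2YXi L) ∈ constraintSet L A M := zero_mem_constraintSet hL
  have hKc := isClosed_constraintSet (M := M) hL hA
  have hKx := convex_constraintSet (M := M) hL hA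
  have hpK := metricProj_mem ⟨0, h0⟩ hKc hKx f
  have hvar := fun k => inner_metricProj_le ⟨0, h0⟩ hKc hKx f (q := k)
  generalize metricProj (constraintSet L A M) f = p at *
  by_cases hf : ∫⁻ w, ‖f w‖ₑ ∂(measYXi L) = ⊤
  · rw [hf]; exact le_top
  have hfi : Integrable f (measYXi L) := ⟨(Lp.memLp f).1, lt_top_iff_ne_top.2 hf⟩
  have hpi : Integrable p (measYXi L) := integrable_of_slab (Lp.memLp p) hpK.1
  have hkm := kinMono_of_mem hL hpK
  have hsb := hkm.sign_bounds hM hpK.1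
  -- Truncation to [-1, 1] provides a representative that is measurable and bounded at every point,
  -- as the algebra lemmas demand.
  obtain ⟨p', hp'⟩ : ∃ p' : E N × ℝ → ℝ, p' = fun w => max (-1) (min 1 (p w)) := ⟨_, rfl⟩
  have hp'm : Measurable p' := by
    rw [hp']
    exact measurable_const.max (measurable_const.min (Lp.stronglyMeasurable p).measurable)
  have hp'1 : ∀ w, |p' w| ≤ 1 := fun w => by
    rw [hp']
    exact abs_le.2 ⟨le_max_left _ _, max_le (by norm_num) (min_le_left _ _)⟩
  have hae : p =ᵐ[measYXi L] p' := by
    filter_upwards [hsb] with w hw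
    rw [hp']
    have : -1 ≤ p w ∧ p w ≤ 1 := by
      rcases lt_or_ge 0 w.2 with h | h
      · exact ⟨by linarith [(hw.1 h).1], (hw.1 h).2⟩
      · exact ⟨(hw.2 h).1, by linarith [(hw.2 h).2]⟩
    simp [this.1, this.2]
  have hdiv : IsDivFree L A p' := hpK.2.1.congr hae
  have hγd := fun n => hdiv.sharpen hL hA hp'm hp'1 n
  have hγm : ∀ n, Measurable fun w => sharpen n (p' w) := fun n =>
    (continuous_sharpen n).measurable.comp hp'm
  have hγ1 : ∀ n w, |sharpen n (p' w)| ≤ 1 := fun n w => abs_sharpen_le n (hp'1 w)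
  have hγs : ∀ n, ∀ᵐ w ∂(measYXi L), M < |w.2| → sharpen n (p' w) = 0 := fun n => by
    filter_upwards [hpK.1, hae] with w h1 h2 h3
    rw [← h2, h1 h3, sharpen_zero]
  have hγ2 : ∀ n, MemLp (fun w => sharpen n (p' w)) 2 (measYXi L) := fun n =>
    memLp_of_bounded_slab (hγm n).aestronglyMeasurable (hγ1 n) (hγs n) 2
  have key : ∀ n, ∫ w, p w * sharpen n (p' w) ∂(measYXi L) ≤ ∫ w, |f w| ∂(measYXi L) := by
    intro n
    obtain ⟨g, hg⟩ : ∃ g : L2YXi L, g = (hγ2 n).toLp _ := ⟨_, rfl⟩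
    have hgae : g =ᵐ[measYXi L] fun w => sharpen n (p' w) := by
      rw [hg]; exact (hγ2 n).coeFn_toLp
    have hpos : (0 : ℝ) < (2 / 3) ^ n := by positivity
    -- The map s ↦ s - (2/3)^n β_n(s) is odd, non-decreasing on [0, 1] and below the identity there,
    -- so it preserves the kinetic inequality.
    have hk : p - (2 / 3 : ℝ) ^ n • g ∈ constraintSet L A M := by
      have hkae : (p - (2 / 3 : ℝ) ^ n • g : L2YXi L) =ᵐ[measYXi L]
          fun w => p' w - (2 / 3) ^ n * sharpen n (p' w) := by
        filter_upwards [Lp.coeFn_sub p ((2 / 3 : ℝ) ^ n • g), Lp.coeFn_smul ((2 / 3 : ℝ) ^ n) g,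
          hgae, hae] with w h1 h2 h3 h4
        rw [h1, Pi.sub_apply, h2, Pi.smul_apply, h3, h4, smul_eq_mul]
      have hsupp : ∀ᵐ w ∂(measYXi L), M < |w.2| → (p - (2 / 3 : ℝ) ^ n • g : L2YXi L) w = 0 := by
        filter_upwards [hkae, hγs n, hpK.1, hae] with w h1 h2 h3 h4 h5
        rw [h1, h2 h5, ← h4, h3 h5, mul_zero, sub_zero]
      have hmono : KinMono L (p - (2 / 3 : ℝ) ^ n • g : L2YXi L) := by
        have := hkm.comp hsb (β := fun s => s - (2 / 3) ^ n * sharpen n s)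
          (fun s => by rw [sharpen_neg]; ring) ?_ (by simp [sharpen_zero]) ?_
        · refine this.congr ?_
          filter_upwards [hkae, hae] with w h1 h2
          rw [h1, ← h2]
        · intro s hs t ht hst
          have := (sharpen_sub_mem n hs.1 hst ht.2).2
          have h2 := mul_le_mul_of_nonneg_left this hpos.le
          rw [← mul_assoc, ← mul_pow] at h2
          norm_num at h2
          simp only
          linarith
        · intro s hs
          have := (sharpen_mem n hs).1
          have := mul_nonneg hpos.le (hs.1.trans this)
          linarith
      refine ⟨hsupp, ?_, hmono.hasKineticDerivative hL (Lp.memLp _) hsupp⟩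
      have := hdiv.comb hA (hγd n) hp'm (hγm n) hp'1 (hγ1 n) 1 (-(2 / 3) ^ n)
      refine this.congr ?_
      filter_upwards [hkae] with w hw
      rw [hw]
      ring
    have h1 := hvar _ hk
    rw [sub_sub_cancel_left, inner_neg_right, inner_smul_right, neg_nonpos] at h1
    -- The competitor differs from p by a negative multiple of g = β_n(p), so the variational
    -- inequality says ⟨f - p, g⟩ ≥ 0.
    have h2 : 0 ≤ inner ℝ (f - p) g := (mul_nonneg_iff_of_pos_left hpos).1 h1
    rw [inner_sub_left, hg, inner_toLp_eq, inner_toLp_eq] at h2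
    refine (sub_nonneg.1 h2).trans (integral_mono (integrable_Lp_mul f (hγ2 n)) hfi.abs fun w => ?_)
    refine (le_abs_self _).trans ?_
    rw [abs_mul]
    exact mul_le_of_le_one_right (abs_nonneg _) (hγ1 n w)
  have hlim : Tendsto (fun n => ∫ w, p w * sharpen n (p' w) ∂(measYXi L)) atTop
      (𝓝 (∫ w, |p w| ∂(measYXi L))) := by
    refine tendsto_integral_of_dominated_convergence (fun w => |p w|)
      (fun n => hpi.1.mul (hγm n).aestronglyMeasurable) hpi.abs (fun n => ?_) ?_
    · refine Eventually.of_forall fun w => ?_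
      rw [norm_mul]
      exact mul_le_of_le_one_right (norm_nonneg _) (hγ1 n w)
    · filter_upwards [hae] with w hw
      rw [hw]
      exact tendsto_mul_sharpen (hp'1 w)
  have hfin := le_of_tendsto' hlim key
  rw [← ofReal_integral_norm_eq_lintegral_enorm hpi, ← ofReal_integral_norm_eq_lintegral_enorm hfi]
  exact ENNReal.ofReal_le_ofReal hfin

theorem coeFn_slice_sliceProj (hL : ∀ i, 0 < L i) (hA : IsDivFreeFlux L A) (F : L2XYXi L) :
    ∀ᵐ x : E N, (fun w => sliceProj (constraintSet L A M) F (x, w)) =ᵐ[measYXi L]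
      (metricProj (constraintSet L A M) (slice F x) : L2YXi L) := by
  have h := isSliceProj_sliceProj (K := constraintSet L A M) (zero_mem_constraintSet hL)
    (isClosed_constraintSet hL hA) (convex_constraintSet hL hA) F
  filter_upwards [h, coeFn_slice (sliceProj (constraintSet L A M) F)] with x h1 h2
  rw [← h1]
  exact h2.symm

/-- Tonelli reduces the claim to slices. Norms are taken in [0, ∞], so slices that are not
integrable need no separate treatment. -/
theorem eLpNorm_sliceProj_le (hL : ∀ i, 0 < L i) (hA : IsDivFreeFlux L A) (hM : 0 ≤ M)
    (F : L2XYXi L) :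
    eLpNorm (sliceProj (constraintSet L A M) F) 1 (measXYXi L) ≤ eLpNorm F 1 (measXYXi L) := by
  have e : ∀ G : L2XYXi L, ∫⁻ z, ‖G z‖ₑ ∂(measXYXi L) =
      ∫⁻ x : E N, ∫⁻ w, ‖G (x, w)‖ₑ ∂(measYXi L) := fun G =>
    lintegral_prod (fun z => ‖G z‖ₑ) (Lp.aestronglyMeasurable G).enorm
  rw [eLpNorm_one_eq_lintegral_enorm, eLpNorm_one_eq_lintegral_enorm, e, e]
  refine lintegral_mono_ae ?_
  filter_upwards [coeFn_slice_sliceProj (M := M) hL hA F, coeFn_slice F] with x h1 h2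
  have e1 := lintegral_congr_ae (h1.fun_comp fun s => ‖s‖ₑ)
  have e2 := lintegral_congr_ae (h2.fun_comp fun s => ‖s‖ₑ)
  exact (e1.le.trans (lintegral_metricProj_le hL hA hM _)).trans e2.le

end L1

/-! ### Closed convex sets preserved by the evolution -/

section InvariantSets

variable {X : Type*} [MeasurableSpace X] {μ : Measure X}

theorem isClosed_ae_mem {C : X → Set ℝ} (hC : ∀ x, IsClosed (C x)) :
    IsClosed {F : Lp ℝ 2 μ | ∀ᵐ x ∂μ, F x ∈ C x} := by
  refine IsSeqClosed.isClosed fun u F hu hF => ?_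
  obtain ⟨ns, -, hns⟩ := (tendstoInMeasure_of_tendsto_Lp hF).exists_seq_tendsto_ae
  filter_upwards [hns, ae_all_iff.2 fun n => hu (ns n)] with x h1 h2
  exact (hC x).mem_of_tendsto h1 (Eventually.of_forall h2)

theorem convex_ae_mem {C : X → Set ℝ} (hC : ∀ x, Convex ℝ (C x)) :
    Convex ℝ {F : Lp ℝ 2 μ | ∀ᵐ x ∂μ, F x ∈ C x} := by
  intro F hF G hG a b ha hb hab
  filter_upwards [hF, hG, Lp.coeFn_add (a • F) (b • G), Lp.coeFn_smul a F, Lp.coeFn_smul b G]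
    with x h1 h2 h3 h4 h5
  rw [h3, Pi.add_apply, h4, h5]
  exact hC x h1 h2 ha hb hab

/-- Fatou's lemma along an almost everywhere convergent subsequence. -/
theorem isClosed_eLpNorm_one_le (c : ℝ≥0∞) :
    IsClosed {F : Lp ℝ 2 μ | eLpNorm F 1 μ ≤ c} := by
  refine IsSeqClosed.isClosed fun u F hu hF => ?_
  obtain ⟨ns, -, hns⟩ := (tendstoInMeasure_of_tendsto_Lp hF).exists_seq_tendsto_ae
  refine (Lp.eLpNorm_lim_le_liminf_eLpNorm (fun n => Lp.aestronglyMeasurable (u (ns n))) F hns).trans ?_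
  exact liminf_le_of_frequently_le' (Frequently.of_forall fun n => hu (ns n))

theorem convex_eLpNorm_one_le (c : ℝ≥0∞) : Convex ℝ {F : Lp ℝ 2 μ | eLpNorm F 1 μ ≤ c} := by
  intro F hF G hG a b ha hb hab
  rw [mem_ofPred_eq] at hF hG ⊢
  have e : (a • F + b • G : Lp ℝ 2 μ) =ᵐ[μ] a • (F : X → ℝ) + b • (G : X → ℝ) :=
    (Lp.coeFn_add _ _).trans ((Lp.coeFn_smul a F).add (Lp.coeFn_smul b G))
  rw [eLpNorm_congr_ae e]
  refine (eLpNorm_add_le ((Lp.aestronglyMeasurable F).const_smul a)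
    ((Lp.aestronglyMeasurable G).const_smul b) le_rfl).trans ?_
  rw [eLpNorm_const_smul, eLpNorm_const_smul, Real.enorm_of_nonneg ha, Real.enorm_of_nonneg hb]
  calc _ ≤ ENNReal.ofReal a * c + ENNReal.ofReal b * c :=
        add_le_add (mul_le_mul_right hF _) (mul_le_mul_right hG _)
    _ = c := by
      rw [← add_mul, ← ENNReal.ofReal_add ha hb, hab, ENNReal.ofReal_one, one_mul]

variable {N : ℕ} {L : Fin N → ℝ} {A : E N × ℝ → E N} {M : ℝ}

/-- The values admitted at `ξ` for kinetic functions supported in `|ξ| ≤ M`. -/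
def kinInterval (M ξ : ℝ) : Set ℝ :=
  Icc (if |ξ| ≤ M ∧ ξ ≤ 0 then -1 else 0) (if |ξ| ≤ M ∧ 0 < ξ then 1 else 0)

theorem mem_kinInterval_iff {M ξ s : ℝ} : s ∈ kinInterval M ξ ↔
    (M < |ξ| → s = 0) ∧ (0 < ξ → 0 ≤ s ∧ s ≤ 1) ∧ (ξ ≤ 0 → -1 ≤ s ∧ s ≤ 0) := by
  unfold kinInterval
  rw [mem_Icc]
  by_cases h1 : |ξ| ≤ M <;> by_cases h2 : 0 < ξ
  · simp [h1, h2, not_lt.2 h1, not_le.2 h2]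
  · simp [h1, h2, not_lt.2 h1, not_lt.1 h2]
  · simp only [h1, h2, false_and, if_false, not_le.1 h1, not_le.2 h2, true_imp_iff,
      false_imp_iff, and_true]
    constructor
    · rintro ⟨h3, h4⟩
      exact ⟨le_antisymm h4 h3, h3, by linarith⟩
    · rintro ⟨rfl, -, -⟩
      exact ⟨le_rfl, le_rfl⟩
  · simp only [h1, h2, false_and, if_false, not_le.1 h1, not_lt.1 h2, true_imp_iff,
      false_imp_iff, true_and]
    constructor
    · rintro ⟨h3, h4⟩
      exact ⟨le_antisymm h4 h3, by linarith, h4⟩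
    · rintro ⟨rfl, -, -⟩
      exact ⟨le_rfl, le_rfl⟩

/-- The kinetic functions supported in `|ξ| ≤ M` with `L¹` norm at most `c`. -/
def kinSet (L : Fin N → ℝ) (M : ℝ) (c : ℝ≥0∞) : Set (L2XYXi L) :=
  {F | ∀ᵐ z ∂(measXYXi L), F z ∈ kinInterval M z.2.2} ∩ {F | eLpNorm F 1 (measXYXi L) ≤ c}

theorem isClosed_kinSet (c : ℝ≥0∞) : IsClosed (kinSet L M c) :=
  (isClosed_ae_mem fun _ => isClosed_Icc).inter (isClosed_eLpNorm_one_le c)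

theorem convex_kinSet (c : ℝ≥0∞) : Convex ℝ (kinSet L M c) :=
  (convex_ae_mem fun _ => convex_Icc _ _).inter (convex_eLpNorm_one_le c)

theorem transport_mem_kinSet (hA : IsDivFreeFlux L A) {c : ℝ≥0∞} (t : ℝ) {F : L2XYXi L}
    (hF : F ∈ kinSet L M c) : transport hA t F ∈ kinSet L M c := by
  have hm := measurePreserving_flowMap hA t
  refine ⟨?_, ?_⟩
  · filter_upwards [coeFn_transport hA t F, hm.quasiMeasurePreserving.ae hF.1] with z h1 h2
    rw [h1]
    exact h2
  · rw [mem_ofPred_eq, eLpNorm_congr_ae (coeFn_transport hA t F)]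
    exact (eLpNorm_comp_measurePreserving (Lp.aestronglyMeasurable F) hm).trans_le hF.2

theorem sliceProj_mem_kinSet (hL : ∀ i, 0 < L i) (hA : IsDivFreeFlux L A) (hM : 0 ≤ M)
    {c : ℝ≥0∞} {F : L2XYXi L} (hF : F ∈ kinSet L M c) :
    sliceProj (constraintSet L A M) F ∈ kinSet L M c := by
  refine ⟨?_, (eLpNorm_sliceProj_le hL hA hM F).trans hF.2⟩
  -- Bounds known for almost every slice give a bound almost everywhere in the product only for a
  -- measurable set of good points.
  have hms : MeasurableSet {z : E N × E N × ℝ |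
      sliceProj (constraintSet L A M) F z ∈ kinInterval M z.2.2} := by
    have hG := (Lp.stronglyMeasurable (sliceProj (constraintSet L A M) F)).measurable
    have hξ : Measurable fun z : E N × E N × ℝ => z.2.2 := by fun_prop
    have h1 : MeasurableSet {z : E N × E N × ℝ | |z.2.2| ≤ M ∧ z.2.2 ≤ 0} :=
      (measurableSet_le hξ.abs measurable_const).inter (measurableSet_le hξ measurable_const)
    have h2 : MeasurableSet {z : E N × E N × ℝ | |z.2.2| ≤ M ∧ 0 < z.2.2} :=
      (measurableSet_le hξ.abs measurable_const).inter (measurableSet_lt measurable_const hξ)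
    exact (measurableSet_le (Measurable.ite h1 measurable_const measurable_const) hG).inter
      (measurableSet_le hG (Measurable.ite h2 measurable_const measurable_const))
  refine (Measure.ae_prod_mem_iff_ae_ae_mem hms).2 ?_
  filter_upwards [coeFn_slice_sliceProj (M := M) hL hA F] with x hx
  have hK := metricProj_mem ⟨0, zero_mem_constraintSet (A := A) (M := M) hL⟩
    (isClosed_constraintSet hL hA) (convex_constraintSet hL hA) (slice F x)
  have hsb := (kinMono_of_mem hL hK).sign_bounds hM hK.1
  filter_upwards [hx, hsb, hK.1] with w h1 h2 h3
  rw [h1, mem_kinInterval_iff]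
  exact ⟨h3, h2⟩

theorem sliceProj_zero (hL : ∀ i, 0 < L i) (hA : IsDivFreeFlux L A) :
    sliceProj (constraintSet L A M) 0 = 0 :=
  metricProj_of_mem ⟨0, zero_mem_sliceSet (zero_mem_constraintSet hL)⟩
    (isClosed_sliceSet (isClosed_constraintSet hL hA))
    (convex_sliceSet (convex_constraintSet hL hA)) (zero_mem_sliceSet (zero_mem_constraintSet hL))

end InvariantSets

/-! ### The kinetic function χ and the initial datum -/

section InitialDatum

variable {N : ℕ} {L : Fin N → ℝ} {u₀ : E N × E N → ℝ}

theorem abs_chi_eq (ξ u : ℝ) : |chi ξ u| = (Ioo (min 0 u) (max 0 u)).indicator (fun _ => 1) ξ := by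
  rcases le_total 0 u with h | h
  · rw [min_eq_left h, max_eq_right h, chi, if_neg fun hc : u < ξ ∧ ξ < 0 => by linarith [hc.1, hc.2],
      sub_zero]
    by_cases hξ : 0 < ξ ∧ ξ < u
    · rw [if_pos hξ, indicator_of_mem (mem_Ioo.2 hξ), abs_one]
    · rw [if_neg hξ, indicator_of_notMem (fun hc => hξ (mem_Ioo.1 hc)), abs_zero]
  · rw [min_eq_right h, max_eq_left h, chi, if_neg fun hc : 0 < ξ ∧ ξ < u => by linarith [hc.1, hc.2],
      zero_sub, abs_neg]
    by_cases hξ : u < ξ ∧ ξ < 0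
    · rw [if_pos hξ, indicator_of_mem (mem_Ioo.2 hξ), abs_one]
    · rw [if_neg hξ, indicator_of_notMem (fun hc => hξ (mem_Ioo.1 hc)), abs_zero]

theorem abs_chi_le (ξ u : ℝ) : |chi ξ u| ≤ 1 := by
  rw [abs_chi_eq]
  exact indicator_le_self' (fun _ _ => zero_le_one) _ |>.trans le_rfl

theorem chi_sq (ξ u : ℝ) : chi ξ u ^ 2 = |chi ξ u| := by
  rw [← sq_abs, abs_chi_eq, indicator_apply]
  split_ifs <;> norm_num

/-- |χ(·, u)| is the indicator of the interval between 0 and u. This is why the L¹ norm of f₀, and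
by χ² = |χ| also its squared L² norm, equals the L¹ norm of u₀. -/
theorem lintegral_chi (u : ℝ) : ∫⁻ ξ, ‖chi ξ u‖ₑ = ‖u‖ₑ := by
  have h : ∀ ξ, ‖chi ξ u‖ₑ = (Ioo (min 0 u) (max 0 u)).indicator (fun _ => (1 : ℝ≥0∞)) ξ := by
    intro ξ
    rw [← Real.enorm_abs, abs_chi_eq, indicator_apply, indicator_apply]
    split_ifs <;> simp
  simp_rw [h]
  rw [lintegral_indicator measurableSet_Ioo, lintegral_const, one_mul, Measure.restrict_apply_univ,
    Real.volume_Ioo, max_sub_min_eq_abs, sub_zero, ← Real.enorm_abs u, Real.enorm_of_nonneg (abs_nonneg u)]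

theorem measurable_chi : Measurable fun p : ℝ × ℝ => chi p.1 p.2 := by
  refine Measurable.sub (Measurable.ite ?_ measurable_const measurable_const)
    (Measurable.ite ?_ measurable_const measurable_const)
  · exact (measurableSet_lt measurable_const measurable_fst).inter
      (measurableSet_lt measurable_fst measurable_snd)
  · exact (measurableSet_lt measurable_snd measurable_fst).inter
      (measurableSet_lt measurable_fst measurable_const)

theorem chi_mem_kinInterval {M ξ u : ℝ} (hu : |u| ≤ M) : chi ξ u ∈ kinInterval M ξ := by
  obtain ⟨h1, h2⟩ := abs_le.1 hu
  rw [mem_kinInterval_iff]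
  unfold chi
  refine ⟨fun h => ?_, fun h => ?_, fun h => ?_⟩
  · rw [if_neg, if_neg, sub_zero]
    · rintro ⟨h3, h4⟩
      rw [abs_of_neg h4] at h; linarith
    · rintro ⟨h3, h4⟩
      rw [abs_of_pos h3] at h; linarith
  · rw [if_neg fun hc : u < ξ ∧ ξ < 0 => by linarith [hc.2], sub_zero]
    split_ifs <;> norm_num
  · rw [if_neg fun hc : 0 < ξ ∧ ξ < u => by linarith [hc.1], zero_sub]
    split_ifs <;> norm_num

theorem measurePreserving_assoc (L : Fin N → ℝ) :
    MeasurePreserving (MeasurableEquiv.prodAssoc : (E N × E N) × ℝ ≃ᵐ E N × E N × ℝ)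
      ((measXY L).prod volume) (measXYXi L) :=
  measurePreserving_prodAssoc (volume : Measure (E N)) (cellMeasure L) (volume : Measure ℝ)

theorem ae_XYXi_of_ae_XY {p : E N × E N → Prop} (h : ∀ᵐ q ∂(measXY L), p q) :
    ∀ᵐ z ∂(measXYXi L), p (z.1, z.2.1) := by
  have h1 : ∀ᵐ q ∂((measXY L).prod (volume : Measure ℝ)), p q.1 :=
    Measure.quasiMeasurePreserving_fst.ae h
  exact ((measurePreserving_assoc L).symm).quasiMeasurePreserving.ae h1

/-- A measurable representative of `u₀` bounded by `M` everywhere. -/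
theorem exists_bounded_rep (hu₀' : MemLp u₀ ⊤ (measXY L)) :
    ∃ u : E N × E N → ℝ, Measurable u ∧ (∀ p, |u p| ≤ supNorm L u₀) ∧ u₀ =ᵐ[measXY L] u := by
  have hM : 0 ≤ supNorm L u₀ := ENNReal.toReal_nonneg
  refine ⟨fun p => max (-supNorm L u₀) (min (supNorm L u₀) (hu₀'.1.mk u₀ p)),
    measurable_const.max (measurable_const.min hu₀'.1.stronglyMeasurable_mk.measurable),
    fun p => abs_le.2 ⟨le_max_left _ _, max_le (by linarith) (min_le_left _ _)⟩, ?_⟩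
  have hb : ∀ᵐ p ∂(measXY L), ‖u₀ p‖ₑ ≤ eLpNorm u₀ ⊤ (measXY L) := by
    rw [eLpNorm_exponent_top]
    exact ae_le_eLpNormEssSup
  filter_upwards [hu₀'.1.ae_eq_mk, hb] with p h1 h2
  rw [← h1]
  have h3 : |u₀ p| ≤ supNorm L u₀ := by
    have := ENNReal.toReal_mono hu₀'.2.ne h2
    rwa [toReal_enorm] at this
  obtain ⟨h4, h5⟩ := abs_le.1 h3
  rw [min_eq_right h5, max_eq_right h4]

theorem initialDatum_congr {u : E N × E N → ℝ} (h : u₀ =ᵐ[measXY L] u) :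
    initialDatum u₀ =ᵐ[measXYXi L] initialDatum u := by
  filter_upwards [ae_XYXi_of_ae_XY h] with z hz
  simp only [initialDatum]
  rw [hz]

theorem measurable_initialDatum {u : E N × E N → ℝ} (hu : Measurable u) :
    Measurable (initialDatum u) :=
  measurable_chi.comp ((by fun_prop : Measurable fun z : E N × E N × ℝ => z.2.2).prodMk
    (hu.comp (by fun_prop)))

theorem eLpNorm_initialDatum {u : E N × E N → ℝ} (hu : Measurable u) :
    eLpNorm (initialDatum u) 1 (measXYXi L) = eLpNorm u 1 (measXY L) := by
  have hm := measurable_initialDatum hu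
  rw [eLpNorm_one_eq_lintegral_enorm, eLpNorm_one_eq_lintegral_enorm,
    ← (measurePreserving_assoc L).lintegral_comp hm.enorm,
    lintegral_prod (fun z => ‖initialDatum u (MeasurableEquiv.prodAssoc z)‖ₑ)
      (hm.enorm.comp (measurePreserving_assoc L).measurable).aemeasurable]
  refine lintegral_congr fun p => ?_
  exact lintegral_chi (u p)

theorem memLp_initialDatum {u : E N × E N → ℝ} (hu : Measurable u) (hu1 : MemLp u 1 (measXY L)) :
    MemLp (initialDatum u) 2 (measXYXi L) := by
  have hm := measurable_initialDatum hu
  have hi : Integrable (initialDatum u) (measXYXi L) := by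
    rw [← memLp_one_iff_integrable]
    exact ⟨hm.aestronglyMeasurable, by rw [eLpNorm_initialDatum hu]; exact hu1.2⟩
  rw [memLp_two_iff_integrable_sq hm.aestronglyMeasurable]
  exact hi.abs.congr (Eventually.of_forall fun z => (chi_sq _ _).symm)

theorem norm_sq_of_initialDatum {u : E N × E N → ℝ} (hu : Measurable u) {F : L2XYXi L}
    (hF : F =ᵐ[measXYXi L] initialDatum u) : ‖F‖ ^ 2 = ∫ p, |u p| ∂(measXY L) := by
  rw [norm_sq_Lp_eq]
  have h1 : ∫ z, F z ^ 2 ∂(measXYXi L) = ∫ z, ‖initialDatum u z‖ ∂(measXYXi L) := by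
    refine integral_congr_ae ?_
    filter_upwards [hF] with z hz
    rw [hz]
    exact chi_sq _ _
  rw [h1, integral_norm_eq_lintegral_enorm (measurable_initialDatum hu).aestronglyMeasurable,
    ← eLpNorm_one_eq_lintegral_enorm, eLpNorm_initialDatum hu, eLpNorm_one_eq_lintegral_enorm,
    ← integral_norm_eq_lintegral_enorm hu.aestronglyMeasurable]
  rfl

end InitialDatum

/-! ### Regularization in x -/

section Translation

variable {N : ℕ} {L : Fin N → ℝ}

/-- Translation in the variable `x`. -/
def shiftX (v : E N) (z : E N × E N × ℝ) : E N × E N × ℝ := (z.1 - v, z.2)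

theorem measurePreserving_shiftX (v : E N) :
    MeasurePreserving (shiftX v) (measXYXi L) (measXYXi L) :=
  (measurePreserving_sub_right (volume : Measure (E N)) v).prod (MeasurePreserving.id (measYXi L))

theorem continuous_shiftX : Continuous fun p : E N × E N × E N × ℝ => shiftX p.1 p.2 := by
  unfold shiftX; fun_prop

/-- The translation group on `L²(ℝ^N × Y × ℝ)`. -/
def translateX (v : E N) : L2XYXi L →L[ℝ] L2XYXi L :=
  (Lp.compMeasurePreservingₗᵢ ℝ (shiftX v) (measurePreserving_shiftX v)).toContinuousLinearMap

theorem coeFn_translateX_of_ae (v : E N) {F : L2XYXi L} {G : E N × E N × ℝ → ℝ}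
    (h : F =ᵐ[measXYXi L] G) : translateX v F =ᵐ[measXYXi L] fun z => G (shiftX v z) :=
  (Lp.coeFn_compMeasurePreserving F (measurePreserving_shiftX v)).trans
    ((measurePreserving_shiftX v).quasiMeasurePreserving.ae_eq_comp h)

theorem norm_translateX (v : E N) (F : L2XYXi L) : ‖translateX v F‖ = ‖F‖ :=
  Lp.norm_compMeasurePreserving F (measurePreserving_shiftX v)

theorem continuous_translateX (F : L2XYXi L) : Continuous fun v : E N => translateX v F := by
  let Φ : C(E N × E N × E N × ℝ, E N × E N × ℝ) := ⟨_, continuous_shiftX⟩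
  exact Continuous.compMeasurePreservingLp (g := fun v => Φ.curry v) continuous_const
    Φ.curry.continuous (fun v => measurePreserving_shiftX v) (by norm_num)

theorem translateX_zero (F : L2XYXi L) : translateX 0 F = F := by
  apply Lp.ext
  filter_upwards [coeFn_translateX_of_ae 0 (F := F) (ae_eq_refl _)] with z hz
  rw [hz, shiftX, sub_zero]

variable {κ : E N → ℝ} {F : L2XYXi L} {g : E N × E N × ℝ → ℝ}

/-- Convolution in `x` as a Bochner integral of translates. -/
def convX (κ : E N → ℝ) (F : L2XYXi L) : L2XYXi L := ∫ v, κ v • translateX v F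

theorem integrable_smul_translate (hκ : Integrable κ) (F : L2XYXi L) :
    Integrable fun v => κ v • translateX v F := by
  refine (hκ.norm.mul_const ‖F‖).mono
    (hκ.1.smul (continuous_translateX F).aestronglyMeasurable) (Eventually.of_forall fun v => ?_)
  rw [norm_smul, norm_translateX, norm_mul, norm_norm, norm_norm]

/-- The pointwise form of convolution in `x`. -/
theorem coeFn_convX (hκ : Integrable κ) (hκm : Measurable κ) (hF : F =ᵐ[measXYXi L] g)
    (hg : Measurable g) {c : ℝ} (hc : ∀ z, |g z| ≤ c) :
    convX κ F =ᵐ[measXYXi L] fun z => ∫ v, κ v * g (shiftX v z) := by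
  have hsm : Measurable fun p : E N × E N × E N × ℝ => g (shiftX p.1 p.2) :=
    hg.comp continuous_shiftX.measurable
  have hm2 : Measurable fun p : E N × E N × E N × ℝ => κ p.1 * g (shiftX p.1 p.2) :=
    (hκm.comp measurable_fst).mul hsm
  have hfin : ∀ s : Set (E N × E N × ℝ), measXYXi L s < ⊤ →
      Integrable (fun p : E N × E N × E N × ℝ => κ p.1 * g (shiftX p.1 p.2))
        ((volume : Measure (E N)).prod ((measXYXi L).restrict s)) := by
    intro s hs
    have : IsFiniteMeasure ((measXYXi L).restrict s) := ⟨by rwa [Measure.restrict_apply_univ]⟩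
    have h1 : Integrable (fun p : E N × E N × E N × ℝ => κ p.1 * c)
        ((volume : Measure (E N)).prod ((measXYXi L).restrict s)) :=
      hκ.mul_prod (integrable_const c)
    refine h1.mono hm2.aestronglyMeasurable (Eventually.of_forall fun p => ?_)
    rw [norm_mul, norm_mul]
    exact mul_le_mul_of_nonneg_left ((hc _).trans (le_abs_self c)) (norm_nonneg _)
  -- A Bochner integral in L² has no pointwise meaning by itself; it is identified by pairing with
  -- indicators of sets of finite measure and applying Fubini.
  refine ae_eq_of_forall_setIntegral_eq_of_sigmaFinite (fun s hs hμ => ?_) (fun s hs hμ => ?_)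
    fun s hs hμ => ?_
  · exact integrableOn_Lp_of_measure_ne_top _ one_le_two hμ.ne
  · exact (hfin s hμ).integral_prod_right
  · have e1 : ∀ G : L2XYXi L, ∫ z in s, G z ∂(measXYXi L) =
        innerSL ℝ (indicatorConstLp 2 hs hμ.ne (1 : ℝ)) G := fun G => by
      rw [innerSL_apply_apply, L2.inner_indicatorConstLp_one]
    rw [e1, convX, ← ContinuousLinearMap.integral_comp_comm _ (integrable_smul_translate hκ F),
      ← integral_integral_swap (f := fun v z => κ v * g (shiftX v z)) (hfin s hμ)]
    refine integral_congr_ae (Eventually.of_forall fun v => ?_)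
    simp only
    rw [_root_.map_smul, ← e1, smul_eq_mul, ← integral_const_mul]
    refine setIntegral_congr_ae hs ?_
    filter_upwards [coeFn_translateX_of_ae v hF] with z hz _
    rw [hz]

/-- Averages of translates stay in closed convex sets. -/
theorem convX_mem {B : Set (L2XYXi L)} (hBc : IsClosed B) (hBx : Convex ℝ B)
    (hκ : Integrable κ) (hκm : Measurable κ) (hκ0 : ∀ v, 0 ≤ κ v) (hκ1 : ∫ v, κ v = 1)
    (hF : ∀ v, translateX v F ∈ B) : convX κ F ∈ B := by
  have hm : Measurable fun v => (κ v).toNNReal := hκm.real_toNNReal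
  -- κ dv is a probability measure, so the convolution is a barycentre of translates and remains in
  -- the closed convex set.
  have hp : IsProbabilityMeasure ((volume : Measure (E N)).withDensity
      fun v => ((κ v).toNNReal : ℝ≥0∞)) := by
    constructor
    rw [withDensity_apply _ MeasurableSet.univ, Measure.restrict_univ]
    have := ofReal_integral_eq_lintegral_ofReal hκ (Eventually.of_forall hκ0)
    rw [hκ1, ENNReal.ofReal_one] at this
    exact this.symm
  have e : convX κ F = ∫ v, translateX v F ∂((volume : Measure (E N)).withDensity
      fun v => ((κ v).toNNReal : ℝ≥0∞)) := by
    rw [integral_withDensity_eq_integral_smul hm, convX]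
    refine integral_congr_ae (Eventually.of_forall fun v => ?_)
    simp only
    rw [NNReal.smul_def, Real.coe_toNNReal _ (hκ0 v)]
  rw [e]
  refine hBx.integral_mem hBc (Eventually.of_forall hF) ?_
  rw [integrable_withDensity_iff_integrable_smul hm]
  refine (integrable_smul_translate hκ F).congr (Eventually.of_forall fun v => ?_)
  simp only
  rw [NNReal.smul_def, Real.coe_toNNReal _ (hκ0 v)]

theorem norm_convX_sub_le (hκ : Integrable κ) (hκ0 : ∀ v, 0 ≤ κ v) (hκ1 : ∫ v, κ v = 1) {δ : ℝ}
    (hδ : ∀ v, κ v ≠ 0 → ‖translateX v F - F‖ ≤ δ) : ‖convX κ F - F‖ ≤ δ := by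
  have e : convX κ F - F = ∫ v, κ v • (translateX v F - F) := by
    simp_rw [smul_sub]
    rw [integral_sub (integrable_smul_translate hκ F) (hκ.smul_const F), integral_smul_const, hκ1,
      one_smul, convX]
  have h := norm_integral_le_of_norm_le (f := fun v => κ v • (translateX v F - F))
    (hκ.mul_const δ) (Eventually.of_forall fun v => ?_)
  · rwa [integral_mul_const, hκ1, one_mul, ← e] at h
  · rw [norm_smul, Real.norm_of_nonneg (hκ0 v)]
    by_cases hv : κ v = 0
    · simp [hv]
    · exact mul_le_mul_of_nonneg_left (hδ v hv) (hκ0 v)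

variable {A : E N × ℝ → E N} {M : ℝ}

/-- Functions mollified in `x` and supported in `|ξ| ≤ M` are Lipschitz along the free transport. -/
theorem exists_lipschitz_transport_convX (hA : IsDivFreeFlux L A) (hκs : ContDiff ℝ ∞ κ)
    (hκc : HasCompactSupport κ) (hF : F =ᵐ[measXYXi L] g) (hg : Measurable g) {c : ℝ}
    (hc : ∀ z, |g z| ≤ c) (hgM : ∀ z, M < |z.2.2| → g z = 0) :
    ∃ C, 0 ≤ C ∧ ∀ r, 0 ≤ r → ‖transport hA r (convX κ F) - convX κ F‖ ≤ C * r := by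
  have hS := isIsometryGroup_transport hA
  have hκi : Integrable κ := hκs.continuous.integrable_of_hasCompactSupport hκc
  have hκm : Measurable κ := hκs.continuous.measurable
  obtain ⟨k, hk⟩ := hκs.lipschitzWith_of_hasCompactSupport hκc (by simp)
  obtain ⟨V, hV0, hV⟩ := exists_velocity_bound (L := L) hA M
  obtain ⟨R, hR⟩ := hκc.isCompact.isBounded.exists_norm_le
  have hκ0 : ∀ v, R < ‖v‖ → κ v = 0 := fun v hv => by
    by_contra hne
    have := hR v (subset_tsupport κ hne)
    linarith
  have hc0 : 0 ≤ c := (abs_nonneg _).trans (hc 0)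
  -- For r ≤ 1 the displacement is at most V, so κ and its translate both vanish outside the ball of
  -- radius R + V. Convolving |F| with the indicator of this ball gives an L² majorant.
  obtain ⟨B, hB⟩ : ∃ B : E N → ℝ, B = (Metric.closedBall 0 (R + V)).indicator fun _ => 1 := ⟨_, rfl⟩
  have hBm : MeasurableSet (Metric.closedBall (0 : E N) (R + V)) :=
    Metric.isClosed_closedBall.measurableSet
  have hBmeas : Measurable B := by rw [hB]; exact measurable_const.indicator hBm
  have hBi : Integrable B := by
    rw [hB, integrable_indicator_iff hBm]
    exact integrableOn_const (isCompact_closedBall _ _).measure_lt_top.ne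
  have hB0 : ∀ v, 0 ≤ B v := fun v => by rw [hB]; exact indicator_nonneg (fun _ _ => zero_le_one) _
  have hgabs : Measurable fun z => |g z| := hg.abs
  obtain ⟨Fa, hFa⟩ : ∃ Fa : L2XYXi L, Fa =ᵐ[measXYXi L] fun z => |g z| :=
    ⟨|F|, (Lp.coeFn_abs F).trans (hF.mono fun z hz => by simp only [hz])⟩
  have hh := coeFn_convX hκi hκm hF hg hc
  have hha := coeFn_convX hBi hBmeas hFa hgabs (c := c) fun z => by rw [abs_abs]; exact hc z
  -- The first term handles r ≤ 1; for r ≥ 1 the trivial bound 2‖h‖ ≤ 2‖h‖ r is enough.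
  refine ⟨k * V * ‖convX B Fa‖ + 2 * ‖convX κ F‖, by positivity, fun r hr => ?_⟩
  rcases le_total r 1 with hr1 | hr1
  · have key : ‖transport hA r (convX κ F) - convX κ F‖ ≤ (k * V * r) * ‖convX B Fa‖ := by
      refine Lp.norm_le_mul_norm_of_ae_le_mul ?_
      filter_upwards [Lp.coeFn_sub (transport hA r (convX κ F)) (convX κ F),
        coeFn_transport_of_ae hA r hh, hh, hha, ae_mem_cell_XYXi L] with z h1 h2 h3 h4 hz
      rw [h1, Pi.sub_apply, h2, h3, h4]
      by_cases hM : M < |z.2.2|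
      · have e : ∀ v v', g (shiftX v (flowMap A v' z)) = 0 := fun v v' => hgM _ hM
        have e' : ∀ v, g (shiftX v z) = 0 := fun v => hgM _ hM
        simp [e, e']
      · obtain ⟨d, hd⟩ : ∃ d : E N, d = r • velocity A z.2.1 z.2.2 := ⟨_, rfl⟩
        have hdn : ‖d‖ ≤ V * r := by
          rw [hd, norm_smul, Real.norm_of_nonneg hr, mul_comm]
          exact mul_le_mul_of_nonneg_right (hV z.2 hz (not_lt.1 hM)) hr
        have hdV : ‖d‖ ≤ V := hdn.trans (mul_le_of_le_one_right hV0 hr1)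
        -- At fixed (y, ξ) transport is a translation by d = r a; the change of variables moves it
        -- onto the Lipschitz kernel, so F itself needs no regularity.
        have e1 : ∫ v, κ v * g (shiftX v (flowMap A r z)) = ∫ v, κ (v - d) * g (shiftX v z) := by
          rw [← integral_sub_right_eq_self (fun v => κ v * g (shiftX v (flowMap A r z))) d]
          refine integral_congr_ae (Eventually.of_forall fun v => ?_)
          simp only [shiftX, flowMap]
          rw [← hd]
          congr 3
          abel
        have hgv : AEStronglyMeasurable (fun v : E N => g (shiftX v z)) volume :=
          (hg.comp (by unfold shiftX; fun_prop)).aestronglyMeasurable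
        have i1 : Integrable fun v => κ (v - d) * g (shiftX v z) :=
          (hκi.comp_sub_right d).mul_bdd hgv (Eventually.of_forall fun v => hc _)
        have i2 : Integrable fun v => κ v * g (shiftX v z) :=
          hκi.mul_bdd hgv (Eventually.of_forall fun v => hc _)
        have i3 : Integrable fun v => B v * |g (shiftX v z)| :=
          hBi.mul_bdd (c := c) hgv.norm
            (Eventually.of_forall fun v => by rw [Real.norm_eq_abs, abs_abs]; exact hc _)
        rw [e1, ← integral_sub i1 i2]
        have hnn : 0 ≤ ∫ v, B v * |g (shiftX v z)| :=
          integral_nonneg fun v => mul_nonneg (hB0 v) (abs_nonneg _)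
        rw [Real.norm_of_nonneg hnn, ← integral_const_mul]
        refine norm_integral_le_of_norm_le (i3.const_mul _) (Eventually.of_forall fun v => ?_)
        rw [← sub_mul, norm_mul, ← mul_assoc]
        refine mul_le_mul_of_nonneg_right ?_ (abs_nonneg _)
        by_cases hv : v ∈ Metric.closedBall (0 : E N) (R + V)
        · rw [hB, indicator_of_mem hv, mul_one]
          refine (hk.norm_sub_le _ _).trans ?_
          rw [sub_sub_cancel_left, norm_neg, mul_assoc]
          exact mul_le_mul_of_nonneg_left hdn k.2
        · rw [mem_closedBall_zero_iff, not_le] at hv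
          have h5 : κ v = 0 := hκ0 v (by linarith)
          have h6 : κ (v - d) = 0 := hκ0 _ (by
            have := norm_sub_norm_le v d
            linarith)
          rw [h5, h6, sub_zero, norm_zero]
          exact mul_nonneg (by positivity) (hB0 v)
    refine key.trans ?_
    have : 0 ≤ 2 * ‖convX κ F‖ * r := by positivity
    linarith
  · have h1 : ‖transport hA r (convX κ F) - convX κ F‖ ≤ 2 * ‖convX κ F‖ := by
      refine (norm_sub_le _ _).trans ?_
      rw [hS.norm_map]
      linarith
    have h2 : 2 * ‖convX κ F‖ ≤ 2 * ‖convX κ F‖ * r := le_mul_of_one_le_right (by positivity) hr1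
    have h3 : 0 ≤ k * V * ‖convX B Fa‖ * r := by positivity
    linarith

/-- Membership of the slices is invariant under translations in `x`. -/
theorem translateX_mem_sliceSet {K : Set (L2YXi L)} (hF : F ∈ sliceSet K) (v : E N) :
    translateX v F ∈ sliceSet K := by
  have h1 := (measurePreserving_sub_right (volume : Measure (E N)) v).quasiMeasurePreserving.ae hF
  have h2 := (measurePreserving_sub_right (volume : Measure (E N)) v).quasiMeasurePreserving.ae
    (coeFn_slice F)
  have h3 := ae_ae_of_ae_XYXi (coeFn_translateX_of_ae v (F := F) (ae_eq_refl _))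
  filter_upwards [h1, h2, h3] with x hx1 hx2 (hx3 : (fun w => translateX v F (x, w))
    =ᵐ[measYXi L] fun w => F (x - v, w))
  have : slice (translateX v F) x = slice F (x - v) := slice_eq_of_ae (hx3.trans hx2.symm)
  rw [this]
  exact hx1

/-- Well-behaved data are approximated by data that are Lipschitz along the free transport. -/
theorem exists_regular_approx (hL : ∀ i, 0 < L i) (hA : IsDivFreeFlux L A)
    (hF : F =ᵐ[measXYXi L] g) (hg : Measurable g) {c : ℝ} (hc : ∀ z, |g z| ≤ c)
    (hgM : ∀ z, M < |z.2.2| → g z = 0) (hFK : F ∈ sliceSet (constraintSet L A M)) {δ : ℝ}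
    (hδ : 0 < δ) : ∃ h : L2XYXi L, ‖h - F‖ ≤ δ ∧ sliceProj (constraintSet L A M) h = h ∧
      ∃ C, 0 ≤ C ∧ ∀ r, 0 ≤ r → ‖transport hA r h - h‖ ≤ C * r := by
  have hcont := (continuous_translateX F).tendsto 0
  rw [translateX_zero] at hcont
  obtain ⟨ε, hε, hball⟩ := Metric.tendsto_nhds_nhds.1 hcont δ hδ
  set κ : E N → ℝ := mollifier volume (ε / 2) with hκ
  have hκs : ContDiff ℝ ∞ κ := contDiff_mollifier volume (ε / 2)
  have hκc : HasCompactSupport κ := hasCompactSupport_mollifier volume (by positivity)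
  have hκi : Integrable κ := hκs.continuous.integrable_of_hasCompactSupport hκc
  have hκ0 : ∀ v, 0 ≤ κ v := mollifier_nonneg volume (by positivity)
  have hκ1 : ∫ v, κ v = 1 := integral_mollifier volume (by positivity)
  have hc' := isClosed_sliceSet (isClosed_constraintSet (M := M) hL hA)
  have hx' := convex_sliceSet (convex_constraintSet (M := M) hL hA)
  refine ⟨convX κ F, norm_convX_sub_le hκi hκ0 hκ1 fun v hv => ?_, ?_,
    exists_lipschitz_transport_convX hA hκs hκc hF hg hc hgM⟩
  · have hv' : v ∈ Metric.closedBall 0 (ε / 2) := by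
      by_contra hne
      exact hv (mollifier_eq_zero volume (by positivity) hne)
    have : dist v 0 < ε := lt_of_le_of_lt hv' (by linarith)
    rw [← dist_eq_norm]
    exact (hball this).le
  · exact metricProj_of_mem ⟨0, zero_mem_sliceSet (zero_mem_constraintSet hL)⟩ hc' hx'
      (convX_mem hc' hx' hκi hκs.continuous.measurable hκ0 hκ1 (translateX_mem_sliceSet hFK))

end Translation

/-! ### Estimates for solutions -/

section Solutions

variable {N : ℕ} {L : Fin N → ℝ} {A : E N × ℝ → E N} {M lam T : ℝ} {u₀ u : E N × E N → ℝ}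
  {F F₀ : L2XYXi L}

/-- The condition k² = |k| forces k ∈ {-1, 0, 1}, and k has the sign of s. For k = 0 the identity is
trivial; for |k| = 1 the difference |s - k| equals 1 - |s|. -/
theorem abs_sub_eq_of_kinInterval {ξ s k : ℝ} (hs : s ∈ kinInterval M ξ)
    (hk : k ∈ kinInterval M ξ) (hk2 : k ^ 2 = |k|) : |s - k| = (s - k) ^ 2 + (|s| - s ^ 2) := by
  rw [mem_kinInterval_iff] at hs hk
  rcases lt_or_ge 0 ξ with hξ | hξ
  · obtain ⟨s0, s1⟩ := hs.2.1 hξ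
    obtain ⟨k0, k1⟩ := hk.2.1 hξ
    rw [abs_of_nonneg k0] at hk2
    rw [abs_of_nonneg s0]
    rcases mul_eq_zero.1 (by linarith : k * (k - 1) = 0) with h | h
    · rw [h, sub_zero, abs_of_nonneg s0]; ring
    · rw [sub_eq_zero.1 h, abs_of_nonpos (by linarith)]; ring
  · obtain ⟨s0, s1⟩ := hs.2.2 hξ
    obtain ⟨k0, k1⟩ := hk.2.2 hξ
    rw [abs_of_nonpos k1] at hk2
    rw [abs_of_nonpos s1]
    rcases mul_eq_zero.1 (by linarith : k * (k + 1) = 0) with h | h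
    · rw [h, sub_zero, abs_of_nonpos s1]; ring
    · rw [eq_neg_of_add_eq_zero_left h, abs_of_nonneg (by linarith)]; ring

/-- The `L¹` distance to an equilibrium function is controlled by the `L²` distance. -/
theorem eLpNorm_sub_le_of_mem_kinSet (hF : F ∈ kinSet L M (eLpNorm F₀ 1 (measXYXi L)))
    (h₀ : ∀ᵐ z ∂(measXYXi L), F₀ z ∈ kinInterval M z.2.2)
    (hsq : ∀ᵐ z ∂(measXYXi L), F₀ z ^ 2 = |F₀ z|) :
    eLpNorm (F - F₀ : L2XYXi L) 1 (measXYXi L) ≤ ENNReal.ofReal (2 * ‖F₀‖ * ‖F - F₀‖) := by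
  have hi₀ : Integrable F₀ (measXYXi L) := by
    rw [← integrable_norm_iff (Lp.aestronglyMeasurable F₀)]
    exact (Lp.memLp F₀).integrable_sq.congr hsq
  have hi : Integrable F (measXYXi L) := memLp_one_iff_integrable.1
    ⟨Lp.aestronglyMeasurable F, hF.2.trans_lt (memLp_one_iff_integrable.2 hi₀).2⟩
  have hid : Integrable (F - F₀ : L2XYXi L) (measXYXi L) :=
    (hi.sub hi₀).congr (Lp.coeFn_sub F F₀).symm
  have h1 : ∫ z, |F z| ∂(measXYXi L) ≤ ‖F₀‖ ^ 2 := by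
    have e0 : ‖F₀‖ ^ 2 = ∫ z, ‖F₀ z‖ ∂(measXYXi L) := by
      rw [norm_sq_Lp_eq]
      exact integral_congr_ae hsq
    have := ENNReal.toReal_mono (memLp_one_iff_integrable.2 hi₀).2.ne hF.2
    rw [eLpNorm_one_eq_lintegral_enorm, eLpNorm_one_eq_lintegral_enorm,
      ← integral_norm_eq_lintegral_enorm (Lp.aestronglyMeasurable F),
      ← integral_norm_eq_lintegral_enorm (Lp.aestronglyMeasurable F₀), ← e0] at this
    exact this
  have h2 : ∫ z, ‖(F - F₀ : L2XYXi L) z‖ ∂(measXYXi L) =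
      ‖F - F₀‖ ^ 2 + (∫ z, |F z| ∂(measXYXi L) - ‖F‖ ^ 2) := by
    have i1 : Integrable (fun z => |F z| - F z ^ 2) (measXYXi L) :=
      hi.abs.sub (Lp.memLp F).integrable_sq
    rw [norm_sq_Lp_eq, norm_sq_Lp_eq, ← integral_sub hi.abs (Lp.memLp F).integrable_sq,
      ← integral_add (Lp.memLp _).integrable_sq i1]
    refine integral_congr_ae ?_
    filter_upwards [hF.1, h₀, hsq, Lp.coeFn_sub F F₀] with z e1 e2 e3 e4
    rw [e4, Pi.sub_apply]
    exact abs_sub_eq_of_kinInterval e1 e2 e3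
  rw [eLpNorm_one_eq_lintegral_enorm, ← ofReal_integral_norm_eq_lintegral_enorm hid]
  refine ENNReal.ofReal_le_ofReal ?_
  have h3 := norm_sub_sq_real F F₀
  have h4 : -inner ℝ (F - F₀) F₀ ≤ ‖F - F₀‖ * ‖F₀‖ :=
    (neg_le_abs _).trans (abs_real_inner_le_norm _ _)
  rw [inner_sub_left, real_inner_self_eq_norm_sq] at h4
  -- With ∫|F| ≤ ‖F₀‖² the right side of `h2` is at most ‖F - F₀‖² + ‖F₀‖² - ‖F‖² = -2⟨F - F₀, F₀⟩,
  -- and Cauchy–Schwarz finishes. The L¹ bound on F is indispensable here.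
  rw [h2]
  linarith

/-- The sign, size and support properties of kinetic functions. -/
theorem ae_of_mem_kinSet {c : ℝ≥0∞} (hF : F ∈ kinSet L M c) : ∀ᵐ z ∂(measXYXi L),
    (M ≤ |z.2.2| → F z = 0) ∧ Real.sign z.2.2 * F z = |F z| ∧ |F z| ≤ 1 := by
  have hne : ∀ r : ℝ, ∀ᵐ z ∂(measXYXi L), z.2.2 ≠ r := fun r =>
    Measure.quasiMeasurePreserving_snd.ae
      (Measure.quasiMeasurePreserving_snd.ae (Measure.ae_ne volume r))
  -- `kinInterval` allows nonzero values at |ξ| = M and at ξ = 0, where the support and sign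
  -- statements could fail; these levels are null sets.
  filter_upwards [hF.1, hne 0, hne M, hne (-M)] with z h h0 h1 h2
  rw [mem_kinInterval_iff] at h
  refine ⟨fun hM => h.1 (lt_of_le_of_ne hM fun e => ?_), ?_⟩
  · rcases abs_choice z.2.2 with e' | e' <;> rw [e'] at e
    · exact h1 e.symm
    · exact h2 (by linarith)
  · rcases lt_or_gt_of_ne h0 with hξ | hξ
    · obtain ⟨s0, s1⟩ := h.2.2 hξ.le
      rw [Real.sign_of_neg hξ, abs_of_nonpos s1]
      exact ⟨by ring, by linarith⟩
    · obtain ⟨s0, s1⟩ := h.2.1 hξ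
      rw [Real.sign_of_pos hξ, abs_of_nonneg s0]
      exact ⟨by ring, s1⟩

/-- Well-prepared initial data have their slices in the constraint set. -/
theorem mem_sliceSet_of_wellPrepared (hL : ∀ i, 0 < L i) (hu : ∀ p, |u p| ≤ M)
    (hF₀ : F₀ =ᵐ[measXYXi L] initialDatum u) (hF₀' : F₀ =ᵐ[measXYXi L] initialDatum u₀)
    (hw : ∀ᵐ x : E N, IsDivFree L A fun w => chi w.2 (u₀ (x, w.1))) :
    F₀ ∈ sliceSet (constraintSet L A M) := by
  filter_upwards [hw, ae_ae_of_ae_XYXi hF₀, ae_ae_of_ae_XYXi hF₀', coeFn_slice F₀]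
    with x hx h1 h2 h3
  have e1 : slice F₀ x =ᵐ[measYXi L] fun w => chi w.2 (u (x, w.1)) := h3.trans h1
  have e2 : slice F₀ x =ᵐ[measYXi L] fun w => chi w.2 (u₀ (x, w.1)) := h3.trans h2
  have hs : ∀ᵐ w ∂(measYXi L), M < |w.2| → slice F₀ x w = 0 := by
    filter_upwards [e1] with w hw hM
    rw [hw]
    exact (mem_kinInterval_iff.1 (chi_mem_kinInterval (hu _))).1 hM
  exact ⟨hs, hx.congr e2.symm, ((kinMono_chi (u := fun y => u (x, y))).congr
    e1.symm).hasKineticDerivative hL (Lp.memLp _) hs⟩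

/-- Mild solutions with kinetic initial data are kinetic functions. -/
theorem IsMild.mem_kinSet (hL : ∀ i, 0 < L i) (hA : IsDivFreeFlux L A) (hM : 0 ≤ M)
    (hlam : 0 < lam) {hT : 0 ≤ T} {f : XT L T}
    (hf : IsMild (transport hA) (sliceProj (constraintSet L A M)) lam F₀ hT f) {c : ℝ≥0∞}
    (h₀ : F₀ ∈ kinSet L M c) (t : Icc (0 : ℝ) T) : f t ∈ kinSet L M c :=
  IsMild.mem (isIsometryGroup_transport hA)
    (lipschitzWith_sliceProj (zero_mem_constraintSet hL) (isClosed_constraintSet hL hA)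
      (convex_constraintSet hL hA)) hlam hf (isClosed_kinSet c) (convex_kinSet c)
    (fun r _ hv => transport_mem_kinSet hA r hv) (fun _ hv => sliceProj_mem_kinSet hL hA hM hv) h₀ t

/-- Comparison with the fixed point 0 of the projection, which transport does not move. -/
theorem IsMild.norm_le (hL : ∀ i, 0 < L i) (hA : IsDivFreeFlux L A) (hlam : 0 < lam)
    {hT : 0 ≤ T} {f : XT L T}
    (hf : IsMild (transport hA) (sliceProj (constraintSet L A M)) lam F₀ hT f)
    (t : Icc (0 : ℝ) T) : ‖f t‖ ≤ ‖F₀‖ := by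
  have hS := isIsometryGroup_transport hA
  have := IsMild.norm_sub_le hS
    (lipschitzWith_sliceProj (zero_mem_constraintSet hL) (isClosed_constraintSet hL hA)
      (convex_constraintSet hL hA)) hlam hf (h := 0) (C := 0) (sliceProj_zero hL hA)
    (fun r _ => by rw [_root_.map_zero]; simp) t
  simpa using this

/-- The variational inequality of the projection, in terms of the relaxation term. -/
theorem integral_relaxTerm_mul_le (hL : ∀ i, 0 < L i) (hA : IsDivFreeFlux L A) (hlam : 0 < lam)
    {g : L2YXi L} (hg : g ∈ constraintSet L A M) (x : E N) :
    ∫ w, relaxTerm (constraintSet L A M) lam F x w *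
      (metricProj (constraintSet L A M) (slice F x) w - g w) ∂(measYXi L) ≤ 0 := by
  have h := inner_metricProj_le ⟨0, zero_mem_constraintSet (A := A) (M := M) hL⟩
    (isClosed_constraintSet hL hA) (convex_constraintSet hL hA) (slice F x) hg
  have e : ∫ w, relaxTerm (constraintSet L A M) lam F x w *
      (metricProj (constraintSet L A M) (slice F x) w - g w) ∂(measYXi L) =
      inner ℝ (relaxTerm (constraintSet L A M) lam F x)
        (metricProj (constraintSet L A M) (slice F x) - g) := by
    rw [L2.inner_def]
    refine integral_congr_ae ?_
    filter_upwards [Lp.coeFn_sub (metricProj (constraintSet L A M) (slice F x)) g] with w hw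
    rw [hw, Pi.sub_apply, RCLike.inner_apply, conj_trivial, mul_comm]
  rw [e, relaxTerm, real_inner_smul_left, ← neg_sub (slice F x), ← neg_sub g, inner_neg_neg]
  exact mul_nonpos_of_nonneg_of_nonpos hlam.le h

/-- A modulus of continuity built from a family of affine bounds. -/
theorem exists_modulus (B : ℝ) (C : ℕ → ℝ) :
    ∃ m : ℝ → ℝ≥0, Tendsto m (𝓝[>] 0) (𝓝 0) ∧ ∀ t a : ℝ,
      (∀ n : ℕ, a ≤ B * (2 * (1 / ((n : ℝ) + 1)) + C n * t)) → ENNReal.ofReal a ≤ m t := by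
  -- An infimum of continuous functions of t is upper semicontinuous, and its value at t = 0 is zero
  -- because the offsets tend to zero with n; the slopes C n may be unbounded.
  refine ⟨fun t => ⨅ n : ℕ, (B * (2 * (1 / ((n : ℝ) + 1)) + C n * t)).toNNReal, ?_,
    fun t a ha => ?_⟩
  · have hlim : Tendsto (fun n : ℕ => (B * (2 * (1 / ((n : ℝ) + 1)))).toNNReal) atTop (𝓝 0) := by
      have := tendsto_real_toNNReal
        ((tendsto_one_div_add_atTop_nhds_zero_nat (𝕜 := ℝ)).const_mul 2 |>.const_mul B)
      simpa using this
    refine tendsto_order.2 ⟨fun a ha => absurd ha not_lt_zero, fun a ha => ?_⟩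
    obtain ⟨n, hn⟩ := ((tendsto_order.1 hlim).2 a ha).exists
    have hc : Continuous fun t : ℝ => (B * (2 * (1 / ((n : ℝ) + 1)) + C n * t)).toNNReal :=
      continuous_real_toNNReal.comp (by fun_prop)
    have h0 : (fun t : ℝ => (B * (2 * (1 / ((n : ℝ) + 1)) + C n * t)).toNNReal) 0 < a := by
      simpa using hn
    filter_upwards [nhdsWithin_le_nhds ((hc.tendsto 0).eventually (gt_mem_nhds h0))] with t ht
    exact (ciInf_le (OrderBot.bddBelow _) n).trans_lt ht
  · rw [ENNReal.ofReal, ENNReal.coe_le_coe]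
    exact le_ciInf fun n => Real.toNNReal_le_toNNReal (ha n)

end Solutions

end
-- Assembly of the theorem
theorem mainTheorem5 {N : ℕ} (L : Fin N → ℝ) (hL : ∀ i, 0 < L i)
    (A : E N × ℝ → E N) (hA : IsDivFreeFlux L A)
    (u₀ : E N × E N → ℝ) (hu₀ : MemLp u₀ 1 (measXY L)) (hu₀' : MemLp u₀ ⊤ (measXY L)) :
    -- the constraint set is a non-empty closed convex set, so that the projection is well defined
    ((constraintSet L A (supNorm L u₀)).Nonempty ∧
      IsClosed (constraintSet L A (supNorm L u₀)) ∧
      Convex ℝ (constraintSet L A (supNorm L u₀))) ∧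
    -- existence and uniqueness
    (∀ lam > 0, ∀ T > 0, ∃! f : XT L T, IsBGKSolution L A u₀ lam T f) ∧
    (∀ lam > 0, ∀ T > 0, ∀ f : XT L T, IsBGKSolution L A u₀ lam T f →
      -- support in `ξ` and sign property
      (∀ t, ∀ᵐ z ∂(measXYXi L),
        (supNorm L u₀ ≤ |z.2.2| → f t z = 0) ∧
        Real.sign z.2.2 * f t z = |f t z| ∧ |f t z| ≤ 1) ∧
      -- `L²` estimate
      ‖f‖ ≤ Real.sqrt (∫ p, |u₀ p| ∂(measXY L)) ∧
      -- fundamental inequality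
      (∀ g ∈ constraintSet L A (supNorm L u₀), ∀ t, ∀ᵐ x : E N,
        ∫ w, relaxTerm (constraintSet L A (supNorm L u₀)) lam (f t) x w *
          (metricProj (constraintSet L A (supNorm L u₀)) (slice (f t) x) w - g w)
            ∂(measYXi L) ≤ 0)) ∧
    -- continuity at `t = 0`, uniform in `lam`, for well-prepared initial data
    ((∀ᵐ x : E N, IsDivFree L A (fun w => chi w.2 (u₀ (x, w.1)))) →
      ∃ m : ℝ → ℝ≥0, Tendsto m (𝓝[>] 0) (𝓝 0) ∧
        ∀ lam > 0, ∀ T > 0, ∀ f : XT L T, IsBGKSolution L A u₀ lam T f →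
          ∀ t : Set.Icc (0 : ℝ) T,
            eLpNorm (fun z => f t z - initialDatum u₀ z) 1 (measXYXi L) ≤ (m t : ℝ≥0∞)) := by
  have hM : 0 ≤ supNorm L u₀ := ENNReal.toReal_nonneg
  have h0 := zero_mem_constraintSet (A := A) (M := supNorm L u₀) hL
  have hKc := isClosed_constraintSet (M := supNorm L u₀) hL hA
  have hKx := convex_constraintSet (M := supNorm L u₀) hL hA
  have hS := isIsometryGroup_transport hA
  have hP := lipschitzWith_sliceProj h0 hKc hKx
  obtain ⟨u, hum, hub, huu⟩ := exists_bounded_rep hu₀'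
  have hu1 : MemLp u 1 (measXY L) := (memLp_congr_ae huu).1 hu₀
  obtain ⟨F₀, hF₀⟩ : ∃ F₀ : L2XYXi L, F₀ =ᵐ[measXYXi L] initialDatum u :=
    ⟨(memLp_initialDatum hum hu1).toLp _, MemLp.coeFn_toLp _⟩
  have hF₀' : F₀ =ᵐ[measXYXi L] initialDatum u₀ := hF₀.trans (initialDatum_congr huu).symm
  have hkin : ∀ᵐ z ∂(measXYXi L), F₀ z ∈ kinInterval (supNorm L u₀) z.2.2 := by
    filter_upwards [hF₀] with z hz
    rw [hz]
    exact chi_mem_kinInterval (hub _)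
  have hsq : ∀ᵐ z ∂(measXYXi L), F₀ z ^ 2 = |F₀ z| := by
    filter_upwards [hF₀] with z hz
    rw [hz]
    exact chi_sq _ _
  have hset : F₀ ∈ kinSet L (supNorm L u₀) (eLpNorm F₀ 1 (measXYXi L)) := ⟨hkin, le_refl (eLpNorm F₀ 1 (measXYXi L))⟩
  have hnorm : ‖F₀‖ = Real.sqrt (∫ p, |u₀ p| ∂(measXY L)) := by
    rw [← Real.sqrt_sq (norm_nonneg F₀), norm_sq_of_initialDatum hum hF₀]
    congr 1
    refine integral_congr_ae ?_
    filter_upwards [huu] with p hp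
    rw [hp]
  refine ⟨⟨⟨0, h0⟩, hKc, hKx⟩, fun lam hlam T hT => ?_, fun lam hlam T hT f hf => ⟨fun t => ?_, ?_,
    fun g hg t => Eventually.of_forall (integral_relaxTerm_mul_le hL hA hlam hg)⟩, fun hw => ?_⟩
  · simp_rw [isBGKSolution_iff_isMild hL hA hT hF₀']
    exact existsUnique_isMild hS hP hlam F₀ hT.le
  · exact ae_of_mem_kinSet
      (((isBGKSolution_iff_isMild hL hA hT hF₀' f).1 hf).mem_kinSet hL hA hM hlam hset t)
  · rw [← hnorm, ContinuousMap.norm_le _ (norm_nonneg _)]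
    exact ((isBGKSolution_iff_isMild hL hA hT hF₀' f).1 hf).norm_le hL hA hlam
  · have hFK := mem_sliceSet_of_wellPrepared hL hub hF₀ hF₀' hw
    -- The approximations h n and the slopes C n depend only on the datum and the flux, which makes
    -- the modulus independent of lam, T and f.
    choose h hδ hh C _ hC using fun n : ℕ => exists_regular_approx hL hA hF₀
      (measurable_initialDatum hum) (fun z => abs_chi_le _ _)
      (fun z => (mem_kinInterval_iff.1 (chi_mem_kinInterval (hub (z.1, z.2.1)))).1) hFK
      (δ := 1 / ((n : ℝ) + 1)) (by positivity)
    obtain ⟨m, hm0, hm⟩ := exists_modulus (2 * ‖F₀‖) C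
    refine ⟨m, hm0, fun lam hlam T hT f hf t => ?_⟩
    have hmild := (isBGKSolution_iff_isMild hL hA hT hF₀' f).1 hf
    have e : (fun z => f t z - initialDatum u₀ z) =ᵐ[measXYXi L] (f t - F₀ : L2XYXi L) := by
      filter_upwards [Lp.coeFn_sub (f t) F₀, hF₀'] with z h1 h2
      rw [h1, Pi.sub_apply, h2]
    rw [eLpNorm_congr_ae e]
    -- The L² distance is at most ‖f(t) - h n‖ + ‖h n - f₀‖ ≤ 2/(n+1) + C n t: the approximation
    -- error enters once through the comparison at time 0 and once through the triangle inequality.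
    refine (eLpNorm_sub_le_of_mem_kinSet (hmild.mem_kinSet hL hA hM hlam hset t) hkin hsq).trans
      (hm t _ fun n => mul_le_mul_of_nonneg_left ?_ (by positivity))
    have h1 := IsMild.norm_sub_le hS hP hlam hmild (hh n) (hC n) t
    have h2 := norm_sub_le_norm_sub_add_norm_sub (f t) (h n) F₀
    have h3 := hδ n
    rw [norm_sub_rev F₀] at h1
    linarith
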